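/- Let $k$ be an algebraically closed field of characteristic zero, $\tilde G=\mathrm{SL}_2(\mathbb F_{11})$ and $G=\mathrm{PSL}_2(\mathbb F_{11})$. Irreducible $6$-dimensional representations of $\tilde G$ over $k$ exist. Let $V$ be any of them. Then the representation $\wedge^2(V^\vee)$ of $\tilde G$, viewed as the space of skew forms on $V$, contains exactly one $\tilde G$-invariant subspace $A$ of dimension $5$. Put $$Y=\{[\omega]\in\mathbb P(A) : \mathrm{rk}(\omega)\le 4\}=\mathbb P(A)\cap \mathrm{Gr}(2,V)^\vee,\qquad X=\mathrm{Gr}(2,V)\cap\mathbb P(A^\perp)\subset\mathbb P(\wedge^2 V),$$ where $\mathrm{Gr}(2,V)^\vee\subset\mathbb P(\wedge^2(V^\vee))$ is the Pfaffian cubic hypersurface and $A^\perp\subset\wedge^2V$ is the annihilator of $A$. The center of $\tilde G$ acts on $V$ by scalars, so $G$ acts on $\mathbb P(V)$, $Y$ and $X$. In suitable linear coordinates $y_1,\dots,y_5$ on $\mathbb P(A)\cong\mathbb P^4$, $Y$ is the Klein cubic threefold $$y_1^2y_2+y_2^2y_3+y_3^2y_4+y_4^2y_5+y_5^2y_1=0,$$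 and $X$ is called the associated Fano threefold of degree $14$. Moreover $$Y\times\mathbb P^2\times\mathbb P(V)\ \sim_G\ X\times\mathbb P^2\times\mathbb P(V),$$ that is, these varieties are $G$-equivariantly birational: they contain $G$-stable dense Zariski-open subsets that are $G$-equivariantly isomorphic. Here $G$ acts diagonally, with trivial action on $\mathbb P^2$ and the projectively linear action induced by $V$ on $\mathbb P(V)$. -/

import Mathlib

open scoped LinearAlgebra.Projectivization Topology

noncomputable section

namespace KleinFano

/-! ### Quasi-projective varieties in a product of three projective spaces

The base field `k` is algebraically closed, and varieties are treated classically, through their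
`k`-points. -/

section Varieties

variable (k : Type*) [Field k]

/-- `f : E → k` is a polynomial function: a polynomial in linear functionals. -/
def IsPolynomialFun {E : Type*} [AddCommGroup E] [Module k E] (f : E → k) : Prop :=
  f ∈ Algebra.adjoin k (Set.range fun l : Module.Dual k E => (l : E → k))

variable {U V W E : Type*} [AddCommGroup U] [Module k U] [AddCommGroup V] [Module k V]
  [AddCommGroup W] [Module k W] [AddCommGroup E] [Module k E]

/-- `F : U × V × W → E` is a polynomial map, multihomogeneous of some multidegree `(a, b, c)`. -/
def IsMultihomogeneous (F : U × V × W → E) : Prop :=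
  (∀ l : Module.Dual k E, IsPolynomialFun k fun x => l (F x)) ∧
    ∃ a b c : ℕ, ∀ (r s t : k) (u : U) (v : V) (w : W),
      F (r • u, s • v, t • w) = (r ^ a * s ^ b * t ^ c) • F (u, v, w)

variable {k}

/-- A choice of homogeneous coordinates of a point of a product of three projective spaces. -/
def coords (x : ℙ k U × ℙ k V × ℙ k W) : U × V × W :=
  (x.1.rep, x.2.1.rep, x.2.2.rep)

variable (k U V W) in
/-- The Zariski topology on `ℙ(U) × ℙ(V) × ℙ(W)`: the one generated by the non-vanishing loci of
multihomogeneous polynomials. (It is finer than the product of the Zariski topologies.) -/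
abbrev zariski : TopologicalSpace (ℙ k U × ℙ k V × ℙ k W) :=
  TopologicalSpace.generateFrom
    {D | ∃ f : U × V × W → k, IsMultihomogeneous k f ∧ D = {x | f (coords x) ≠ 0}}

/-- `O` is a Zariski-open dense subset of the subvariety `S`. -/
def IsOpenDenseIn (O S : Set (ℙ k U × ℙ k V × ℙ k W)) : Prop :=
  (∃ N, IsOpen[zariski k U V W] N ∧ O = S ∩ N) ∧ S ⊆ @closure _ (zariski k U V W) O

variable {U' V' W' : Type*} [AddCommGroup U'] [Module k U'] [AddCommGroup V'] [Module k V']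
  [AddCommGroup W'] [Module k W']

/-- `φ` is a morphism on the (locally closed) set `O`: locally in the Zariski topology its three
components are given in homogeneous coordinates by multihomogeneous polynomial maps without
common zeros. -/
def IsRegularOn (φ : ℙ k U × ℙ k V × ℙ k W → ℙ k U' × ℙ k V' × ℙ k W')
    (O : Set (ℙ k U × ℙ k V × ℙ k W)) : Prop :=
  ∀ x ∈ O, ∃ N, IsOpen[zariski k U V W] N ∧ x ∈ N ∧
    ∃ (F₁ : U × V × W → U') (F₂ : U × V × W → V') (F₃ : U × V × W → W'),
      IsMultihomogeneous k F₁ ∧ IsMultihomogeneous k F₂ ∧ IsMultihomogeneous k F₃ ∧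
      ∀ y ∈ O ∩ N, ∃ (h₁ : F₁ (coords y) ≠ 0) (h₂ : F₂ (coords y) ≠ 0) (h₃ : F₃ (coords y) ≠ 0),
        φ y = (.mk k _ h₁, .mk k _ h₂, .mk k _ h₃)

/-- `S ∼_G S'`: the subvarieties `S` and `S'`, on which `G` acts through the given actions `α`
and `β` on the ambient spaces, are `G`-equivariantly birational, that is, some `G`-stable dense
open subsets of `S` and `S'` are `G`-equivariantly isomorphic. -/
def EquivariantlyBirational {G : Type*} [Group G]
    (α : G →* Equiv.Perm (ℙ k U × ℙ k V × ℙ k W)) (S : Set (ℙ k U × ℙ k V × ℙ k W))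
    (β : G →* Equiv.Perm (ℙ k U' × ℙ k V' × ℙ k W')) (S' : Set (ℙ k U' × ℙ k V' × ℙ k W')) :
    Prop :=
  ∃ φ : PartialEquiv (ℙ k U × ℙ k V × ℙ k W) (ℙ k U' × ℙ k V' × ℙ k W'),
    IsOpenDenseIn φ.source S ∧ IsOpenDenseIn φ.target S' ∧
    IsRegularOn φ φ.source ∧ IsRegularOn φ.symm φ.target ∧
    ∀ g : G, ∀ x ∈ φ.source, α g x ∈ φ.source ∧ φ (α g x) = β g (φ x)

end Varieties

/-! ### Group actions -/

/-- The diagonal action on a product of three sets. -/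
def prodAction {G X Y Z : Type*} [Group G] (a : G →* Equiv.Perm X) (b : G →* Equiv.Perm Y)
    (c : G →* Equiv.Perm Z) : G →* Equiv.Perm (X × Y × Z) where
  toFun g := (a g).prodCongr ((b g).prodCongr (c g))
  map_one' := by ext x <;> simp
  map_mul' g h := by ext x <;> simp

section Actions

variable {k : Type*} [Field k] {H : Type*} [Group H] {V E : Type*} [AddCommGroup V] [Module k V]
  [AddCommGroup E] [Module k E]

theorem rep_injective (σ : Representation k H E) (g : H) : Function.Injective (σ g) :=
  Function.LeftInverse.injective (g := σ g⁻¹) fun x => by simp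

/-- The action on `ℙ(E)` induced by a linear representation on `E`. -/
def projAction (σ : Representation k H E) : H →* Equiv.Perm (ℙ k E) where
  toFun g :=
    { toFun := Projectivization.map (σ g) (rep_injective σ g)
      invFun := Projectivization.map (σ g⁻¹) (rep_injective σ g⁻¹)
      left_inv := fun x => by
        induction x using Projectivization.ind with
        | _ v hv => simp [Projectivization.map_mk]
      right_inv := fun x => by
        induction x using Projectivization.ind with
        | _ v hv => simp [Projectivization.map_mk] }
  map_one' := by
    ext x
    induction x using Projectivization.ind with
    | _ v hv => simp [Projectivization.map_mk]
  map_mul' g h := by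
    ext x
    induction x using Projectivization.ind with
    | _ v hv => simp [Projectivization.map_mk]

theorem projAction_mk (σ : Representation k H E) (g : H) (v : E) (hv : v ≠ 0) :
    projAction σ g (.mk k v hv) =
      .mk k (σ g v) (fun h => hv (rep_injective σ g (h.trans (map_zero _).symm))) := rfl

theorem projAction_eq_one (σ : Representation k H E) (g : H) (c : k) (h : ∀ v, σ g v = c • v) :
    projAction σ g = 1 := by
  ext x
  induction x using Projectivization.ind with
  | _ v hv =>
    rw [projAction_mk, Equiv.Perm.one_apply, Projectivization.mk_eq_mk_iff']
    exact ⟨c, (h v).symm⟩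

/-- The representation `⋀²(V^∨)` on skew bilinear forms on `V`:
`(g • ω)(v, w) = ω(g⁻¹ v, g⁻¹ w)`. -/
def formRep (ρ : Representation k H V) : Representation k H (V [⋀^Fin 2]→ₗ[k] k) where
  toFun g :=
    { toFun := fun ω => ω.compLinearMap (ρ g⁻¹)
      map_add' := fun ω η => by ext; simp
      map_smul' := fun c ω => by ext; simp }
  map_one' := by ext; simp
  map_mul' g h := by ext; simp

/-- The representation `⋀² V`. -/
def bivectorRep (ρ : Representation k H V) : Representation k H (⋀[k]^2 V) where
  toFun g := exteriorPower.map 2 (ρ g)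
  map_one' := by rw [map_one, Module.End.one_eq_id, exteriorPower.map_id]; rfl
  map_mul' g h := by rw [map_mul, Module.End.mul_eq_comp, exteriorPower.map_comp]; rfl

/-- Schur's lemma: the centre acts by scalars in an irreducible representation. -/
theorem center_scalar [IsAlgClosed k] [FiniteDimensional k V] (ρ : Representation k H V)
    [ρ.IsIrreducible] {z : H} (hz : z ∈ Subgroup.center H) : ∃ c : k, ∀ v, ρ z v = c • v := by
  let f : Representation.IntertwiningMap ρ ρ :=
    { toLinearMap := ρ z
      isIntertwining' := fun g => by
        rw [← Module.End.mul_eq_comp, ← Module.End.mul_eq_comp, ← map_mul, ← map_mul,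
          Subgroup.mem_center_iff.mp hz g] }
  obtain ⟨c, hc⟩ :=
    (Representation.IsIrreducible.algebraMap_intertwiningMap_bijective_of_isAlgClosed
      (ρ := ρ)).2 f
  exact ⟨c, fun v => (congrArg (fun m : Representation.IntertwiningMap ρ ρ => m v) hc).symm⟩

end Actions

/-- `SL₂(𝔽₁₁)`. -/
abbrev SL211 : Type := Matrix.SpecialLinearGroup (Fin 2) (ZMod 11)

/-- `PSL₂(𝔽₁₁)`. -/
abbrev PSL211 : Type := Matrix.ProjectiveSpecialLinearGroup (Fin 2) (ZMod 11)

section Klein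

variable {k : Type*} [Field k] {V : Type*} [AddCommGroup V] [Module k V]

/-- The action of `PSL₂(𝔽₁₁)` on `ℙ(E)` induced by a representation of `SL₂(𝔽₁₁)` on `E` whose
centre acts by scalars. -/
def pslAction {E : Type*} [AddCommGroup E] [Module k E] (σ : Representation k SL211 E)
    (hσ : ∀ z ∈ Subgroup.center SL211, ∃ c : k, ∀ v, σ z v = c • v) :
    PSL211 →* Equiv.Perm (ℙ k E) :=
  QuotientGroup.lift _ (projAction σ) fun z hz =>
    (hσ z hz).elim fun c hc => projAction_eq_one σ z c hc

theorem formRep_scalar {H : Type*} [Group H] (ρ : Representation k H V)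
    (h : ∀ z ∈ Subgroup.center H, ∃ c : k, ∀ v, ρ z v = c • v) :
    ∀ z ∈ Subgroup.center H, ∃ c : k, ∀ v, formRep ρ z v = c • v := by
  intro z hz
  obtain ⟨c, hc⟩ := h z⁻¹ (inv_mem hz)
  refine ⟨c * c, fun ω => ?_⟩
  ext v
  change ω (fun i => ρ z⁻¹ (v i)) = c * c * ω v
  simp only [hc]
  simpa [Fin.prod_univ_two, ← pow_two] using ω.toMultilinearMap.map_smul_univ (fun _ => c) v

theorem bivectorRep_scalar {H : Type*} [Group H] (ρ : Representation k H V)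
    (h : ∀ z ∈ Subgroup.center H, ∃ c : k, ∀ v, ρ z v = c • v) :
    ∀ z ∈ Subgroup.center H, ∃ c : k, ∀ v, bivectorRep ρ z v = c • v := by
  intro z hz
  obtain ⟨c, hc⟩ := h z hz
  refine ⟨c * c, fun ξ => ?_⟩
  have : exteriorPower.map 2 (ρ z) = (c * c) • (LinearMap.id : ⋀[k]^2 V →ₗ[k] ⋀[k]^2 V) := by
    apply exteriorPower.linearMap_ext
    ext1 v
    have := (exteriorPower.ιMulti k 2 (M := V)).toMultilinearMap.map_smul_univ (fun _ => c) v
    simpa [Fin.prod_univ_two, Function.comp_def, hc, ← pow_two] using this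
  exact congrArg (fun m => m ξ) this

/-- The action of `PSL₂(𝔽₁₁)` on `ℙ(V)` for an irreducible representation `V` of `SL₂(𝔽₁₁)`. -/
def actionV [IsAlgClosed k] [FiniteDimensional k V] (ρ : Representation k SL211 V)
    [ρ.IsIrreducible] : PSL211 →* Equiv.Perm (ℙ k V) :=
  pslAction ρ fun _ => center_scalar ρ

/-- The induced action of `PSL₂(𝔽₁₁)` on `ℙ(⋀²(V^∨))`. -/
def actionForms [IsAlgClosed k] [FiniteDimensional k V] (ρ : Representation k SL211 V)
    [ρ.IsIrreducible] : PSL211 →* Equiv.Perm (ℙ k (V [⋀^Fin 2]→ₗ[k] k)) :=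
  pslAction (formRep ρ) (formRep_scalar ρ fun _ => center_scalar ρ)

/-- The induced action of `PSL₂(𝔽₁₁)` on `ℙ(⋀² V)`. -/
def actionBivectors [IsAlgClosed k] [FiniteDimensional k V] (ρ : Representation k SL211 V)
    [ρ.IsIrreducible] : PSL211 →* Equiv.Perm (ℙ k (⋀[k]^2 V)) :=
  pslAction (bivectorRep ρ) (bivectorRep_scalar ρ fun _ => center_scalar ρ)

/-! ### The Klein cubic and the Pfaffian–Grassmannian correspondence -/

variable (k) in
/-- The Klein cubic threefold in `ℙ⁴`. -/
def kleinCubic : Set (ℙ k (Fin 5 → k)) :=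
  {p | p.rep 0 ^ 2 * p.rep 1 + p.rep 1 ^ 2 * p.rep 2 + p.rep 2 ^ 2 * p.rep 3 +
    p.rep 3 ^ 2 * p.rep 4 + p.rep 4 ^ 2 * p.rep 0 = 0}

/-- The rank of a skew form `ω`, that is, of the map `v ↦ ω(v, ·)`. -/
def formRank (ω : V [⋀^Fin 2]→ₗ[k] k) : ℕ :=
  Module.finrank k (LinearMap.range ω.curryLeft)

/-- `Y = ℙ(A) ∩ Gr(2, V)^∨`, where `Gr(2, V)^∨ ⊆ ℙ(⋀²(V^∨))` is the Pfaffian hypersurface of skew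
forms of rank at most four (`V` has dimension six). -/
def pfaffianCubic (A : Submodule k (V [⋀^Fin 2]→ₗ[k] k)) : Set (ℙ k (V [⋀^Fin 2]→ₗ[k] k)) :=
  {p | p.rep ∈ A ∧ formRank p.rep ≤ 4}

/-- `Gr(2, V)` in its Plücker embedding: the classes of decomposable bivectors. -/
def grassmannian (k V : Type*) [Field k] [AddCommGroup V] [Module k V] :
    Set (ℙ k (⋀[k]^2 V)) :=
  {p | ∃ v w : V, p.rep = exteriorPower.ιMulti k 2 ![v, w]}

/-- The annihilator `A^⊥ ⊆ ⋀² V` of a space of skew forms. -/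
def annihilator (A : Submodule k (V [⋀^Fin 2]→ₗ[k] k)) : Submodule k (⋀[k]^2 V) :=
  ⨅ ω ∈ A, LinearMap.ker (exteriorPower.alternatingMapLinearEquiv ω)

/-- `X = Gr(2, V) ∩ ℙ(A^⊥)`. -/
def fanoThreefold (A : Submodule k (V [⋀^Fin 2]→ₗ[k] k)) : Set (ℙ k (⋀[k]^2 V)) :=
  grassmannian k V ∩ {p | p.rep ∈ annihilator A}

end Klein

end KleinFano

end

/-! For a nonzero vector `u` of `V`, the map `ω ↦ ω(u, ·)` goes from the five-dimensional space `A`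
to the five-dimensional space of linear forms killing `u`, so its kernel and cokernel have equal
dimension. Hence `u` lies in the kernel of a nonzero `ω ∈ A` exactly when it lies in a plane
isotropic for all of `A`; when the common dimension is one, `u` determines both the form and the
plane. The kernel planes over `Y` and the tautological planes over `X` thus sweep out the same
hypersurface of `ℙ(V)`. A general hyperplane of `V` meets a kernel plane and an isotropic plane in
one line each, and matching these lines gives a birational map between `Y` and `X`.

No fixed hyperplane is invariant under the group. It is therefore made to depend on the point of
`ℙ(V)`, through an equivariant homogeneous polynomial map `ℓ : V → V^∨` whose image lies in no
hypersurface (`exists_equivariant_covector`). The resulting correspondence (`Corresponds`) is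
equivariant and keeps the point of `ℙ(V)`; the factor `ℙ²` is carried along and may be any
projective space.

Density of the domains is checked over every point of `Y` and of `X`, so irreducibility of these
varieties is not needed. The essential points are that no nonzero form in `A` has rank two
(`kAdj_ne_zero`) and that every plane in `V` contains a vector killed by at most one form up to
scaling (`exists_isCorankOne`). Both are explicit computations in coordinates where `A` is spanned
by `x₀ ∧ xᵢ + xᵢ₊₁ ∧ xᵢ₊₂`. Local polynomial formulas come from the Pfaffian adjoint and from
adjugates (`isLocallyPolynomial_forms`, `isLocallyPolynomial_bivectors`).

These coordinates exist for every irreducible `V` of dimension six (`exists_isWeylFrame`). A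
transvection has eigenvalues `1` and `z ^ s`, with `s` running over the nonzero squares modulo `11`,
for a suitable primitive root `z`; Bruhat relations and Fourier inversion then determine the Weyl
element. Invariance of `A` becomes a list of cyclotomic identities, and its uniqueness a weight
argument (`IsWeylFrame.eq_range_of_finrank`). A representation `V` is found inside the
twelve-dimensional space of functions on the plane over `𝔽₁₁` homogeneous for the quadratic
character (`exists_isIrreducible`). -/

namespace KleinFano

/-! ### Matrices of corank one -/

section Corank

variable {k : Type*} [Field k] {n : Type*} [Fintype n] [DecidableEq n]

open Matrix in
/-- If the adjugate of a singular matrix has a non-zero entry, the kernel is spanned by the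
corresponding column of the adjugate. -/
theorem mem_span_adjugate_col {N : Matrix n n k} (hN : N.det = 0) {j r : n}
    (h : N.adjugate j r ≠ 0) {x : n → k} (hx : N *ᵥ x = 0) :
    ∃ c : k, x = c • fun i => N.adjugate i r := by
  set w : n → k := fun i => N.adjugate i r with hw
  have hNw : N *ᵥ w = 0 := by
    have h1 : N * N.adjugate = 0 := by rw [Matrix.mul_adjugate, hN, zero_smul]
    ext i
    exact congrFun (congrFun h1 i) r
  -- This scalar makes the `j`-th coordinate of the difference vanish, and `N.adjugate j r` is the
  -- determinant of `N` with row `r` replaced by that coordinate.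
  refine ⟨x j / w j, ?_⟩
  have hdet : (N.updateRow r (Pi.single j 1)).det ≠ 0 := by
    rwa [← Matrix.adjugate_apply]
  rw [← sub_eq_zero]
  refine Matrix.eq_zero_of_mulVec_eq_zero hdet ?_
  have hN0 : N *ᵥ (x - (x j / w j) • w) = 0 := by
    rw [Matrix.mulVec_sub, Matrix.mulVec_smul, hNw, hx, smul_zero, sub_zero]
  ext i
  by_cases hi : i = r
  · subst hi
    have : w j ≠ 0 := h
    simp [Matrix.mulVec, Matrix.updateRow_self, single_dotProduct, this]
  · simpa [Matrix.mulVec, Matrix.updateRow_ne hi] using congrFun hN0 i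

open Matrix in
/-- Similarly the left kernel is spanned by a row of the adjugate. -/
theorem mem_span_adjugate_row {N : Matrix n n k} (hN : N.det = 0) {j r : n}
    (h : N.adjugate j r ≠ 0) {x : n → k} (hx : x ᵥ* N = 0) :
    ∃ c : k, x = c • fun i => N.adjugate j i := by
  have := mem_span_adjugate_col (N := Nᵀ) (j := r) (r := j) (x := x)
    (by rwa [Matrix.det_transpose]) (by rwa [← Matrix.adjugate_transpose, Matrix.transpose_apply])
    (by rwa [Matrix.mulVec_transpose])
  simpa only [← Matrix.adjugate_transpose, Matrix.transpose_apply] using this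

open Matrix in
-- A left kernel vector with nonzero entry at `r` makes row `r` redundant. Replacing this row by a
-- coordinate that is nonzero on the kernel line leaves a nonsingular matrix, whose determinant is
-- an entry of the adjugate.
theorem adjugate_ne_zero_of_ker {N : Matrix n n k} {x₀ : n → k} (hx₀ : x₀ ≠ 0)
    (hN : N *ᵥ x₀ = 0) (h : ∀ x, N *ᵥ x = 0 → ∃ c : k, x = c • x₀) :
    ∃ j r, N.adjugate j r ≠ 0 := by
  have hdet : N.det = 0 := by
    by_contra hd
    exact hx₀ (Matrix.eq_zero_of_mulVec_eq_zero hd hN)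
  obtain ⟨j, hj⟩ := Function.ne_iff.mp hx₀
  obtain ⟨y, hy0, hy⟩ := Matrix.exists_vecMul_eq_zero_iff.mpr hdet
  obtain ⟨r, hr⟩ := Function.ne_iff.mp hy0
  refine ⟨j, r, ?_⟩
  rw [Matrix.adjugate_apply]
  intro hd
  obtain ⟨x, hx0, hx⟩ := Matrix.exists_mulVec_eq_zero_iff.mpr hd
  have hrow : ∀ i, i ≠ r → (N *ᵥ x) i = 0 := fun i hi => by
    simpa [Matrix.mulVec, Matrix.updateRow_ne hi] using congrFun hx i
  have hxj : x j = 0 := by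
    simpa [Matrix.mulVec, Matrix.updateRow_self, single_dotProduct] using congrFun hx r
  have hr0 : (N *ᵥ x) r = 0 := by
    have h1 : y ⬝ᵥ (N *ᵥ x) = 0 := by rw [Matrix.dotProduct_mulVec, hy, zero_dotProduct]
    rw [dotProduct, Finset.sum_eq_single r (fun i _ hi => by rw [hrow i hi, mul_zero])
      (fun h => absurd (Finset.mem_univ r) h)] at h1
    exact (mul_eq_zero.mp h1).resolve_left hr
  obtain ⟨c, hc⟩ := h x (by ext i; by_cases hi : i = r; (· rw [hi]; exact hr0); exact hrow i hi)
  have : c = 0 := by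
    have := congrFun hc j
    rw [hxj, Pi.smul_apply, smul_eq_mul] at this
    exact (mul_eq_zero.mp this.symm).resolve_right hj
  exact hx0 (by rw [hc, this, zero_smul])

end Corank

/-! ### The net of skew forms in coordinates

`V = k⁶` has coordinates `u 0, …, u 5`; the five-dimensional space of skew forms is spanned by
`x₀ ∧ xᵢ + xᵢ₊₁ ∧ xᵢ₊₂`, where `1 ≤ i ≤ 5` and indices are cyclic. -/

section Coordinates

variable {k : Type*} [Field k]

/-- The coefficients of the linear form `w ↦ ω_y(u, w)`. -/
def kRow (y : Fin 5 → k) (u : Fin 6 → k) : Fin 6 → k :=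
  ![-(y 0 * u 1 + y 1 * u 2 + y 2 * u 3 + y 3 * u 4 + y 4 * u 5),
    y 0 * u 0 + y 3 * u 5 - y 4 * u 2,
    y 1 * u 0 + y 4 * u 1 - y 0 * u 3,
    y 2 * u 0 + y 0 * u 2 - y 1 * u 4,
    y 3 * u 0 + y 1 * u 3 - y 2 * u 5,
    y 4 * u 0 + y 2 * u 4 - y 3 * u 1]

/-- The skew form `ω_y = ∑ yᵢ (x₀ ∧ xᵢ + xᵢ₊₁ ∧ xᵢ₊₂)`. -/
def kForm (y : Fin 5 → k) (u w : Fin 6 → k) : k := kRow y u ⬝ᵥ w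

/-- The Pfaffian of `ω_y`. -/
def kPf (y : Fin 5 → k) : k :=
  y 0 ^ 2 * y 2 + y 1 ^ 2 * y 3 + y 2 ^ 2 * y 4 + y 3 ^ 2 * y 0 + y 4 ^ 2 * y 1

/-- The Pfaffian adjoint of `ω_y`, applied to a linear form. -/
def kAdj (y : Fin 5 → k) (l : Fin 6 → k) : Fin 6 → k :=
  ![y 0 * y 2 * l 1 + y 1 * y 3 * l 2 + y 2 * y 4 * l 3 + y 3 * y 0 * l 4 + y 4 * y 1 * l 5,
    -(y 0 * y 2 * l 0) + (y 2 ^ 2 + y 1 * y 4) * l 2 - (y 1 ^ 2 + y 0 * y 3) * l 5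
      - y 1 * y 2 * l 3 + y 4 * y 0 * l 4,
    -(y 1 * y 3 * l 0) + (y 3 ^ 2 + y 2 * y 0) * l 3 - (y 2 ^ 2 + y 1 * y 4) * l 1
      - y 2 * y 3 * l 4 + y 0 * y 1 * l 5,
    -(y 2 * y 4 * l 0) + (y 4 ^ 2 + y 3 * y 1) * l 4 - (y 3 ^ 2 + y 2 * y 0) * l 2
      - y 3 * y 4 * l 5 + y 1 * y 2 * l 1,
    -(y 3 * y 0 * l 0) + (y 0 ^ 2 + y 4 * y 2) * l 5 - (y 4 ^ 2 + y 3 * y 1) * l 3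
      - y 4 * y 0 * l 1 + y 2 * y 3 * l 2,
    -(y 4 * y 1 * l 0) + (y 1 ^ 2 + y 0 * y 3) * l 1 - (y 0 ^ 2 + y 4 * y 2) * l 4
      - y 0 * y 1 * l 2 + y 3 * y 4 * l 3]

theorem forall_fin_six {P : Fin 6 → Prop} :
    (∀ i, P i) ↔ P 0 ∧ P 1 ∧ P 2 ∧ P 3 ∧ P 4 ∧ P 5 := by
  constructor
  · intro h; exact ⟨h 0, h 1, h 2, h 3, h 4, h 5⟩
  · rintro ⟨h0, h1, h2, h3, h4, h5⟩ i
    fin_cases i <;> assumption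

theorem kRow_eq_zero_iff {y : Fin 5 → k} {u : Fin 6 → k} : kRow y u = 0 ↔
    y 0 * u 1 + y 1 * u 2 + y 2 * u 3 + y 3 * u 4 + y 4 * u 5 = 0 ∧
    y 0 * u 0 + y 3 * u 5 - y 4 * u 2 = 0 ∧ y 1 * u 0 + y 4 * u 1 - y 0 * u 3 = 0 ∧
    y 2 * u 0 + y 0 * u 2 - y 1 * u 4 = 0 ∧ y 3 * u 0 + y 1 * u 3 - y 2 * u 5 = 0 ∧
    y 4 * u 0 + y 2 * u 4 - y 3 * u 1 = 0 := by
  rw [funext_iff, forall_fin_six]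
  simp [kRow, -neg_add_rev]

theorem dotProduct_six (l u : Fin 6 → k) :
    l ⬝ᵥ u = l 0 * u 0 + l 1 * u 1 + l 2 * u 2 + l 3 * u 3 + l 4 * u 4 + l 5 * u 5 := by
  simp [dotProduct, Fin.sum_univ_six]

theorem kForm_eq (y : Fin 5 → k) (u w : Fin 6 → k) : kForm y u w =
    y 0 * (u 0 * w 1 - u 1 * w 0 + u 2 * w 3 - u 3 * w 2) +
    y 1 * (u 0 * w 2 - u 2 * w 0 + u 3 * w 4 - u 4 * w 3) +
    y 2 * (u 0 * w 3 - u 3 * w 0 + u 4 * w 5 - u 5 * w 4) +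
    y 3 * (u 0 * w 4 - u 4 * w 0 + u 5 * w 1 - u 1 * w 5) +
    y 4 * (u 0 * w 5 - u 5 * w 0 + u 1 * w 2 - u 2 * w 1) := by
  rw [kForm, dotProduct_six]
  simp [kRow]
  ring

theorem kForm_self (y : Fin 5 → k) (u : Fin 6 → k) : kForm y u u = 0 := by
  rw [kForm_eq]; ring

theorem kForm_swap (y : Fin 5 → k) (u w : Fin 6 → k) : kForm y u w = -kForm y w u := by
  rw [kForm_eq, kForm_eq]; ring

theorem kForm_of_kRow {y : Fin 5 → k} {u : Fin 6 → k} (h : kRow y u = 0) (w : Fin 6 → k) :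
    kForm y u w = 0 := by rw [kForm, h, zero_dotProduct]

theorem kRow_eq_zero_of_kForm {y : Fin 5 → k} {u : Fin 6 → k} (h : ∀ w, kForm y u w = 0) :
    kRow y u = 0 := dotProduct_eq_zero_iff.mp h

theorem kForm_smul_add (y : Fin 5 → k) (u w w' : Fin 6 → k) (a b : k) :
    kForm y u (a • w + b • w') = a * kForm y u w + b * kForm y u w' := by
  simp [kForm, dotProduct_add, dotProduct_smul]

theorem kForm_smul_add_left (y : Fin 5 → k) (u w w' : Fin 6 → k) (a b : k) :
    kForm y (a • w + b • w') u = a * kForm y w u + b * kForm y w' u := by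
  rw [kForm_swap, kForm_smul_add, kForm_swap y u, kForm_swap y u]; ring

theorem kRow_smul (y : Fin 5 → k) (u : Fin 6 → k) (c : k) : kRow y (c • u) = c • kRow y u := by
  funext i
  revert i
  rw [forall_fin_six]
  simp [kRow]
  refine ⟨?_, ?_, ?_, ?_, ?_, ?_⟩ <;> ring

theorem kRow_smul_left (y : Fin 5 → k) (u : Fin 6 → k) (c : k) :
    kRow (c • y) u = c • kRow y u := by
  funext i
  revert i
  rw [forall_fin_six]
  simp [kRow]
  refine ⟨?_, ?_, ?_, ?_, ?_, ?_⟩ <;> ring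

theorem kRow_sub_left (y y' : Fin 5 → k) (u : Fin 6 → k) :
    kRow (y - y') u = kRow y u - kRow y' u := by
  funext i
  revert i
  rw [forall_fin_six]
  simp [kRow]
  refine ⟨?_, ?_, ?_, ?_, ?_, ?_⟩ <;> ring

theorem kRow_sub (y : Fin 5 → k) (u u' : Fin 6 → k) :
    kRow y (u - u') = kRow y u - kRow y u' := by
  funext i
  revert i
  rw [forall_fin_six]
  simp [kRow]
  refine ⟨?_, ?_, ?_, ?_, ?_, ?_⟩ <;> ring

/-- The Pfaffian version of the adjugate identity, of half the degree. On the cubic it says that the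
adjoint takes values in the kernel of the form. -/
theorem kRow_kAdj (y : Fin 5 → k) (l : Fin 6 → k) : kRow y (kAdj y l) = kPf y • l := by
  funext i
  revert i
  rw [forall_fin_six]
  simp [kRow, kAdj, kPf]
  refine ⟨?_, ?_, ?_, ?_, ?_, ?_⟩ <;> ring

theorem kAdj_kRow (y : Fin 5 → k) (u : Fin 6 → k) : kAdj y (kRow y u) = kPf y • u := by
  funext i
  revert i
  rw [forall_fin_six]
  simp [kRow, kAdj, kPf]
  refine ⟨?_, ?_, ?_, ?_, ?_, ?_⟩ <;> ring

/-- The adjoint is itself skew, so it sends `l` into the hyperplane `l = 0`. On the cubic it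
therefore produces the kernel vector lying on this hyperplane. -/
theorem dotProduct_kAdj_self (y : Fin 5 → k) (l : Fin 6 → k) : l ⬝ᵥ kAdj y l = 0 := by
  rw [dotProduct_six]
  simp [kAdj]
  ring

theorem dotProduct_kAdj (y : Fin 5 → k) (l m : Fin 6 → k) :
    l ⬝ᵥ kAdj y m = -(m ⬝ᵥ kAdj y l) := by
  rw [dotProduct_six, dotProduct_six]
  simp [kAdj]
  ring

/-- If `u ∈ ker ω_y` then `ω_y^♯ ∧ u = 0`; here this trivector is contracted with two forms. -/
theorem kAdj_wedge {y : Fin 5 → k} {u : Fin 6 → k} (h : kRow y u = 0) (l m : Fin 6 → k)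
    (i : Fin 6) :
    (m ⬝ᵥ kAdj y l) * u i = (m ⬝ᵥ u) * kAdj y l i - (l ⬝ᵥ u) * kAdj y m i := by
  obtain ⟨h0, h1, h2, h3, h4, h5⟩ := kRow_eq_zero_iff.mp h
  revert i
  rw [forall_fin_six, dotProduct_six, dotProduct_six, dotProduct_six]
  simp [kAdj]
  -- Each coordinate is a combination of the six components of `ω_y(u, ·)`, with coefficients linear
  -- in `y` and in the `2 × 2` minors of `l` and `m`.
  refine ⟨?_, ?_, ?_, ?_, ?_, ?_⟩
  · linear_combination (- y 2 * (l 2 * m 3 - l 3 * m 2) - y 1 * (l 2 * m 5 - l 5 * m 2) - y 0 * (l 4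
      * m 5 - l 5 * m 4)) * h1 + (y 2 * (l 1 * m 3 - l 3 * m 1) + y 1 * (l 1 * m 5 - l 5 * m 1) -
      y 3 * (l 3 * m 4 - l 4 * m 3)) * h2 + (- y 2 * (l 1 * m 2 - l 2 * m 1) + y 3 * (l 2 * m 4 -
      l 4 * m 2) - y 4 * (l 4 * m 5 - l 5 * m 4)) * h3 + (y 0 * (l 1 * m 5 - l 5 * m 1) - y 3 * (l
      2 * m 3 - l 3 * m 2) + y 4 * (l 3 * m 5 - l 5 * m 3)) * h4 + (- y 1 * (l 1 * m 2 - l 2 * m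
      1) - y 0 * (l 1 * m 4 - l 4 * m 1) - y 4 * (l 3 * m 4 - l 4 * m 3)) * h5
  · linear_combination (y 2 * (l 2 * m 3 - l 3 * m 2) + y 1 * (l 2 * m 5 - l 5 * m 2) + y 0 * (l 4 *
      m 5 - l 5 * m 4)) * (-1) * h0 + (- y 2 * (l 0 * m 3 - l 3 * m 0) - y 1 * (l 0 * m 5 - l 5 *
      m 0) - y 4 * (l 3 * m 4 - l 4 * m 3) + y 3 * (l 3 * m 5 - l 5 * m 3) - y 2 * (l 4 * m 5 - l
      5 * m 4)) * h2 + (y 2 * (l 0 * m 2 - l 2 * m 0) + y 4 * (l 2 * m 4 - l 4 * m 2) - y 3 * (l 2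
      * m 5 - l 5 * m 2) + y 1 * (l 4 * m 5 - l 5 * m 4)) * h3 + (- y 0 * (l 0 * m 5 - l 5 * m 0)
      - y 4 * (l 2 * m 3 - l 3 * m 2) + y 2 * (l 2 * m 5 - l 5 * m 2) - y 1 * (l 3 * m 5 - l 5 * m
      3)) * h4 + (y 1 * (l 0 * m 2 - l 2 * m 0) + y 0 * (l 0 * m 4 - l 4 * m 0) + y 3 * (l 2 * m 3
      - l 3 * m 2) - y 2 * (l 2 * m 4 - l 4 * m 2) + y 1 * (l 3 * m 4 - l 4 * m 3)) * h5
  · linear_combination (- y 2 * (l 1 * m 3 - l 3 * m 1) - y 1 * (l 1 * m 5 - l 5 * m 1) + y 3 * (l 3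
      * m 4 - l 4 * m 3)) * (-1) * h0 + (y 2 * (l 0 * m 3 - l 3 * m 0) + y 1 * (l 0 * m 5 - l 5 *
      m 0) + y 4 * (l 3 * m 4 - l 4 * m 3) - y 3 * (l 3 * m 5 - l 5 * m 3) + y 2 * (l 4 * m 5 - l
      5 * m 4)) * h1 + (- y 2 * (l 0 * m 1 - l 1 * m 0) - y 3 * (l 0 * m 4 - l 4 * m 0) - y 4 * (l
      1 * m 4 - l 4 * m 1) + y 3 * (l 1 * m 5 - l 5 * m 1) - y 0 * (l 4 * m 5 - l 5 * m 4)) * h3 +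
      (y 3 * (l 0 * m 3 - l 3 * m 0) + y 4 * (l 1 * m 3 - l 3 * m 1) - y 2 * (l 1 * m 5 - l 5 * m
      1) + y 0 * (l 3 * m 5 - l 5 * m 3)) * h4 + (- y 1 * (l 0 * m 1 - l 1 * m 0) - y 3 * (l 1 * m
      3 - l 3 * m 1) + y 2 * (l 1 * m 4 - l 4 * m 1) - y 0 * (l 3 * m 4 - l 4 * m 3)) * h5
  · linear_combination (y 2 * (l 1 * m 2 - l 2 * m 1) - y 3 * (l 2 * m 4 - l 4 * m 2) + y 4 * (l 4 *
      m 5 - l 5 * m 4)) * (-1) * h0 + (- y 2 * (l 0 * m 2 - l 2 * m 0) - y 4 * (l 2 * m 4 - l 4 *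
      m 2) + y 3 * (l 2 * m 5 - l 5 * m 2) - y 1 * (l 4 * m 5 - l 5 * m 4)) * h1 + (y 2 * (l 0 * m
      1 - l 1 * m 0) + y 3 * (l 0 * m 4 - l 4 * m 0) + y 4 * (l 1 * m 4 - l 4 * m 1) - y 3 * (l 1
      * m 5 - l 5 * m 1) + y 0 * (l 4 * m 5 - l 5 * m 4)) * h2 + (- y 3 * (l 0 * m 2 - l 2 * m 0)
      - y 4 * (l 0 * m 5 - l 5 * m 0) - y 4 * (l 1 * m 2 - l 2 * m 1) + y 1 * (l 1 * m 5 - l 5 * m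
      1) - y 0 * (l 2 * m 5 - l 5 * m 2)) * h4 + (y 4 * (l 0 * m 4 - l 4 * m 0) + y 3 * (l 1 * m 2
      - l 2 * m 1) - y 1 * (l 1 * m 4 - l 4 * m 1) + y 0 * (l 2 * m 4 - l 4 * m 2)) * h5
  · linear_combination (- y 0 * (l 1 * m 5 - l 5 * m 1) + y 3 * (l 2 * m 3 - l 3 * m 2) - y 4 * (l 3
      * m 5 - l 5 * m 3)) * (-1) * h0 + (y 0 * (l 0 * m 5 - l 5 * m 0) + y 4 * (l 2 * m 3 - l 3 *
      m 2) - y 2 * (l 2 * m 5 - l 5 * m 2) + y 1 * (l 3 * m 5 - l 5 * m 3)) * h1 + (- y 3 * (l 0 *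
      m 3 - l 3 * m 0) - y 4 * (l 1 * m 3 - l 3 * m 1) + y 2 * (l 1 * m 5 - l 5 * m 1) - y 0 * (l
      3 * m 5 - l 5 * m 3)) * h2 + (y 3 * (l 0 * m 2 - l 2 * m 0) + y 4 * (l 0 * m 5 - l 5 * m 0)
      + y 4 * (l 1 * m 2 - l 2 * m 1) - y 1 * (l 1 * m 5 - l 5 * m 1) + y 0 * (l 2 * m 5 - l 5 * m
      2)) * h3 + (- y 0 * (l 0 * m 1 - l 1 * m 0) - y 4 * (l 0 * m 3 - l 3 * m 0) - y 2 * (l 1 * m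
      2 - l 2 * m 1) + y 1 * (l 1 * m 3 - l 3 * m 1) - y 0 * (l 2 * m 3 - l 3 * m 2)) * h5
  · linear_combination (y 1 * (l 1 * m 2 - l 2 * m 1) + y 0 * (l 1 * m 4 - l 4 * m 1) + y 4 * (l 3 *
      m 4 - l 4 * m 3)) * (-1) * h0 + (- y 1 * (l 0 * m 2 - l 2 * m 0) - y 0 * (l 0 * m 4 - l 4 *
      m 0) - y 3 * (l 2 * m 3 - l 3 * m 2) + y 2 * (l 2 * m 4 - l 4 * m 2) - y 1 * (l 3 * m 4 - l
      4 * m 3)) * h1 + (y 1 * (l 0 * m 1 - l 1 * m 0) + y 3 * (l 1 * m 3 - l 3 * m 1) - y 2 * (l 1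
      * m 4 - l 4 * m 1) + y 0 * (l 3 * m 4 - l 4 * m 3)) * h2 + (- y 4 * (l 0 * m 4 - l 4 * m 0)
      - y 3 * (l 1 * m 2 - l 2 * m 1) + y 1 * (l 1 * m 4 - l 4 * m 1) - y 0 * (l 2 * m 4 - l 4 * m
      2)) * h3 + (y 0 * (l 0 * m 1 - l 1 * m 0) + y 4 * (l 0 * m 3 - l 3 * m 0) + y 2 * (l 1 * m 2
      - l 2 * m 1) - y 1 * (l 1 * m 3 - l 3 * m 1) + y 0 * (l 2 * m 3 - l 3 * m 2)) * h4

/-- No nonzero form of the family has rank two. Up to sign, all `y i * y (i + 2)` and all `y i ^ 2 +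
y (i + 2) * y (i + 4)` are entries of the adjoint, so if it vanished every square would vanish. -/
theorem kAdj_ne_zero {y : Fin 5 → k} (hy : y ≠ 0) : ∃ l m : Fin 6 → k, m ⬝ᵥ kAdj y l ≠ 0 := by
  by_contra! H
  have e : ∀ i j : Fin 6, kAdj y (Pi.single i 1) j = 0 := fun i j => by
    simpa using H (Pi.single i 1) (Pi.single j 1)
  have h02 := e 1 0
  have h13 := e 2 0
  have h24 := e 3 0
  have h30 := e 4 0
  have h41 := e 5 0
  have a0 := e 5 4
  have a1 := e 1 5
  have a2 := e 2 1
  have a3 := e 3 2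
  have a4 := e 4 3
  have b0 := e 2 5
  have b1 := e 3 1
  have b2 := e 4 2
  have b3 := e 5 3
  have b4 := e 1 4
  simp [kAdj] at h02 h13 h24 h30 h41 a0 a1 a2 a3 a4 b0 b1 b2 b3 b4
  apply hy
  funext i
  fin_cases i <;> simp <;> grind

end Coordinates

/-! ### Vectors killed by at most one form, up to scaling -/

section Corank

variable {k : Type*} [Field k]

/-- At most one form `ω_y`, up to scaling, has `u` in its kernel. -/
def IsCorankOne (u : Fin 6 → k) : Prop :=
  ∃ i, ∀ y : Fin 5 → k, kRow y u = 0 → y i = 0 → y = 0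

/-- The cyclic shift of coordinates. -/
def shift (u : Fin 6 → k) : Fin 6 → k := ![u 0, u 2, u 3, u 4, u 5, u 1]

/-- The family of forms is stable under the cyclic permutation of the last five coordinates; this
reduces the case distinctions to representative indices. -/
theorem IsCorankOne.of_shift {u : Fin 6 → k} (h : IsCorankOne (shift u)) : IsCorankOne u := by
  obtain ⟨i, hi⟩ := h
  refine ⟨i + 1, fun y hy hyi => ?_⟩
  have h1 := hi (fun j => y (j + 1)) ?_ hyi
  · funext j
    have := congrFun h1 (j - 1)
    simpa using this
  · obtain ⟨h0, h1, h2, h3, h4, h5⟩ := kRow_eq_zero_iff.mp hy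
    rw [kRow_eq_zero_iff]
    simp only [shift]
    refine ⟨?_, ?_, ?_, ?_, ?_, ?_⟩ <;> simp <;> grind

theorem fin_five_eq_zero {y : Fin 5 → k} (h0 : y 0 = 0) (h1 : y 1 = 0) (h2 : y 2 = 0)
    (h3 : y 3 = 0) (h4 : y 4 = 0) : y = 0 := by
  funext i
  fin_cases i <;> assumption

/-- With `u 0 = 0` the equations have two terms each, apart from the first, and `y 1`, `y 2`
determine the rest. Which of these two suffices alone depends on which of `u 3`, `u 4`, `u 5`
vanish. -/
theorem isCorankOne_of_adjacent {u : Fin 6 → k} (h0 : u 0 = 0) (h1 : u 1 ≠ 0) (h2 : u 2 ≠ 0) :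
    IsCorankOne u := by
  have key : ∀ y : Fin 5 → k, kRow y u = 0 → y 1 = 0 → y 2 = 0 → y = 0 := by
    intro y hy y1 y2
    obtain ⟨e0, e1, e2, e3, e4, e5⟩ := kRow_eq_zero_iff.mp hy
    simp only [h0, y1, y2, mul_zero, zero_mul, zero_add, zero_sub, sub_zero] at e2 e3 e5
    have y0 : y 0 = 0 := by grind
    have y3 : y 3 = 0 := by grind
    have y4 : y 4 = 0 := by grind
    exact fin_five_eq_zero y0 y1 y2 y3 y4
  by_cases h3 : u 3 = 0
  · by_cases h5 : u 5 = 0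
    · by_cases h4 : u 4 = 0
      · refine ⟨2, fun y hy hy2 => key y hy ?_ hy2⟩
        obtain ⟨e0, e1, e2, e3, e4, e5⟩ := kRow_eq_zero_iff.mp hy
        grind
      · refine ⟨1, fun y hy hy1 => key y hy hy1 ?_⟩
        obtain ⟨e0, e1, e2, e3, e4, e5⟩ := kRow_eq_zero_iff.mp hy
        grind
    · refine ⟨1, fun y hy hy1 => key y hy hy1 ?_⟩
      obtain ⟨e0, e1, e2, e3, e4, e5⟩ := kRow_eq_zero_iff.mp hy
      grind
  · refine ⟨2, fun y hy hy2 => key y hy ?_ hy2⟩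
    obtain ⟨e0, e1, e2, e3, e4, e5⟩ := kRow_eq_zero_iff.mp hy
    grind

/-- Here `y 2` and `y 4` determine the rest, and the derived relations `e` between them show that
one of the two suffices. -/
theorem isCorankOne_of_skip {u : Fin 6 → k} (h0 : u 0 = 0) (h1 : u 1 ≠ 0) (h3 : u 3 ≠ 0) :
    IsCorankOne u := by
  have key : ∀ y : Fin 5 → k, kRow y u = 0 → y 2 = 0 → y 4 = 0 → y = 0 := by
    intro y hy y2 y4
    obtain ⟨e0, e1, e2, e3, e4, e5⟩ := kRow_eq_zero_iff.mp hy
    simp only [h0, y2, y4, mul_zero, zero_mul, zero_add, zero_sub, sub_zero, add_zero] at e2 e4 e5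
    have y0 : y 0 = 0 := by grind
    have y3 : y 3 = 0 := by grind
    have y1 : y 1 = 0 := by grind
    exact fin_five_eq_zero y0 y1 y2 y3 y4
  have e : ∀ y : Fin 5 → k, kRow y u = 0 →
      y 4 * (u 1 ^ 2 + u 5 * u 3) = -(y 2 * (u 2 * u 5 + u 3 ^ 2) + u 3 * u 4 * y 3) ∧
      y 3 * u 1 = y 2 * u 4 ∧ u 2 * u 1 * y 4 = u 4 * u 5 * y 2 := by
    intro y hy
    obtain ⟨e0, e1, e2, e3, e4, e5⟩ := kRow_eq_zero_iff.mp hy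
    simp only [h0, mul_zero, zero_add] at e1 e2 e3 e4 e5
    refine ⟨?_, by grind, ?_⟩
    · grind
    · apply mul_left_cancel₀ h3
      grind
  by_cases h2 : u 2 = 0
  · by_cases h45 : u 4 * u 5 = 0
    · by_cases hs : u 1 ^ 2 + u 5 * u 3 = 0
      · refine ⟨4, fun y hy hy4 => key y hy ?_ hy4⟩
        obtain ⟨e1, e2, e3⟩ := e y hy
        have h5 : u 5 ≠ 0 := by rintro h; simp [h, h1] at hs
        have h4 : u 4 = 0 := (mul_eq_zero.mp h45).resolve_right h5
        grind
      · refine ⟨2, fun y hy hy2 => key y hy hy2 ?_⟩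
        obtain ⟨e1, e2, e3⟩ := e y hy
        grind
    · refine ⟨4, fun y hy hy4 => key y hy ?_ hy4⟩
      obtain ⟨e1, e2, e3⟩ := e y hy
      grind
  · refine ⟨2, fun y hy hy2 => key y hy hy2 ?_⟩
    obtain ⟨e1, e2, e3⟩ := e y hy
    grind

/-- On `y 1 = 0` the equations express `y 4`, `y 2`, `y 3` through `y 0`. Substituting in the first
equation and clearing denominators leaves this quartic as the coefficient of `y 0`. -/
theorem isCorankOne_of_minor {u : Fin 6 → k} (h0 : u 0 ≠ 0) (h1 : u 1 ≠ 0)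
    (h : u 0 * u 1 ^ 3 + u 4 * u 0 ^ 2 * u 3 + u 5 * u 3 * u 1 * u 0 - u 2 * u 3 * u 1 ^ 2
      - u 2 * u 4 ^ 2 * u 1 ≠ 0) : IsCorankOne u := by
  refine ⟨1, fun y hy y1 => ?_⟩
  obtain ⟨e0, e1, e2, e3, e4, e5⟩ := kRow_eq_zero_iff.mp hy
  have y0 : y 0 = 0 := by
    refine (mul_eq_zero.mp (?_ : y 0 * _ = 0)).resolve_right h
    simp only [y1] at *
    grind
  have y4 : y 4 = 0 := by grind
  have y2 : y 2 = 0 := by grind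
  have y3 : y 3 = 0 := by grind
  exact fin_five_eq_zero y0 y1 y2 y3 y4

end Corank

/-! ### Every plane contains a vector of corank one -/

section NoLine

variable {k : Type*} [Field k]

/-- Two distinct indices modulo five are at cyclic distance one or two, so cyclic shifts reduce to
the two preceding cases. -/
theorem isCorankOne_of_two_ne_zero {u : Fin 6 → k} (h0 : u 0 = 0) {i j : Fin 6} (hij : i ≠ j)
    (hi : u i ≠ 0) (hj : u j ≠ 0) : IsCorankOne u := by
  have A1 : ∀ v : Fin 6 → k, v 0 = 0 → v 1 ≠ 0 → v 2 ≠ 0 → IsCorankOne v := fun v a b c =>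
    isCorankOne_of_adjacent a b c
  have B1 : ∀ v : Fin 6 → k, v 0 = 0 → v 1 ≠ 0 → v 3 ≠ 0 → IsCorankOne v := fun v a b c =>
    isCorankOne_of_skip a b c
  have A2 : ∀ v : Fin 6 → k, v 0 = 0 → v 2 ≠ 0 → v 3 ≠ 0 → IsCorankOne v := fun v a b c =>
    (A1 (shift v) a b c).of_shift
  have A3 : ∀ v : Fin 6 → k, v 0 = 0 → v 3 ≠ 0 → v 4 ≠ 0 → IsCorankOne v := fun v a b c =>
    (A2 (shift v) a b c).of_shift
  have A4 : ∀ v : Fin 6 → k, v 0 = 0 → v 4 ≠ 0 → v 5 ≠ 0 → IsCorankOne v := fun v a b c =>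
    (A3 (shift v) a b c).of_shift
  have A5 : ∀ v : Fin 6 → k, v 0 = 0 → v 5 ≠ 0 → v 1 ≠ 0 → IsCorankOne v := fun v a b c =>
    (A4 (shift v) a b c).of_shift
  have B2 : ∀ v : Fin 6 → k, v 0 = 0 → v 2 ≠ 0 → v 4 ≠ 0 → IsCorankOne v := fun v a b c =>
    (B1 (shift v) a b c).of_shift
  have B3 : ∀ v : Fin 6 → k, v 0 = 0 → v 3 ≠ 0 → v 5 ≠ 0 → IsCorankOne v := fun v a b c =>
    (B2 (shift v) a b c).of_shift
  have B4 : ∀ v : Fin 6 → k, v 0 = 0 → v 4 ≠ 0 → v 1 ≠ 0 → IsCorankOne v := fun v a b c =>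
    (B3 (shift v) a b c).of_shift
  have B5 : ∀ v : Fin 6 → k, v 0 = 0 → v 5 ≠ 0 → v 2 ≠ 0 → IsCorankOne v := fun v a b c =>
    (B4 (shift v) a b c).of_shift
  fin_cases i <;> fin_cases j <;> first
    | exact absurd rfl hij
    | exact absurd h0 hi
    | exact absurd h0 hj
    | exact A1 u h0 hi hj | exact A1 u h0 hj hi | exact A2 u h0 hi hj | exact A2 u h0 hj hi
    | exact A3 u h0 hi hj | exact A3 u h0 hj hi | exact A4 u h0 hi hj | exact A4 u h0 hj hi
    | exact A5 u h0 hi hj | exact A5 u h0 hj hi | exact B1 u h0 hi hj | exact B1 u h0 hj hi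
    | exact B2 u h0 hi hj | exact B2 u h0 hj hi | exact B3 u h0 hi hj | exact B3 u h0 hj hi
    | exact B4 u h0 hi hj | exact B4 u h0 hj hi | exact B5 u h0 hi hj | exact B5 u h0 hj hi

/-- The delicate planes meet `x₀ = 0` in a coordinate vector, which itself may have higher corank.
The quartic of `isCorankOne_of_minor` does not vanish identically on such a plane. -/
theorem exists_isCorankOne_through_one [Infinite k] {a b : Fin 6 → k} (h0 : a 0 = 0)
    (h1 : a 1 ≠ 0) (ha : ∀ i, i ≠ 1 → a i = 0) (hb : b 0 ≠ 0) :
    ∃ s t : k, IsCorankOne (s • a + t • b) := by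
  -- This is the quartic at `a + t b`, divided by `t`; its value at `t = 0` is `b 0 * a 1 ^ 3`.
  open Polynomial in
  let q : k[X] := C (b 0) * (C (a 1) + X * C (b 1)) ^ 3 + X ^ 3 * C (b 4 * b 0 ^ 2 * b 3)
    + X ^ 2 * C (b 5 * b 3 * b 0) * (C (a 1) + X * C (b 1))
    - X * C (b 2 * b 3) * (C (a 1) + X * C (b 1)) ^ 2
    - X ^ 2 * C (b 2 * b 4 ^ 2) * (C (a 1) + X * C (b 1))
  have hq : q ≠ 0 := by
    intro h
    have := congrArg (Polynomial.eval 0) h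
    simp [q, hb, h1] at this
  have hl : (Polynomial.C (a 1) + Polynomial.X * Polynomial.C (b 1)) ≠ 0 := by
    intro h
    have := congrArg (Polynomial.eval 0) h
    simp [h1] at this
  have hP : Polynomial.X * (Polynomial.C (a 1) + Polynomial.X * Polynomial.C (b 1)) * q ≠ 0 :=
    mul_ne_zero (mul_ne_zero Polynomial.X_ne_zero hl) hq
  obtain ⟨t, ht⟩ : ∃ t, (Polynomial.X * (Polynomial.C (a 1) + Polynomial.X *
      Polynomial.C (b 1)) * q).eval t ≠ 0 := by
    by_contra! H
    exact hP (Polynomial.funext fun r => by rw [H r, Polynomial.eval_zero])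
  rw [Polynomial.eval_mul, Polynomial.eval_mul] at ht
  obtain ⟨ht1, ht2⟩ := mul_ne_zero_iff.mp ht
  obtain ⟨ht0, ht1⟩ := mul_ne_zero_iff.mp ht1
  simp only [q, Polynomial.eval_add, Polynomial.eval_sub, Polynomial.eval_mul, Polynomial.eval_pow,
    Polynomial.eval_C, Polynomial.eval_X] at ht0 ht1 ht2
  refine ⟨1, t, isCorankOne_of_minor ?_ ?_ ?_⟩
  · simp [h0, hb, ht0]
  · simpa using ht1
  · have e2 := ha 2 (by decide)
    have e3 := ha 3 (by decide)
    have e4 := ha 4 (by decide)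
    have e5 := ha 5 (by decide)
    have := mul_ne_zero ht0 ht2
    intro h
    apply this
    simp only [Pi.add_apply, Pi.smul_apply, smul_eq_mul, one_mul, h0, e2, e3, e4, e5,
      zero_add] at h
    clear hP hl hq ht q
    generalize b 0 = b0, b 1 = b1, b 2 = b2, b 3 = b3, b 4 = b4, b 5 = b5, a 1 = a1 at h ⊢
    linear_combination h

theorem shift_comb (a b : Fin 6 → k) (s t : k) :
    shift (s • a + t • b) = s • shift a + t • shift b := by
  funext i
  fin_cases i <;> simp [shift]

theorem exists_isCorankOne_through [Infinite k] {a b : Fin 6 → k} {j : Fin 6} (hj : j ≠ 0)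
    (hj1 : a j ≠ 0) (ha : ∀ i, i ≠ j → a i = 0) (hb : b 0 ≠ 0) :
    ∃ s t : k, IsCorankOne (s • a + t • b) := by
  have step : ∀ {a b : Fin 6 → k}, (∃ s t : k, IsCorankOne (s • shift a + t • shift b)) →
      ∃ s t : k, IsCorankOne (s • a + t • b) := by
    rintro a b ⟨s, t, h⟩
    exact ⟨s, t, IsCorankOne.of_shift (by rwa [shift_comb])⟩
  have ha0 : a 0 = 0 := ha 0 hj.symm
  have h1 : a 1 ≠ 0 → (∀ i, i ≠ 1 → a i = 0) → _ := fun h h' =>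
    exists_isCorankOne_through_one ha0 h h' hb
  fin_cases j
  · exact absurd rfl hj
  · exact exists_isCorankOne_through_one ha0 hj1 ha hb
  · refine step (exists_isCorankOne_through_one ha0 hj1 ?_ hb)
    rw [forall_fin_six] at *
    simp_all [shift]
  · refine step (step (exists_isCorankOne_through_one ha0 hj1 ?_ hb))
    rw [forall_fin_six] at *
    simp_all [shift]
  · refine step (step (step (exists_isCorankOne_through_one ha0 hj1 ?_ hb)))
    rw [forall_fin_six] at *
    simp_all [shift]
  · refine step (step (step (step (exists_isCorankOne_through_one ha0 hj1 ?_ hb))))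
    rw [forall_fin_six] at *
    simp_all [shift]

/-- The locus of vectors of corank at least two contains no line. -/
theorem exists_isCorankOne [Infinite k] {a b : Fin 6 → k}
    (hab : ∀ s t : k, s • a + t • b = 0 → s = 0 ∧ t = 0) :
    ∃ s t : k, IsCorankOne (s • a + t • b) := by
  -- the case of a plane with a chosen vector in the hyperplane
  have key : ∀ {a b : Fin 6 → k}, (∀ s t : k, s • a + t • b = 0 → s = 0 ∧ t = 0) → a 0 = 0 →
      ∃ s t : k, IsCorankOne (s • a + t • b) := by
    intro a b hab h0
    have ha : a ≠ 0 := fun h => by simpa using hab 1 0 (by simp [h])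
    obtain ⟨j, hj⟩ := Function.ne_iff.mp ha
    -- Inside the hyperplane `x₀ = 0` only multiples of coordinate vectors remain to be treated.
    by_cases h2 : ∃ i, i ≠ j ∧ a i ≠ 0
    · obtain ⟨i, hij, hi⟩ := h2
      exact ⟨1, 0, by simpa using isCorankOne_of_two_ne_zero h0 hij hi hj⟩
    push Not at h2
    have hj0 : j ≠ 0 := fun h => hj (h ▸ h0)
    by_cases hb : b 0 = 0
    · obtain ⟨i, hi⟩ : ∃ i, i ≠ j ∧ b i ≠ 0 := by
        by_contra! H
        have := hab (b j) (-a j) (by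
          funext i
          by_cases hi : i = j
          · subst hi; simp [mul_comm]
          · simp [h2 i hi, H i hi])
        exact hj (neg_eq_zero.mp this.2)
      -- The coefficient makes the `j`-th coordinate equal to `1`, while the `i`-th one is that of
      -- `b`.
      refine ⟨(1 - b j) / a j, 1, isCorankOne_of_two_ne_zero (by simp [h0, hb]) hi.1 ?_ ?_⟩
      · simp [h2 i hi.1, hi.2]
      · have : a j ≠ 0 := hj
        simp [this]
    · exact exists_isCorankOne_through hj0 hj h2 hb
  by_cases h0 : a 0 = 0
  · exact key hab h0
  -- The combination `b 0 • a - a 0 • b` lies on `x₀ = 0` and spans the same plane together with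
  -- `a`.
  · obtain ⟨s, t, h⟩ := key (a := b 0 • a + (-a 0) • b) (b := a) (fun s t h => by
      have := hab (s * b 0 + t) (-(s * a 0)) (by rw [← h]; module)
      have hs : s = 0 := by simpa [h0] using this.2
      simpa [hs] using this.1) (by simp [mul_comm])
    refine ⟨s * b 0 + t, -(s * a 0), ?_⟩
    convert h using 1
    module

end NoLine

/-! ### Flags: a form and an isotropic plane matched by a common line -/

section Flags

variable {k : Type*} [Field k]

/-- The linear condition that `u, w` be orthogonal for all forms `ω_y`. -/
def IsIsotropic (u w : Fin 6 → k) : Prop := ∀ y, kForm y u w = 0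

/-- In general position with respect to the hyperplane `l = 0`: the line `⟨u⟩` is the
intersection of this hyperplane with `ker ω_y` and with the isotropic plane `⟨u, w⟩`,
and each of `ω_y` and `⟨u, w⟩` is determined by `u`. -/
structure IsFlag (y : Fin 5 → k) (l u w : Fin 6 → k) : Prop where
  ne_zero : u ≠ 0
  ker : kRow y u = 0
  on : l ⬝ᵥ u = 0
  off : l ⬝ᵥ w ≠ 0
  isotropic : IsIsotropic u w
  off_ker : ∃ u', kRow y u' = 0 ∧ l ⬝ᵥ u' ≠ 0
  unique_form : ∀ y', kRow y' u = 0 → ∃ c : k, y' = c • y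
  unique_plane : ∀ w', IsIsotropic u w' → ∃ c d : k, w' = c • u + d • w
  unique_ker : ∀ u', kRow y u' = 0 → l ⬝ᵥ u' = 0 → ∃ c : k, u' = c • u

/-- The `6 × 6` matrix with rows `uᵢ xᵢ` and the forms `ω(u, ·)` for `ω` in the basis. -/
def kMatrix (i : Fin 6) (u : Fin 6 → k) : Matrix (Fin 6) (Fin 6) k :=
  Fin.cons (Pi.single i (u i)) fun r => kRow (Pi.single r 1) u

theorem kRow_eq_sum (y : Fin 5 → k) (u : Fin 6 → k) :
    kRow y u = ∑ r, y r • kRow (Pi.single r 1) u := by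
  funext i
  revert i
  rw [forall_fin_six]
  simp [kRow, Fin.sum_univ_five]
  refine ⟨?_, ?_, ?_, ?_, ?_, ?_⟩ <;> ring

theorem isIsotropic_iff {u w : Fin 6 → k} :
    IsIsotropic u w ↔ ∀ r, kForm (Pi.single r 1) u w = 0 := by
  refine ⟨fun h r => h _, fun h y => ?_⟩
  rw [kForm, kRow_eq_sum, sum_dotProduct]
  refine Finset.sum_eq_zero fun r _ => ?_
  rw [smul_dotProduct]
  have := h r
  rw [kForm] at this
  rw [this, smul_zero]

open Matrix in
-- All the forms `ω(u, ·)` kill `u`; the additional row removes `u` by imposing `w i = 0`. The right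
-- kernel is then the space of vectors isotropic to `u`, modulo `u`.
theorem kMatrix_mulVec_eq_zero_iff {i : Fin 6} {u w : Fin 6 → k} (hu : u i ≠ 0) :
    kMatrix i u *ᵥ w = 0 ↔ w i = 0 ∧ IsIsotropic u w := by
  rw [isIsotropic_iff, funext_iff, Fin.forall_fin_succ]
  refine and_congr ?_ Iff.rfl
  simp [kMatrix, Matrix.mulVec, hu]

open Matrix in
theorem vecMul_kMatrix (i : Fin 6) (u z : Fin 6 → k) :
    z ᵥ* kMatrix i u = Pi.single i (z 0 * u i) + kRow (fun r => z r.succ) u := by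
  rw [kRow_eq_sum]
  funext j
  simp only [Matrix.vecMul, dotProduct, Fin.sum_univ_succ (n := 5), kMatrix, Fin.cons_zero,
    Fin.cons_succ, Pi.add_apply, Finset.sum_apply, Pi.smul_apply, smul_eq_mul]
  congr 1
  by_cases h : j = i
  · subst h; simp
  · simp [h]

open Matrix in
-- Pairing with `u` kills the skew part and leaves `z 0 * u i ^ 2`, so the additional row does not
-- contribute. The left kernel thus consists of the forms killing `u`; since left and right kernels
-- of a square matrix have equal dimension, forms and planes through `u` correspond.
theorem vecMul_kMatrix_eq_zero_iff {i : Fin 6} {u z : Fin 6 → k} (hu : u i ≠ 0) :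
    z ᵥ* kMatrix i u = 0 ↔ z 0 = 0 ∧ kRow (fun r => z r.succ) u = 0 := by
  rw [vecMul_kMatrix]
  constructor
  · intro h
    have h0 : z 0 = 0 := by
      have h1 : (Pi.single i (z 0 * u i) + kRow (fun r => z r.succ) u) ⬝ᵥ u = 0 := by
        rw [h, zero_dotProduct]
      rw [add_dotProduct, single_dotProduct] at h1
      have h2 := kForm_self (fun r => z r.succ) u
      rw [kForm] at h2
      simpa [h2, hu] using h1
    simpa [h0] using h
  · rintro ⟨h0, h1⟩
    simp [h0, h1]

/-- On the cubic the adjoint is the bivector of the kernel plane, so its contraction with `l`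
vanishes only if `l` vanishes on the whole plane. -/
theorem exists_kAdj_apply_ne_zero {y : Fin 5 → k} {l u' : Fin 6 → k} (hy : y ≠ 0)
    (hu' : kRow y u' = 0) (hl : l ⬝ᵥ u' ≠ 0) : kAdj y l ≠ 0 := by
  intro h
  obtain ⟨m, n, hmn⟩ := kAdj_ne_zero hy
  -- `ω_y^♯(m, n) u'` pairs with `l` to zero
  have h1 : (n ⬝ᵥ kAdj y m) * (l ⬝ᵥ u') = 0 := by
    have h2 : (n ⬝ᵥ kAdj y m) • u' = (n ⬝ᵥ u') • kAdj y m - (m ⬝ᵥ u') • kAdj y n :=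
      funext fun i => kAdj_wedge hu' m n i
    have h3 := congrArg (fun x => l ⬝ᵥ x) h2
    simp only [dotProduct_smul, dotProduct_sub, smul_eq_mul] at h3
    rw [h3, dotProduct_kAdj, dotProduct_kAdj y l n, h]
    simp
  exact (mul_ne_zero hmn hl) h1

/-- The contraction of the bivector of the kernel plane with `l` spans the intersection of this
plane with `l = 0`. -/
theorem mem_span_kAdj {y : Fin 5 → k} {l u : Fin 6 → k} (hl : kAdj y l ≠ 0)
    (hu : kRow y u = 0) (hlu : l ⬝ᵥ u = 0) : ∃ c : k, u = c • kAdj y l := by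
  obtain ⟨i, hi⟩ := Function.ne_iff.mp hl
  refine ⟨(Pi.single i 1 ⬝ᵥ u) / kAdj y l i, ?_⟩
  funext j
  have h := kAdj_wedge hu l (Pi.single i 1) j
  rw [hlu, zero_mul, sub_zero, single_dotProduct, one_mul] at h
  have hi : kAdj y l i ≠ 0 := hi
  rw [Pi.smul_apply, smul_eq_mul]
  field_simp
  rw [mul_comm, h, mul_comm]

theorem kPf_eq_zero {y : Fin 5 → k} {u : Fin 6 → k} (hu : kRow y u = 0) (h0 : u ≠ 0) :
    kPf y = 0 := by
  have h := kAdj_kRow y u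
  rw [hu] at h
  have h1 : kAdj y 0 = 0 := by
    funext i; revert i; rw [forall_fin_six]; simp [kAdj]
  rw [h1] at h
  exact (smul_eq_zero.mp h.symm).resolve_right h0

theorem IsFlag.exists_smul_kAdj {y : Fin 5 → k} {l u w : Fin 6 → k} (h : IsFlag y l u w)
    (hy : y ≠ 0) : kAdj y l ≠ 0 ∧ ∃ c : k, c ≠ 0 ∧ kAdj y l = c • u := by
  obtain ⟨u', hu', hl⟩ := h.off_ker
  have h0 := exists_kAdj_apply_ne_zero hy hu' hl
  refine ⟨h0, ?_⟩
  obtain ⟨c, hc⟩ := h.unique_ker (kAdj y l)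
    (by rw [kRow_kAdj, kPf_eq_zero h.ker h.ne_zero, zero_smul]) (dotProduct_kAdj_self y l)
  exact ⟨c, fun hc0 => h0 (by rw [hc, hc0, zero_smul]), hc⟩

theorem IsFlag.smul {y : Fin 5 → k} {l u w : Fin 6 → k} (h : IsFlag y l u w) {c : k}
    (hc : c ≠ 0) : IsFlag y l (c • u) w where
  ne_zero := smul_ne_zero hc h.ne_zero
  ker := by rw [kRow_smul, h.ker, smul_zero]
  on := by rw [dotProduct_smul, h.on, smul_zero]
  off := h.off
  isotropic y' := by rw [kForm, kRow_smul, smul_dotProduct, ← kForm, h.isotropic, smul_zero]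
  off_ker := h.off_ker
  unique_form y' hy' := h.unique_form y' (by
    rw [kRow_smul] at hy'; exact (smul_eq_zero.mp hy').resolve_left hc)
  unique_plane w' hw' := by
    obtain ⟨a, b, hab⟩ := h.unique_plane w' fun y' => by
      have := hw' y'
      rw [kForm, kRow_smul, smul_dotProduct, ← kForm] at this
      exact (smul_eq_zero.mp this).resolve_left hc
    exact ⟨a / c, b, by rw [hab, smul_smul, div_mul_cancel₀ _ hc]⟩
  unique_ker u' h1 h2 := by
    obtain ⟨a, ha⟩ := h.unique_ker u' h1 h2
    exact ⟨a / c, by rw [ha, smul_smul, div_mul_cancel₀ _ hc]⟩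

/-- The adjugate of `kMatrix i u` is non-zero in the situation of a flag. -/
theorem IsFlag.adjugate {y : Fin 5 → k} {l u w : Fin 6 → k} (h : IsFlag y l u w)
    {i : Fin 6} (hi : u i ≠ 0) : ∃ j r, (kMatrix i u).adjugate j r ≠ 0 := by
  have hw : w - (w i / u i) • u ≠ 0 := by
    intro h0
    rw [sub_eq_zero] at h0
    apply h.off
    rw [h0, dotProduct_smul, h.on, smul_zero]
  have huu : IsIsotropic u u := fun y => kForm_self y u
  refine adjugate_ne_zero_of_ker hw ?_ fun x hx => ?_
  · rw [kMatrix_mulVec_eq_zero_iff hi]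
    refine ⟨by simp [hi], fun y' => ?_⟩
    have := kForm_smul_add y' u w u 1 (-(w i / u i))
    rw [h.isotropic, huu] at this
    rw [← sub_eq_zero] at this ⊢
    convert this using 2
    · rw [sub_eq_add_neg, one_smul, neg_smul]
    · simp
  · rw [kMatrix_mulVec_eq_zero_iff hi] at hx
    obtain ⟨a, b, hab⟩ := h.unique_plane x hx.2
    refine ⟨b, ?_⟩
    have := hx.1
    rw [hab] at this ⊢
    simp only [Pi.add_apply, Pi.smul_apply, smul_eq_mul] at this
    have ha : a = -(b * (w i / u i)) := by field_simp; linear_combination this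
    rw [ha]
    module

open Matrix in
theorem kMatrix_col {i : Fin 6} {u : Fin 6 → k} (hi : u i ≠ 0) (hdet : (kMatrix i u).det = 0)
    (r : Fin 6) : (kMatrix i u).adjugate i r = 0 ∧
      IsIsotropic u fun j => (kMatrix i u).adjugate j r := by
  rw [← kMatrix_mulVec_eq_zero_iff (w := fun j => (kMatrix i u).adjugate j r) hi]
  have h1 : kMatrix i u * (kMatrix i u).adjugate = 0 := by
    rw [Matrix.mul_adjugate, hdet, zero_smul]
  funext j
  exact congrFun (congrFun h1 j) r

open Matrix in
theorem kMatrix_row {i : Fin 6} {u : Fin 6 → k} (hi : u i ≠ 0) (hdet : (kMatrix i u).det = 0)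
    (j : Fin 6) : (kMatrix i u).adjugate j 0 = 0 ∧
      kRow (fun r : Fin 5 => (kMatrix i u).adjugate j r.succ) u = 0 := by
  rw [← vecMul_kMatrix_eq_zero_iff (z := fun r => (kMatrix i u).adjugate j r) hi]
  have h1 : (kMatrix i u).adjugate * kMatrix i u = 0 := by
    rw [Matrix.adjugate_mul, hdet, zero_smul]
  funext r
  exact congrFun (congrFun h1 j) r

open Matrix in
theorem det_kMatrix_eq_zero_of_ker {i : Fin 6} {u : Fin 6 → k} (hi : u i ≠ 0) {y : Fin 5 → k}
    (hy : y ≠ 0) (h : kRow y u = 0) : (kMatrix i u).det = 0 := by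
  refine Matrix.exists_vecMul_eq_zero_iff.mp ⟨Fin.cons 0 y, ?_, ?_⟩
  · intro h0
    exact hy (funext fun r => by simpa using congrFun h0 r.succ)
  · rw [vecMul_kMatrix_eq_zero_iff hi]
    simpa using h

open Matrix in
-- A nonzero entry of the adjugate means corank one, so both kernels are lines, spanned by a row and
-- a column of the adjugate.
theorem unique_of_adjugate {i : Fin 6} {u : Fin 6 → k} (hi : u i ≠ 0)
    (hdet : (kMatrix i u).det = 0) {j r : Fin 6} (hjr : (kMatrix i u).adjugate j r ≠ 0) :
    (∀ y, kRow y u = 0 → ∃ c : k, y = c • fun r : Fin 5 => (kMatrix i u).adjugate j r.succ) ∧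
    ∀ w', IsIsotropic u w' →
      ∃ c d : k, w' = c • u + d • fun j => (kMatrix i u).adjugate j r := by
  constructor
  · intro y hy
    obtain ⟨c, hc⟩ := mem_span_adjugate_row hdet hjr (x := Fin.cons 0 y)
      ((vecMul_kMatrix_eq_zero_iff hi).mpr (by simpa using hy))
    exact ⟨c, funext fun r => by simpa using congrFun hc r.succ⟩
  · intro w' hw'
    have huu : IsIsotropic u u := fun y => kForm_self y u
    obtain ⟨d, hd⟩ := mem_span_adjugate_col hdet hjr (x := w' - (w' i / u i) • u)
      ((kMatrix_mulVec_eq_zero_iff hi).mpr ⟨by simp [hi], fun y => by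
        have := kForm_smul_add y u w' u 1 (-(w' i / u i))
        rw [hw', huu, mul_zero, mul_zero, add_zero] at this
        rw [one_smul] at this
        rwa [sub_eq_add_neg, ← neg_smul]⟩)
    exact ⟨w' i / u i, d, by rw [← hd]; module⟩

end Flags

/-! ### Flags detected by nonvanishing polynomials, and their existence -/

section Flags

variable {k : Type*} [Field k]

/-- Together with `isFlag_of_col`, this presents the domain of the map from `Y` to `X` as a union of
nonvanishing loci of polynomials in `y` and `l`. -/
theorem IsFlag.exists_col {y : Fin 5 → k} {l u w : Fin 6 → k} (h : IsFlag y l u w) (hy : y ≠ 0) :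
    ∃ i r, kAdj y l i * (l ⬝ᵥ fun j => (kMatrix i (kAdj y l)).adjugate j r) ≠ 0 := by
  obtain ⟨h0, c, hc, hcu⟩ := h.exists_smul_kAdj hy
  obtain ⟨i, hi⟩ := Function.ne_iff.mp h0
  have hi : kAdj y l i ≠ 0 := hi
  have h' := h.smul hc
  rw [← hcu] at h'
  obtain ⟨j, r, hjr⟩ := h'.adjugate hi
  refine ⟨i, r, mul_ne_zero hi ?_⟩
  obtain ⟨hw0, hw⟩ := kMatrix_col hi (det_kMatrix_eq_zero_of_ker hi hy h'.ker) r
  obtain ⟨a, b, hab⟩ := h'.unique_plane _ hw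
  rw [hab, dotProduct_add, dotProduct_smul, dotProduct_smul, h'.on, smul_zero, zero_add]
  refine smul_ne_zero (fun hb => hjr ?_) h.off
  have h1 := congrFun hab i
  simp only [hb, zero_smul, add_zero, Pi.smul_apply, smul_eq_mul, hw0] at h1
  have ha : a = 0 := (mul_eq_zero.mp h1.symm).resolve_right hi
  have h2 := congrFun hab j
  simpa [ha, hb] using h2

theorem isFlag_of_col {y : Fin 5 → k} {l : Fin 6 → k} (hpf : kPf y = 0) {i r : Fin 6}
    (h : kAdj y l i * (l ⬝ᵥ fun j => (kMatrix i (kAdj y l)).adjugate j r) ≠ 0) :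
    IsFlag y l (kAdj y l) fun j => (kMatrix i (kAdj y l)).adjugate j r := by
  obtain ⟨hi, hl⟩ := mul_ne_zero_iff.mp h
  have hu0 : kAdj y l ≠ 0 := fun h => hi (by rw [h]; rfl)
  have hker : ∀ m, kRow y (kAdj y m) = 0 := fun m => by rw [kRow_kAdj, hpf, zero_smul]
  have hy : y ≠ 0 := by
    rintro rfl
    apply hi
    have : ∀ i, kAdj (0 : Fin 5 → k) l i = 0 := by rw [forall_fin_six]; simp [kAdj]
    exact this i
  have hdet := det_kMatrix_eq_zero_of_ker hi hy (hker l)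
  obtain ⟨j, hj⟩ : ∃ j, (kMatrix i (kAdj y l)).adjugate j r ≠ 0 := by
    by_contra! H
    apply hl
    simp [dotProduct, H]
  obtain ⟨U1, U2⟩ := unique_of_adjugate hi hdet hj
  -- By skewness, `l` takes the value `-(kAdj y l i)` on the kernel vector `kAdj y (Pi.single i 1)`,
  -- which is nonzero.
  refine ⟨hu0, hker l, dotProduct_kAdj_self y l, hl, (kMatrix_col hi hdet r).2,
    ⟨kAdj y (Pi.single i 1), hker _, ?_⟩, ?_, U2, fun u' h1 h2 => mem_span_kAdj hu0 h1 h2⟩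
  · rw [dotProduct_kAdj]
    simpa using hi
  · intro y' hy'
    obtain ⟨c, hc⟩ := U1 y (hker l)
    obtain ⟨c', hc'⟩ := U1 y' hy'
    have hc0 : c ≠ 0 := fun h0 => hy (by rw [hc, h0, zero_smul])
    refine ⟨c' / c, ?_⟩
    conv_rhs => rw [hc]
    rw [hc', smul_smul, div_mul_cancel₀ _ hc0]

/-- The counterpart for the inverse map: with `isFlag_of_row` it detects flags starting from the
plane, the form being read off from a row of the adjugate. -/
theorem IsFlag.exists_row {y : Fin 5 → k} {l u w : Fin 6 → k} (h : IsFlag y l u w) :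
    ∃ i j p, u i * kAdj (fun r : Fin 5 => (kMatrix i u).adjugate j r.succ) l p ≠ 0 := by
  obtain ⟨i, hi⟩ := Function.ne_iff.mp h.ne_zero
  have hi : u i ≠ 0 := hi
  obtain ⟨j, r, hjr⟩ := h.adjugate hi
  have hdet : (kMatrix i u).det = 0 := by
    by_contra hd
    have hw : w - (w i / u i) • u ≠ 0 := by
      intro h0
      rw [sub_eq_zero] at h0
      apply h.off
      rw [h0, dotProduct_smul, h.on, smul_zero]
    refine hw (Matrix.eq_zero_of_mulVec_eq_zero hd ((kMatrix_mulVec_eq_zero_iff hi).mpr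
      ⟨by simp [hi], fun y' => ?_⟩))
    have := kForm_smul_add y' u w u 1 (-(w i / u i))
    rw [h.isotropic, kForm_self, mul_zero, mul_zero, add_zero, one_smul] at this
    rwa [sub_eq_add_neg, ← neg_smul]
  obtain ⟨h0, h1⟩ := kMatrix_row hi hdet j
  set z : Fin 5 → k := fun r : Fin 5 => (kMatrix i u).adjugate j r.succ with hz
  have hz0 : z ≠ 0 := by
    intro hz0
    revert hjr
    induction r using Fin.cases with
    | zero => simp [h0]
    | succ r => simpa [hz] using congrFun hz0 r
  obtain ⟨c, hc⟩ := h.unique_form z h1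
  have hc0 : c ≠ 0 := fun h => hz0 (by rw [hc, h, zero_smul])
  obtain ⟨u', hu', hl⟩ := h.off_ker
  have hk := exists_kAdj_apply_ne_zero (y := z) hz0 (u' := u')
    (by rw [hc, kRow_smul_left, hu', smul_zero]) hl
  obtain ⟨p, hp⟩ := Function.ne_iff.mp hk
  exact ⟨i, j, p, mul_ne_zero hi hp⟩

theorem isFlag_of_row {l u w : Fin 6 → k} (hu : l ⬝ᵥ u = 0) (hw : l ⬝ᵥ w ≠ 0)
    (huw : IsIsotropic u w) {i j p : Fin 6}
    (h : u i * kAdj (fun r : Fin 5 => (kMatrix i u).adjugate j r.succ) l p ≠ 0) :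
    IsFlag (fun r : Fin 5 => (kMatrix i u).adjugate j r.succ) l u w := by
  obtain ⟨hi, hl⟩ := mul_ne_zero_iff.mp h
  set z : Fin 5 → k := fun r : Fin 5 => (kMatrix i u).adjugate j r.succ with hz
  have hu0 : u ≠ 0 := fun h => hi (by rw [h]; rfl)
  have hk0 : kAdj z l ≠ 0 := fun h => hl (by rw [h]; rfl)
  have hw' : w - (w i / u i) • u ≠ 0 := by
    intro h0
    rw [sub_eq_zero] at h0
    apply hw
    rw [h0, dotProduct_smul, hu, smul_zero]
  have hww : IsIsotropic u (w - (w i / u i) • u) := fun y' => by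
    have := kForm_smul_add y' u w u 1 (-(w i / u i))
    rw [huw, kForm_self, mul_zero, mul_zero, add_zero, one_smul] at this
    rwa [sub_eq_add_neg, ← neg_smul]
  have hN := (kMatrix_mulVec_eq_zero_iff hi).mpr
    ⟨show (w - (w i / u i) • u) i = 0 by simp [hi], hww⟩
  have hdet : (kMatrix i u).det = 0 := Matrix.exists_mulVec_eq_zero_iff.mp ⟨_, hw', hN⟩
  have hker := (kMatrix_row hi hdet j).2
  rw [← hz] at hker
  have hpf : kPf z = 0 := kPf_eq_zero hker hu0
  have hz0 : z ≠ 0 := by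
    intro h0
    apply hl
    have : ∀ i, kAdj (0 : Fin 5 → k) l i = 0 := by rw [forall_fin_six]; simp [kAdj]
    rw [h0]
    exact this p
  obtain ⟨r, hr⟩ := Function.ne_iff.mp hz0
  have hr : (kMatrix i u).adjugate j r.succ ≠ 0 := hr
  obtain ⟨U1, U2⟩ := unique_of_adjugate hi hdet hr
  refine ⟨hu0, hker, hu, hw, huw, ⟨kAdj z (Pi.single p 1), ?_, ?_⟩, U1, ?_, ?_⟩
  · rw [kRow_kAdj, hpf, zero_smul]
  · rw [dotProduct_kAdj]
    simpa using hl
  · intro w₁ hw₁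
    obtain ⟨a, b, hab⟩ := U2 w huw
    have hb : b ≠ 0 := by
      rintro rfl
      apply hw
      rw [hab, zero_smul, add_zero, dotProduct_smul, hu, smul_zero]
    obtain ⟨a₁, b₁, hab₁⟩ := U2 w₁ hw₁
    refine ⟨a₁ - b₁ / b * a, b₁ / b, ?_⟩
    rw [hab₁, hab, smul_add, smul_smul, smul_smul, div_mul_cancel₀ _ hb]
    module
  · obtain ⟨c, hc⟩ := mem_span_kAdj hk0 hker hu
    have hc0 : c ≠ 0 := fun h => hu0 (by rw [hc, h, zero_smul])
    intro u' h1 h2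
    obtain ⟨c', hc'⟩ := mem_span_kAdj hk0 h1 h2
    refine ⟨c' / c, ?_⟩
    rw [hc', hc, smul_smul, div_mul_cancel₀ _ hc0]

theorem IsCorankOne.ne_zero {u : Fin 6 → k} (h : IsCorankOne u) : u ≠ 0 := by
  obtain ⟨i, hi⟩ := h
  rintro rfl
  have hz : ∀ y : Fin 5 → k, kRow y 0 = 0 := fun y => by
    have := kRow_smul y (0 : Fin 6 → k) 0
    simpa using this
  have := hi (Pi.single (i + 1) 1) (hz _) (by simp)
  simpa using congrFun this (i + 1)

/-- If `u` has corank one and lies in the kernel of some non-zero `ω_y`, the vectors orthogonal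
to `u` form a plane. -/
theorem IsCorankOne.exists_plane {u : Fin 6 → k} (h : IsCorankOne u) {y : Fin 5 → k} (hy : y ≠ 0)
    (hyu : kRow y u = 0) : (∀ y', kRow y' u = 0 → ∃ c : k, y' = c • y) ∧
      ∃ w, IsIsotropic u w ∧ (∀ c : k, w ≠ c • u) ∧
        ∀ w', IsIsotropic u w' → ∃ c d : k, w' = c • u + d • w := by
  have hu := h.ne_zero
  obtain ⟨i, hi⟩ := h
  have hU1 : ∀ y', kRow y' u = 0 → ∃ c : k, y' = c • y := by
    intro y' hy'
    have hyi : y i ≠ 0 := fun h => hy (hi y hyu h)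
    refine ⟨y' i / y i, sub_eq_zero.mp (hi _ ?_ ?_)⟩
    · rw [kRow_sub_left, kRow_smul_left, hy', hyu, smul_zero, sub_zero]
    · simp [hyi]
  refine ⟨hU1, ?_⟩
  obtain ⟨j, hj⟩ := Function.ne_iff.mp hu
  have hj : u j ≠ 0 := hj
  have hdet := det_kMatrix_eq_zero_of_ker hj hy hyu
  -- the left kernel of the matrix is a line, so the transposed matrix has non-zero adjugate
  obtain ⟨r, q, hrq⟩ := adjugate_ne_zero_of_ker (N := (kMatrix j u).transpose)
    (x₀ := Fin.cons 0 y) (fun h0 => hy (funext fun r => by simpa using congrFun h0 r.succ))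
    (by
      rw [Matrix.mulVec_transpose, vecMul_kMatrix_eq_zero_iff hj]
      simpa using hyu)
    (fun x hx => by
      rw [Matrix.mulVec_transpose, vecMul_kMatrix_eq_zero_iff hj] at hx
      obtain ⟨c, hc⟩ := hU1 _ hx.2
      refine ⟨c, funext fun r => ?_⟩
      induction r using Fin.cases with
      | zero => simp [hx.1]
      | succ r => simpa using congrFun hc r)
  rw [← Matrix.adjugate_transpose, Matrix.transpose_apply] at hrq
  obtain ⟨-, U2⟩ := unique_of_adjugate hj hdet hrq
  obtain ⟨h0, hw⟩ := kMatrix_col hj hdet r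
  refine ⟨_, hw, fun c hc => hrq ?_, U2⟩
  have h1 := congrFun hc j
  have hc0 : c = 0 := by
    rw [Pi.smul_apply, smul_eq_mul] at h1
    exact (mul_eq_zero.mp (h1.symm.trans h0)).resolve_right hj
  have h2 := congrFun hc q
  simpa [hc0] using h2

theorem exists_dual_off {u v w : Fin 6 → k} (hv : ∀ c : k, v ≠ c • u) (hw : ∀ c : k, w ≠ c • u)
    [Infinite k] : ∃ l : Fin 6 → k, l ⬝ᵥ u = 0 ∧ l ⬝ᵥ v ≠ 0 ∧ l ⬝ᵥ w ≠ 0 := by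
  have key : ∀ v : Fin 6 → k, (∀ c : k, v ≠ c • u) → ∃ l : Fin 6 → k, l ⬝ᵥ u = 0 ∧ l ⬝ᵥ v ≠ 0 := by
    intro v hv
    obtain ⟨f, hf, hfu⟩ := Submodule.exists_le_ker_of_notMem (p := Submodule.span k {u})
      (v := v) (by
        rw [Submodule.mem_span_singleton]
        rintro ⟨c, hc⟩
        exact hv c hc.symm)
    have hdot : ∀ x : Fin 6 → k, (fun i => f (Pi.single i 1)) ⬝ᵥ x = f x := fun x => by
      conv_rhs => rw [← LinearMap.sum_single_apply (fun _ => k) x, map_sum]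
      refine Finset.sum_congr rfl fun i _ => ?_
      have : Pi.single i (x i) = x i • (Pi.single i 1 : Fin 6 → k) := by
        rw [← Pi.single_smul, smul_eq_mul, mul_one]
      rw [this, map_smul, smul_eq_mul, mul_comm]
    refine ⟨fun i => f (Pi.single i 1), ?_, ?_⟩
    · rw [hdot]
      exact hfu (Submodule.mem_span_singleton_self u)
    · rwa [hdot]
  obtain ⟨l₁, h1, h1'⟩ := key v hv
  obtain ⟨l₂, h2, h2'⟩ := key w hw
  by_cases hlv : l₂ ⬝ᵥ v = 0
  · by_cases hlw : l₁ ⬝ᵥ w = 0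
    · exact ⟨l₁ + l₂, by simp [add_dotProduct, h1, h2], by simpa [add_dotProduct, hlv],
        by simpa [add_dotProduct, hlw]⟩
    · exact ⟨l₁, h1, h1', hlw⟩
  · exact ⟨l₂, h2, hlv, h2'⟩

/-- The kernel contains the image of the adjoint, a nonzero skew map, which has rank at least two.
-/
theorem exists_ker_pair {y : Fin 5 → k} (hy : y ≠ 0) (hpf : kPf y = 0) :
    ∃ a b : Fin 6 → k, (∀ s t : k, s • a + t • b = 0 → s = 0 ∧ t = 0) ∧
      ∀ s t : k, kRow y (s • a + t • b) = 0 := by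
  obtain ⟨l, m, hlm⟩ := kAdj_ne_zero hy
  have hla : l ⬝ᵥ kAdj y l = 0 := dotProduct_kAdj_self y l
  have hmb : m ⬝ᵥ kAdj y m = 0 := dotProduct_kAdj_self y m
  have hlb : l ⬝ᵥ kAdj y m = -(m ⬝ᵥ kAdj y l) := dotProduct_kAdj y l m
  refine ⟨kAdj y l, kAdj y m, fun s t h => ?_, fun s t => ?_⟩
  · have h1 := congrArg (fun x => l ⬝ᵥ x) h
    have h2 := congrArg (fun x => m ⬝ᵥ x) h
    simp only [dotProduct_add, dotProduct_smul, hla, hmb, hlb, smul_eq_mul,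
      dotProduct_zero] at h1 h2
    constructor
    · simpa [hlm] using h2
    · simpa [hlm] using h1
  · have h1 := kRow_sub y (s • kAdj y l) (-t • kAdj y m)
    rw [kRow_smul, kRow_smul, kRow_kAdj, kRow_kAdj, hpf] at h1
    simpa using h1

/-- It suffices that `l` vanish on `u` but neither on a second kernel vector nor on the second
vector of the plane. -/
theorem IsCorankOne.exists_isFlag [Infinite k] {y : Fin 5 → k} {u w : Fin 6 → k}
    (h : IsCorankOne u) (hy : y ≠ 0) (hyu : kRow y u = 0) (hw : IsIsotropic u w)
    (hwu : ∀ c : k, w ≠ c • u) : ∃ l, IsFlag y l u w := by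
  obtain ⟨U1, w₁, -, -, U2⟩ := h.exists_plane hy hyu
  have hu0 := h.ne_zero
  obtain ⟨a, b, hab, hker⟩ := exists_ker_pair hy (kPf_eq_zero hyu hu0)
  obtain ⟨v, hv, hvu⟩ : ∃ v, kRow y v = 0 ∧ ∀ c : k, v ≠ c • u := by
    by_contra! H
    obtain ⟨c, hc⟩ := H a (by simpa using hker 1 0)
    obtain ⟨d, hd⟩ := H b (by simpa using hker 0 1)
    have h1 := hab d (-c) (by rw [hc, hd, smul_smul, smul_smul]; module)
    have hc0 : c = 0 := by simpa using h1.2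
    have := hab 1 0 (by rw [hc, hc0]; simp)
    exact one_ne_zero this.1
  obtain ⟨l, h1, h2, h3⟩ := exists_dual_off hvu hwu
  have hk : kAdj y l ≠ 0 := exists_kAdj_apply_ne_zero hy hv h2
  refine ⟨l, hu0, hyu, h1, h3, hw, ⟨v, hv, h2⟩, U1, fun w' hw' => ?_, fun u' h4 h5 => ?_⟩
  · obtain ⟨c, d, hcd⟩ := U2 w hw
    obtain ⟨c', d', hcd'⟩ := U2 w' hw'
    have hd : d ≠ 0 := by
      rintro rfl
      exact hwu c (by rw [hcd]; simp)
    refine ⟨c' - d' / d * c, d' / d, ?_⟩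
    rw [hcd', hcd, smul_add, smul_smul, smul_smul, div_mul_cancel₀ _ hd]
    module
  · obtain ⟨c, hc⟩ := mem_span_kAdj hk hyu h1
    obtain ⟨d, hd⟩ := mem_span_kAdj hk h4 h5
    have hc0 : c ≠ 0 := fun h => hu0 (by rw [hc, h, zero_smul])
    exact ⟨d / c, by rw [hd, hc, smul_smul, div_mul_cancel₀ _ hc0]⟩

/-- This holds at every point of the cubic, not only at general ones, because every kernel plane
contains a vector of corank one. It gives density over each point of `Y`. -/
theorem exists_isFlag_of_kPf [Infinite k] {y : Fin 5 → k} (hy : y ≠ 0) (hpf : kPf y = 0) :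
    ∃ l u w, IsFlag y l u w := by
  obtain ⟨a, b, hab, hker⟩ := exists_ker_pair hy hpf
  obtain ⟨s, t, hst⟩ := exists_isCorankOne hab
  obtain ⟨-, w, hw, hwu, -⟩ := hst.exists_plane hy (hker s t)
  obtain ⟨l, hl⟩ := hst.exists_isFlag hy (hker s t) hw hwu
  exact ⟨l, _, w, hl⟩

theorem exists_isFlag_of_isIsotropic [Infinite k] {a b : Fin 6 → k} (h : IsIsotropic a b)
    (hab : ∀ s t : k, s • a + t • b = 0 → s = 0 ∧ t = 0) :
    ∃ y l, ∃ s t s' t' : k, s * t' - t * s' = 1 ∧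
      IsFlag y l (s • a + t • b) (s' • a + t' • b) := by
  obtain ⟨s, t, hst⟩ := exists_isCorankOne hab
  have hu0 := hst.ne_zero
  have hst0 : s ≠ 0 ∨ t ≠ 0 := by
    by_contra! H
    simp [H.1, H.2] at hu0
  -- The change of basis of the plane is unimodular, so the bivector `a ∧ b` is unchanged.
  obtain ⟨s', t', hd⟩ : ∃ s' t' : k, s * t' - t * s' = 1 := by
    rcases hst0 with h | h
    · exact ⟨0, s⁻¹, by simp [h]⟩
    · exact ⟨-t⁻¹, 0, by simp [h]⟩
  set u := s • a + t • b with hu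
  set w := s' • a + t' • b with hw
  have huw : IsIsotropic u w := fun y => by
    rw [hu, kForm_smul_add_left, hw, kForm_smul_add, kForm_smul_add, h, kForm_self, kForm_self,
      kForm_swap y b a, h]
    simp
  have hwu : ∀ c : k, w ≠ c • u := by
    intro c hc
    obtain ⟨h1, h2⟩ := hab (s' - c * s) (t' - c * t) (by
      rw [← sub_eq_zero] at hc
      rw [← hc, hu, hw]
      module)
    have : (1 : k) = 0 := by
      rw [← hd, sub_eq_zero.mp h1, sub_eq_zero.mp h2]; ring
    exact one_ne_zero this
  obtain ⟨i, hi⟩ := Function.ne_iff.mp hu0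
  have hi : u i ≠ 0 := hi
  -- The vector `w` modulo `u` makes the matrix singular, and a left kernel vector is a form killing
  -- `u`.
  obtain ⟨z, hz0, hz⟩ := Matrix.exists_vecMul_eq_zero_iff.mpr
    (Matrix.exists_mulVec_eq_zero_iff.mp ⟨w - (w i / u i) • u,
      fun h0 => hwu _ (sub_eq_zero.mp h0), (kMatrix_mulVec_eq_zero_iff hi).mpr
        ⟨by simp [hi], fun y => by
          have := kForm_smul_add y u w u 1 (-(w i / u i))
          rw [huw, kForm_self, mul_zero, mul_zero, add_zero, one_smul] at this
          rwa [sub_eq_add_neg, ← neg_smul]⟩⟩)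
  rw [vecMul_kMatrix_eq_zero_iff hi] at hz
  have hy : (fun r : Fin 5 => z r.succ) ≠ 0 := by
    intro h0
    apply hz0
    funext r
    induction r using Fin.cases with
    | zero => exact hz.1
    | succ r => exact congrFun h0 r
  obtain ⟨l, hl⟩ := hst.exists_isFlag hy hz.2 huw hwu
  exact ⟨_, l, s, t, s', t', hd, hl⟩

end Flags

/-! ### Polynomial functions -/

section PolynomialFun

variable {k : Type*} [Field k] {E E' : Type*} [AddCommGroup E] [Module k E] [AddCommGroup E']
  [Module k E']

namespace IsPolynomialFun

theorem const (c : k) : IsPolynomialFun k fun _ : E => c :=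
  Subalgebra.algebraMap_mem (Algebra.adjoin k (Set.range fun l : Module.Dual k E => (l : E → k))) c

theorem linear (l : E →ₗ[k] k) : IsPolynomialFun k fun x => l x :=
  Algebra.subset_adjoin ⟨l, rfl⟩

theorem add {f g : E → k} (hf : IsPolynomialFun k f) (hg : IsPolynomialFun k g) :
    IsPolynomialFun k fun x => f x + g x := Subalgebra.add_mem _ hf hg

theorem mul {f g : E → k} (hf : IsPolynomialFun k f) (hg : IsPolynomialFun k g) :
    IsPolynomialFun k fun x => f x * g x := Subalgebra.mul_mem _ hf hg

theorem neg {f : E → k} (hf : IsPolynomialFun k f) : IsPolynomialFun k fun x => -f x :=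
  Subalgebra.neg_mem _ hf

theorem sub {f g : E → k} (hf : IsPolynomialFun k f) (hg : IsPolynomialFun k g) :
    IsPolynomialFun k fun x => f x - g x := Subalgebra.sub_mem _ hf hg

theorem pow {f : E → k} (hf : IsPolynomialFun k f) (n : ℕ) :
    IsPolynomialFun k fun x => f x ^ n := Subalgebra.pow_mem _ hf n

theorem sum {ι : Type*} (s : Finset ι) {f : ι → E → k} (hf : ∀ i ∈ s, IsPolynomialFun k (f i)) :
    IsPolynomialFun k fun x => ∑ i ∈ s, f i x := by
  have := Subalgebra.sum_mem (Algebra.adjoin k (Set.range fun l : Module.Dual k E => (l : E → k))) hf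
  rw [IsPolynomialFun]
  convert this using 1
  ext x
  simp

theorem prod {ι : Type*} (s : Finset ι) {f : ι → E → k} (hf : ∀ i ∈ s, IsPolynomialFun k (f i)) :
    IsPolynomialFun k fun x => ∏ i ∈ s, f i x := by
  have := Subalgebra.prod_mem (Algebra.adjoin k (Set.range fun l : Module.Dual k E => (l : E → k)))
    hf
  rw [IsPolynomialFun]
  convert this using 1
  ext x
  simp

theorem induction {P : (E → k) → Prop} (hc : ∀ c : k, P fun _ => c)
    (hl : ∀ l : E →ₗ[k] k, P fun x => l x) (ha : ∀ f g, P f → P g → P fun x => f x + g x)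
    (hm : ∀ f g, P f → P g → P fun x => f x * g x) {f : E → k} (hf : IsPolynomialFun k f) :
    P f := by
  refine Algebra.adjoin_induction (p := fun f _ => P f) ?_ (fun c => hc c)
    (fun f g _ _ h1 h2 => ha f g h1 h2) (fun f g _ _ h1 h2 => hm f g h1 h2) hf
  rintro _ ⟨l, rfl⟩
  exact hl l

theorem comp {f : E → k} (hf : IsPolynomialFun k f) {F : E' → E}
    (hF : ∀ l : Module.Dual k E, IsPolynomialFun k fun x => l (F x)) :
    IsPolynomialFun k fun x => f (F x) := by
  refine induction (P := fun f => IsPolynomialFun k fun x => f (F x)) (fun c => const c)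
    (fun l => hF l) (fun f g h1 h2 => ?_) (fun f g h1 h2 => ?_) hf
  · exact h1.add h2
  · exact h1.mul h2

theorem id : IsPolynomialFun k fun t : k => t := linear (E := k) LinearMap.id

/-- A polynomial function of one variable is given by a polynomial. -/
theorem exists_polynomial {f : k → k} (hf : IsPolynomialFun k f) :
    ∃ p : Polynomial k, ∀ t, f t = p.eval t := by
  refine induction (P := fun f => ∃ p : Polynomial k, ∀ t, f t = p.eval t)
    (fun c => ?_) (fun l => ?_) (fun f g h1 h2 => ?_) (fun f g h1 h2 => ?_) hf
  · exact ⟨.C c, fun t => by simp⟩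
  · refine ⟨.C (l 1) * .X, fun t => ?_⟩
    have := l.map_smul t 1
    rw [smul_eq_mul, mul_one, smul_eq_mul, mul_comm] at this
    rw [Polynomial.eval_mul, Polynomial.eval_C, Polynomial.eval_X]
    exact this
  · obtain ⟨p, hp⟩ := h1
    obtain ⟨q, hq⟩ := h2
    exact ⟨p + q, fun t => by simp [hp, hq]⟩
  · obtain ⟨p, hp⟩ := h1
    obtain ⟨q, hq⟩ := h2
    exact ⟨p * q, fun t => by simp [hp, hq]⟩

theorem polynomial_eval (p : Polynomial k) {f : E → k} (hf : IsPolynomialFun k f) :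
    IsPolynomialFun k fun x => p.eval (f x) := by
  simp only [Polynomial.eval_eq_sum, Polynomial.sum]
  exact sum _ fun i _ => (const _).mul (hf.pow i)

theorem restrict_line {f : E → k} (hf : IsPolynomialFun k f) (a b : E) :
    IsPolynomialFun k fun t : k => f (a + t • b) := by
  refine hf.comp fun l => ?_
  simp only [map_add, map_smul, smul_eq_mul]
  exact (const _).add (id.mul (const _))

/-- Two polynomials in one variable that do not vanish identically have a common non-zero. -/
theorem exists_mul_ne_zero_line [Infinite k] {f g : k → k} (hf : IsPolynomialFun k f)
    (hg : IsPolynomialFun k g) {a b : k} (ha : f a ≠ 0) (hb : g b ≠ 0) :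
    ∃ t, f t ≠ 0 ∧ g t ≠ 0 := by
  obtain ⟨p, hp⟩ := hf.exists_polynomial
  obtain ⟨q, hq⟩ := hg.exists_polynomial
  by_contra! H
  have h0 : p * q = 0 := Polynomial.funext fun r => by
    rw [Polynomial.eval_mul, Polynomial.eval_zero, ← hp, ← hq]
    by_cases h : f r = 0
    · rw [h, zero_mul]
    · rw [H r h, mul_zero]
  rcases mul_eq_zero.mp h0 with h | h
  · exact ha (by rw [hp, h, Polynomial.eval_zero])
  · exact hb (by rw [hq, h, Polynomial.eval_zero])

theorem exists_mul_ne_zero [Infinite k] {f g : E → k} (hf : IsPolynomialFun k f)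
    (hg : IsPolynomialFun k g) {a b : E} (ha : f a ≠ 0) (hb : g b ≠ 0) :
    ∃ x, f x ≠ 0 ∧ g x ≠ 0 := by
  obtain ⟨t, h1, h2⟩ := exists_mul_ne_zero_line (hf.restrict_line a (b - a))
    (hg.restrict_line a (b - a)) (a := 0) (b := 1) (by simpa using ha) (by simpa using hb)
  exact ⟨_, h1, h2⟩

theorem exists_prod_ne_zero [Infinite k] {ι : Type*} (s : Finset ι) {f : ι → E → k}
    (hf : ∀ i ∈ s, IsPolynomialFun k (f i)) (h : ∀ i ∈ s, ∃ x, f i x ≠ 0) :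
    ∃ x, ∀ i ∈ s, f i x ≠ 0 := by
  classical
  induction s using Finset.induction_on with
  | empty => exact ⟨0, by simp⟩
  | insert j s hj ih =>
    obtain ⟨x, hx⟩ := ih (fun i hi => hf i (Finset.mem_insert_of_mem hi))
      fun i hi => h i (Finset.mem_insert_of_mem hi)
    obtain ⟨x', hx'⟩ := h j (Finset.mem_insert_self j s)
    obtain ⟨z, h1, h2⟩ := exists_mul_ne_zero (hf j (Finset.mem_insert_self j s))
      (prod s fun i hi => hf i (Finset.mem_insert_of_mem hi)) hx' (Finset.prod_ne_zero_iff.mpr hx)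
    refine ⟨z, fun i hi => ?_⟩
    rcases Finset.mem_insert.mp hi with rfl | hi
    · exact h1
    · exact Finset.prod_ne_zero_iff.mp h2 i hi

/-- Expansion of a polynomial function at a point, along rays. -/
theorem exists_expansion {h : E → k} (hh : IsPolynomialFun k h) (p : E) :
    ∃ P : Polynomial (Algebra.adjoin k (Set.range fun l : Module.Dual k E => (l : E → k))),
      ∀ (t : k) (y : E), h (p + t • y) = P.sum fun m a => t ^ m * (a : E → k) y := by
  let R := Algebra.adjoin k (Set.range fun l : Module.Dual k E => (l : E → k))
  let ev : E → R →+* k := fun y => (Pi.evalRingHom (fun _ : E => k) y).comp R.val.toRingHom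
  suffices H : ∃ P : Polynomial R, ∀ (t : k) (y : E), h (p + t • y) = P.eval₂ (ev y) t by
    obtain ⟨P, hP⟩ := H
    refine ⟨P, fun t y => ?_⟩
    rw [hP, Polynomial.eval₂_eq_sum]
    simp only [mul_comm]
    rfl
  refine induction (P := fun h => ∃ P : Polynomial R, ∀ (t : k) (y : E),
    h (p + t • y) = P.eval₂ (ev y) t)
    (fun c => ?_) (fun l => ?_) (fun f g h1 h2 => ?_) (fun f g h1 h2 => ?_) hh
  · exact ⟨.C (algebraMap k R c), fun t y => by rw [Polynomial.eval₂_C]; rfl⟩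
  · refine ⟨.C (algebraMap k R (l p)) + .C (⟨fun x => l x, linear l⟩ : R) * .X, fun t y => ?_⟩
    rw [Polynomial.eval₂_add, Polynomial.eval₂_mul, Polynomial.eval₂_C, Polynomial.eval₂_C,
      Polynomial.eval₂_X]
    refine (l.map_add p (t • y)).trans ?_
    rw [map_smul, smul_eq_mul, mul_comm]
    rfl
  · obtain ⟨P, hP⟩ := h1
    obtain ⟨Q, hQ⟩ := h2
    exact ⟨P + Q, fun t y => by rw [Polynomial.eval₂_add, ← hP, ← hQ]⟩
  · obtain ⟨P, hP⟩ := h1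
    obtain ⟨Q, hQ⟩ := h2
    exact ⟨P * Q, fun t y => by rw [Polynomial.eval₂_mul, ← hP, ← hQ]⟩

/-- A map whose differential at a point is onto is dominant: its image lies in no
hypersurface. -/
theorem exists_ne_zero_of_submersion [Infinite k] {h : E → k} (hh : IsPolynomialFun k h)
    {q : E} (hq : h q ≠ 0) {X : Type*} (p : E) (L : X → E) (hL : Function.Surjective L)
    (c : X → k → E) (hc : ∀ x (l : Module.Dual k E), IsPolynomialFun k fun t => l (c x t))
    (h0 : ∀ x, c x 0 = L x) : ∃ x t, h (p + t • c x t) ≠ 0 := by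
  obtain ⟨P, hP⟩ := hh.exists_expansion p
  have hP0 : P ≠ 0 := by
    rintro rfl
    have := hP 1 (q - p)
    rw [Polynomial.sum_zero_index, one_smul, add_sub_cancel] at this
    exact hq this
  -- Let `P_m` be the lowest nonzero term of `h` along rays from `p`. Dividing `h (p + t • c x t)`
  -- by `t ^ m` gives a polynomial `T` in `t` with `T 0 = P_m (L x)`, and surjectivity of `L` allows
  -- this value to be nonzero.
  set m := P.natTrailingDegree with hm
  obtain ⟨y, hy⟩ : ∃ y, (P.coeff m : E → k) y ≠ 0 := by
    by_contra! H
    exact Polynomial.coeff_natTrailingDegree_eq_zero.not.mpr hP0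
      (Subtype.ext (funext fun y => H y))
  obtain ⟨x, rfl⟩ := hL y
  refine ⟨x, ?_⟩
  let T : k → k := fun t => ∑ j ∈ P.support, t ^ (j - m) * (P.coeff j : E → k) (c x t)
  have hT : IsPolynomialFun k T := sum _ fun j _ => (id.pow _).mul
    (IsPolynomialFun.comp (f := (P.coeff j : E → k)) (P.coeff j).2 (hc x))
  have hT0 : T 0 ≠ 0 := by
    have : T 0 = (P.coeff m : E → k) (c x 0) := by
      refine (Finset.sum_eq_single m (fun j hj hjm => ?_) fun h => ?_).trans (by simp)
      · have h1 : m < j := lt_of_le_of_ne (Polynomial.natTrailingDegree_le_of_mem_supp j hj)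
          (Ne.symm hjm)
        rw [zero_pow (by omega), zero_mul]
      · exact absurd (Polynomial.natTrailingDegree_mem_support_of_nonzero hP0) h
    rwa [this, h0]
  obtain ⟨t, h1, h2⟩ := exists_mul_ne_zero_line hT id (a := 0) (b := 1) hT0 one_ne_zero
  refine ⟨t, ?_⟩
  rw [hP]
  have : (P.sum fun j a => t ^ j * (a : E → k) (c x t)) = t ^ m * T t := by
    rw [Finset.mul_sum]
    refine Finset.sum_congr rfl fun j hj => ?_
    rw [← mul_assoc, ← pow_add, Nat.add_sub_cancel' (Polynomial.natTrailingDegree_le_of_mem_supp j hj)]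
  rw [this]
  exact mul_ne_zero (pow_ne_zero _ h2) h1

end IsPolynomialFun

end PolynomialFun

/-! ### Equivariant covectors -/

section Covector

theorem coeff_pow_of_coeff_zero {R : Type*} [CommRing R] {p : Polynomial R} (h : p.coeff 0 = 1)
    (n : ℕ) : (p ^ n).coeff 0 = 1 ∧ (p ^ n).coeff 1 = n * p.coeff 1 := by
  induction n with
  | zero => simp [Polynomial.coeff_one]
  | succ n ih =>
    rw [pow_succ, Polynomial.mul_coeff_zero, Polynomial.mul_coeff_one, ih.1, ih.2, h]
    push_cast
    constructor <;> ring

theorem coeff_prod_of_coeff_zero {R ι : Type*} [CommRing R] (s : Finset ι) {p : ι → Polynomial R}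
    (h : ∀ i ∈ s, (p i).coeff 0 = 1) :
    (∏ i ∈ s, p i).coeff 0 = 1 ∧ (∏ i ∈ s, p i).coeff 1 = ∑ i ∈ s, (p i).coeff 1 := by
  classical
  induction s using Finset.induction_on with
  | empty => simp [Polynomial.coeff_one]
  | insert j s hj ih =>
    obtain ⟨h0, h1⟩ := ih fun i hi => h i (Finset.mem_insert_of_mem hi)
    rw [Finset.prod_insert hj, Finset.sum_insert hj, Polynomial.mul_coeff_zero,
      Polynomial.mul_coeff_one, h0, h1, h j (Finset.mem_insert_self j s)]
    constructor <;> ring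

variable {k : Type*} [Field k] {V : Type*} [AddCommGroup V] [Module k V] {H : Type*} [Group H]

/-- A vector is in general position for a finite group if it is an eigenvector only of the group
elements acting as scalars. -/
theorem exists_general_vector [Infinite k] [Nontrivial V] [Finite H] (ρ : Representation k H V) :
    ∃ v₀ : V, v₀ ≠ 0 ∧ ∀ g, (¬ ∃ c : k, ∀ v, ρ g v = c • v) →
      ∃ l : Module.Dual k V, l (ρ g v₀) = 0 ∧ l v₀ = 1 := by
  classical
  have := Fintype.ofFinite H
  have hex : ∀ g, (¬ ∃ c : k, ∀ v, ρ g v = c • v) → ∃ l m : Module.Dual k V, ∃ v,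
      l (ρ g v) * m v - l v * m (ρ g v) ≠ 0 := by
    intro g hg
    obtain ⟨v, hv⟩ : ∃ v, LinearIndependent k ![v, ρ g v] := by
      by_contra! H
      obtain ⟨c, hc⟩ := LinearMap.exists_eq_smul_id_of_forall_notLinearIndependent H
      exact hg ⟨c, fun v => by rw [hc]; rfl⟩
    rw [LinearIndependent.pair_iff] at hv
    have hv0 : v ≠ 0 := by
      rintro rfl
      simpa using hv 1 0 (by simp)
    obtain ⟨l, hl, hlv⟩ := Submodule.exists_le_ker_of_notMem (p := Submodule.span k {v})
      (v := ρ g v) (by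
        rw [Submodule.mem_span_singleton]
        rintro ⟨c, hc⟩
        simpa using (hv c (-1) (by rw [hc]; simp)).2)
    obtain ⟨m, hm⟩ := not_forall.mp ((Module.forall_dual_apply_eq_zero_iff k v).not.mpr hv0)
    refine ⟨l, m, v, ?_⟩
    have : l v = 0 := hlv (Submodule.mem_span_singleton_self v)
    rw [this, zero_mul, sub_zero]
    exact mul_ne_zero hl hm
  choose! l m hlm using hex
  obtain ⟨w, hw⟩ := exists_ne (0 : V)
  obtain ⟨μ, hμ⟩ := not_forall.mp ((Module.forall_dual_apply_eq_zero_iff k w).not.mpr hw)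
  -- These are `2 × 2` minors of the pair `v`, `g v`; where such a minor is nonzero, `v` is no
  -- eigenvector of `g`.
  have hp : ∀ g, IsPolynomialFun k fun v => l g (ρ g v) * m g v - l g v * m g (ρ g v) := fun g =>
    ((IsPolynomialFun.linear (l g ∘ₗ ρ g)).mul (.linear (m g))).sub
      ((IsPolynomialFun.linear (l g)).mul (.linear (m g ∘ₗ ρ g)))
  obtain ⟨v₁, hv₁⟩ := IsPolynomialFun.exists_prod_ne_zero
    (Finset.univ.filter fun g => ¬ ∃ c : k, ∀ v, ρ g v = c • v) (fun g _ => hp g)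
    (fun g hg => hlm g (Finset.mem_filter.mp hg).2)
  obtain ⟨v₀, h1, h2⟩ := IsPolynomialFun.exists_mul_ne_zero
    (IsPolynomialFun.prod _ fun g _ => hp g) (.linear μ) (Finset.prod_ne_zero_iff.mpr hv₁) hμ
  refine ⟨v₀, fun h => h2 (by rw [h, map_zero]), fun g hg => ?_⟩
  have h3 := Finset.prod_ne_zero_iff.mp h1 g (Finset.mem_filter.mpr ⟨Finset.mem_univ g, hg⟩)
  -- The combination of the two functionals that kills `g v₀`, divided by its value at `v₀`.
  refine ⟨(l g (ρ g v₀) * m g v₀ - l g v₀ * m g (ρ g v₀))⁻¹ •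
    (l g (ρ g v₀) • m g - m g (ρ g v₀) • l g), ?_, ?_⟩
  · simp [mul_comm]
  · simp only [LinearMap.smul_apply, LinearMap.sub_apply, smul_eq_mul]
    rw [mul_comm (m g (ρ g v₀))]
    exact inv_mul_cancel₀ h3

/-- A finite group acting linearly on `V` admits a dominant homogeneous equivariant polynomial
map `V → V^∨`. -/
theorem exists_equivariant_covector [CharZero k] [FiniteDimensional k V] [Nontrivial V] [Finite H]
    (ρ : Representation k H V) : ∃ (d : ℕ) (l : V → Module.Dual k V),
      (∀ w, IsPolynomialFun k fun v => l v w) ∧ (∀ (r : k) v, l (r • v) = r ^ (d + 1) • l v) ∧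
      (∀ g v w, l (ρ g v) (ρ g w) = l v w) ∧
      ∀ h : Module.Dual k V → k, IsPolynomialFun k h → ∀ q, h q ≠ 0 → ∃ v, h (l v) ≠ 0 := by
  classical
  have := Fintype.ofFinite H
  obtain ⟨v₀, hv₀, hgen⟩ := exists_general_vector ρ
  choose! lam hlam0 hlam1 using hgen
  obtain ⟨μ', hμ'⟩ := not_forall.mp ((Module.forall_dual_apply_eq_zero_iff k v₀).not.mpr hv₀)
  obtain ⟨μ, hμ⟩ : ∃ μ : Module.Dual k V, μ v₀ = 1 := ⟨(μ' v₀)⁻¹ • μ', by simp [hμ']⟩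
  set T : Finset H := Finset.univ.filter fun g => ¬ ∃ c : k, ∀ v, ρ g v = c • v with hT
  have hT1 : ∀ g ∈ T, lam g (ρ g v₀) = 0 := fun g hg => hlam0 g (Finset.mem_filter.mp hg).2
  have hT2 : ∀ g ∈ T, lam g v₀ = 1 := fun g hg => hlam1 g (Finset.mem_filter.mp hg).2
  set N := Fintype.card H with hN
  have hN0 : 0 < N := Fintype.card_pos
  let B : V ≃ₗ[k] Module.Dual k V :=
    LinearEquiv.ofFinrankEq V (Module.Dual k V) Subspace.dual_finrank_eq.symm
  -- Equal to `1` at `v₀` and vanishing to order at least `2 * N` at `g v₀` for each nonscalar `g`.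
  -- The factor in `μ` adjusts the degree so that `e + 2` is divisible by the group order.
  let f : V → k := fun v => (∏ g ∈ T, lam g v ^ (2 * N)) * μ v ^ (2 * N - 2)
  let e : ℕ := 2 * N * T.card + (2 * N - 2)
  have hfhom : ∀ (r : k) v, f (r • v) = r ^ e * f v := by
    intro r v
    simp only [f, e, map_smul, smul_eq_mul, mul_pow, Finset.prod_mul_distrib, Finset.prod_const,
      pow_add]
    rw [← pow_mul]
    ring
  have hfpoly : IsPolynomialFun k f :=
    (IsPolynomialFun.prod _ fun g _ => (IsPolynomialFun.linear _).pow _).mul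
      ((IsPolynomialFun.linear _).pow _)
  -- The group average of `f v • B v`. Near `v₀` its first-order part comes from the scalar elements
  -- only.
  let l : V → Module.Dual k V := fun v => ∑ g, f (ρ g v) • (B (ρ g v)).comp (ρ g)
  have hl : ∀ v w, l v w = ∑ g, f (ρ g v) * B (ρ g v) (ρ g w) := fun v w => by
    simp [l, LinearMap.sum_apply]
  refine ⟨e, l, fun w => ?_, fun r v => ?_, fun g v w => ?_, fun h hh q hq => ?_⟩
  · simp only [hl]
    exact .sum _ fun g _ => (hfpoly.comp fun m => .linear (m ∘ₗ ρ g)).mul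
      (.linear (LinearMap.applyₗ (ρ g w) ∘ₗ B.toLinearMap ∘ₗ ρ g))
  · ext w
    rw [LinearMap.smul_apply, hl, hl, smul_eq_mul, Finset.mul_sum]
    refine Finset.sum_congr rfl fun g _ => ?_
    rw [map_smul, hfhom, map_smul, LinearMap.smul_apply, smul_eq_mul, pow_succ]
    ring
  · rw [hl, hl]
    refine Fintype.sum_equiv (Equiv.mulRight g) _ _ fun x => ?_
    simp [map_mul]
  -- dominance: expand at `v₀`
  · let F : V → Polynomial k := fun x =>
      (∏ g ∈ T, (1 + Polynomial.C (lam g x) * Polynomial.X) ^ (2 * N)) *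
        (1 + Polynomial.C (μ x) * Polynomial.X) ^ (2 * N - 2)
    -- The differential of `f` at `v₀`; its value at `v₀` is the degree, by Euler's formula.
    let φ : Module.Dual k V := ∑ g ∈ T, (2 * N : ℕ) • lam g + (2 * N - 2 : ℕ) • μ
    have hφ₀ : φ v₀ = (e : k) := by
      simp only [φ, e, LinearMap.add_apply, LinearMap.sum_apply, LinearMap.smul_apply, hμ]
      rw [Finset.sum_congr rfl fun g hg => by rw [hT2 g hg]]
      simp [mul_comm]
    have hF : ∀ x t, f (v₀ + t • x) = (F x).eval t := by
      intro x t
      simp only [f, F, map_add, map_smul, smul_eq_mul, hμ, Polynomial.eval_mul,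
        Polynomial.eval_prod, Polynomial.eval_pow, Polynomial.eval_add, Polynomial.eval_one,
        Polynomial.eval_C, Polynomial.eval_X]
      congr 1
      · exact Finset.prod_congr rfl fun g hg => by rw [hT2 g hg, mul_comm]
      · rw [mul_comm]
    have hF01 : ∀ x, (F x).coeff 0 = 1 ∧ (F x).coeff 1 = φ x := by
      intro x
      have h0 : ∀ a : k, (1 + Polynomial.C a * Polynomial.X).coeff 0 = 1 := fun a => by simp
      have h1 : ∀ a : k, (1 + Polynomial.C a * Polynomial.X).coeff 1 = a := fun a => by
        simp [Polynomial.coeff_one]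
      obtain ⟨p0, p1⟩ := coeff_prod_of_coeff_zero T
        (p := fun g => (1 + Polynomial.C (lam g x) * Polynomial.X) ^ (2 * N))
        fun g _ => (coeff_pow_of_coeff_zero (h0 _) _).1
      obtain ⟨q0, q1⟩ := coeff_pow_of_coeff_zero (h0 (μ x)) (2 * N - 2)
      simp only [F, Polynomial.mul_coeff_zero, Polynomial.mul_coeff_one, p0, p1, q0, q1, h1, φ,
        LinearMap.add_apply, LinearMap.sum_apply, LinearMap.smul_apply, nsmul_eq_mul, mul_one,
        one_mul, true_and]
      rw [add_comm]
      congr 1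
      exact Finset.sum_congr rfl fun g _ => by rw [(coeff_pow_of_coeff_zero (h0 _) _).2, h1]
    have hFX : ∀ x t, (F x).eval t = 1 + t * (F x).divX.eval t := by
      intro x t
      conv_lhs => rw [← Polynomial.divX_mul_X_add (F x)]
      simp [(hF01 x).1]
      ring
    have hFX0 : ∀ x, (F x).divX.eval 0 = φ x := by
      intro x
      rw [← Polynomial.coeff_zero_eq_eval_zero, Polynomial.coeff_divX]
      exact (hF01 x).2
    -- the remaining factors at `ρ g v₀`
    let M : H → V → k → k := fun g x t => lam g (ρ g x) ^ (2 * N) *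
      ((∏ g' ∈ T.erase g, lam g' (ρ g (v₀ + t • x)) ^ (2 * N)) *
        μ (ρ g (v₀ + t • x)) ^ (2 * N - 2))
    have hM : ∀ g ∈ T, ∀ x t, f (ρ g (v₀ + t • x)) = t * (t ^ (2 * N - 1) * M g x t) := by
      intro g hg x t
      simp only [f, M]
      rw [← Finset.mul_prod_erase T _ hg]
      have hlg : lam g (ρ g (v₀ + t • x)) = t * lam g (ρ g x) := by
        rw [map_add, map_add, hT1 g hg, zero_add, map_smul, map_smul, smul_eq_mul]
      have : t ^ (2 * N) = t * t ^ (2 * N - 1) := by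
        rw [← pow_succ']
        congr 1
        omega
      rw [hlg, mul_pow, this]
      ring
    -- An element acting by `c` has `c ^ N = 1` and scales its summand by `c ^ (e + 2) = 1`, so all
    -- scalar elements contribute equally.
    have hscalar : ∀ g ∉ T, ∀ v w, f (ρ g v) * B (ρ g v) (ρ g w) = f v * B v w := by
      intro g hg v w
      obtain ⟨c, hc⟩ : ∃ c : k, ∀ v, ρ g v = c • v := by
        by_contra hcon
        exact hg (Finset.mem_filter.mpr ⟨Finset.mem_univ g, hcon⟩)
      have hpow : ∀ n : ℕ, ρ (g ^ n) v₀ = c ^ n • v₀ := by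
        intro n
        induction n with
        | zero => simp
        | succ n ih => rw [pow_succ', map_mul, Module.End.mul_apply, ih, map_smul, hc, smul_smul,
            pow_succ]
      have hcN : c ^ N = 1 := by
        have h1 := hpow N
        rw [hN, pow_card_eq_one, map_one, Module.End.one_apply, ← sub_eq_zero, ← one_smul k v₀,
          smul_smul, ← sub_smul] at h1
        have := (smul_eq_zero.mp h1).resolve_right hv₀
        rw [mul_one, sub_eq_zero] at this
        exact this.symm
      rw [hc, hc, hfhom, map_smul, map_smul, LinearMap.smul_apply, smul_eq_mul, smul_eq_mul]
      have hce : c ^ (e + 2) = 1 := by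
        have : e + 2 = N * (2 * (T.card + 1)) := by
          simp only [e]
          have h2 : 2 * N - 2 + 2 = 2 * N := by omega
          rw [add_assoc, h2]
          ring
        rw [this, pow_mul, hcN, one_pow]
      calc c ^ e * f v * (c * (c * B v w)) = c ^ (e + 2) * (f v * B v w) := by ring
        _ = f v * B v w := by rw [hce, one_mul]
    set n : k := (Tᶜ.card : k) with hn
    have hn0 : n ≠ 0 := by
      rw [hn, Nat.cast_ne_zero]
      refine Finset.card_ne_zero_of_mem (a := 1) ?_
      rw [Finset.mem_compl, hT, Finset.mem_filter, not_and_not_right]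
      exact fun _ => ⟨1, fun v => by simp⟩
    let c : V → k → Module.Dual k V := fun x t =>
      n • ((F x).divX.eval t • B v₀ + (F x).eval t • B x) +
        ∑ g ∈ T, (t ^ (2 * N - 1) * M g x t) • (B (ρ g (v₀ + t • x))).comp (ρ g)
    have hlc : ∀ x t, l (v₀ + t • x) = n • B v₀ + t • c x t := by
      intro x t
      ext w
      rw [hl, ← Finset.sum_add_sum_compl T]
      rw [Finset.sum_congr rfl fun g hg => by rw [hM g hg]]
      rw [Finset.sum_congr (s₁ := Tᶜ) rfl fun g hg => hscalar g (Finset.mem_compl.mp hg) _ _]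
      simp only [c, LinearMap.add_apply, LinearMap.smul_apply, LinearMap.sum_apply,
        Finset.sum_const, nsmul_eq_mul, smul_eq_mul, map_add, map_smul, hF, LinearMap.comp_apply,
        ← hn, mul_add, Finset.mul_sum, mul_assoc]
      rw [hFX]
      ring
    -- The differential of the average at `v₀`. It is the identity plus a rank-one map, up to `B`
    -- and `n`, and it is invertible because `1 + φ v₀ = 1 + e` is nonzero in characteristic zero.
    have hL : Function.Surjective fun x => n • (φ x • B v₀ + B x) := by
      intro q
      have he1 : (1 + (e : k)) ≠ 0 := by
        have : ((1 + e : ℕ) : k) ≠ 0 := Nat.cast_ne_zero.mpr (by omega)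
        simpa using this
      set z := B.symm (n⁻¹ • q) with hz
      refine ⟨z - (φ z / (1 + e)) • v₀, ?_⟩
      have hφ : φ (z - (φ z / (1 + e)) • v₀) = φ z / (1 + e) := by
        rw [map_sub, map_smul, hφ₀, smul_eq_mul]
        field_simp
        ring
      simp only
      rw [hφ, map_sub, map_smul, add_sub_cancel, hz, B.apply_symm_apply, smul_smul,
        mul_inv_cancel₀ hn0, one_smul]
    have hc : ∀ x (m : Module.Dual k (Module.Dual k V)), IsPolynomialFun k fun t => m (c x t) := by
      intro x m
      have hline : ∀ (g : H) (m : Module.Dual k V),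
          IsPolynomialFun k fun t : k => m (ρ g (v₀ + t • x)) := fun g m =>
        (IsPolynomialFun.linear (m ∘ₗ ρ g)).restrict_line v₀ x
      simp only [c, map_add, map_smul, smul_eq_mul, map_sum]
      refine .add (.mul (.const _) (.add (.mul (.polynomial_eval _ .id) (.const _))
        (.mul (.polynomial_eval _ .id) (.const _)))) (.sum _ fun g hg => .mul (.mul (.pow .id _)
          (.mul (.const _) (.mul (.prod _ fun g' _ => ?_) ?_))) ?_)
      · have := (hline g (lam g')).pow (2 * N)
        simpa only [map_add, map_smul] using this
      · have := (hline g μ).pow (2 * N - 2)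
        simpa only [map_add, map_smul] using this
      · have := (IsPolynomialFun.linear (m ∘ₗ Module.Dual.transpose (ρ g) ∘ₗ B.toLinearMap ∘ₗ
          ρ g)).restrict_line v₀ x
        refine (congrArg (IsPolynomialFun k) (funext fun t => ?_)).mp this
        simp only [← map_smul, ← map_add]
        rfl
    have hc0 : ∀ x, c x 0 = n • (φ x • B v₀ + B x) := by
      intro x
      simp only [c]
      rw [hFX0, hFX]
      have : (0 : k) ^ (2 * N - 1) = 0 := zero_pow (by omega)
      simp [this]
    obtain ⟨x, t, hxt⟩ := IsPolynomialFun.exists_ne_zero_of_submersion hh hq (n • B v₀)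
      (fun x => n • (φ x • B v₀ + B x)) hL c hc hc0
    exact ⟨v₀ + t • x, by rwa [hlc]⟩

end Covector

/-! ### Birational maps given by correspondences -/

section Correspondence

variable {k : Type*} [Field k]
variable {U V W E : Type*} [AddCommGroup U] [Module k U] [AddCommGroup V] [Module k V]
  [AddCommGroup W] [Module k W] [AddCommGroup E] [Module k E]
variable {U' V' W' : Type*} [AddCommGroup U'] [Module k U'] [AddCommGroup V'] [Module k V']
  [AddCommGroup W'] [Module k W']

theorem isMultihomogeneous_scalar {f : U × V × W → k} (hf : IsPolynomialFun k f) {a b c : ℕ}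
    (h : ∀ (r s t : k) u v w, f (r • u, s • v, t • w) = r ^ a * s ^ b * t ^ c * f (u, v, w)) :
    IsMultihomogeneous k f := by
  refine ⟨fun l => ?_, a, b, c, h⟩
  have : (fun x => l (f x)) = fun x => f x * l 1 := by
    ext x
    have := l.map_smul (f x) 1
    rwa [smul_eq_mul, mul_one] at this
  rw [this]
  exact hf.mul (.const _)

theorem IsMultihomogeneous.isPolynomialFun {f : U × V × W → k} (hf : IsMultihomogeneous k f) :
    IsPolynomialFun k f := hf.1 LinearMap.id

theorem IsMultihomogeneous.mul {f g : U × V × W → k} (hf : IsMultihomogeneous k f)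
    (hg : IsMultihomogeneous k g) : IsMultihomogeneous k fun x => f x * g x := by
  obtain ⟨a, b, c, h⟩ := hf.2
  obtain ⟨a', b', c', h'⟩ := hg.2
  refine isMultihomogeneous_scalar (a := a + a') (b := b + b') (c := c + c')
    (hf.isPolynomialFun.mul hg.isPolynomialFun) fun r s t u v w => ?_
  rw [h, h', smul_eq_mul, smul_eq_mul]
  ring

/-- The principal open sets form a basis of the Zariski topology. -/
theorem exists_principal_open {N : Set (ℙ k U × ℙ k V × ℙ k W)} (hN : IsOpen[zariski k U V W] N)
    {x : ℙ k U × ℙ k V × ℙ k W} (hx : x ∈ N) :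
    ∃ f : U × V × W → k, IsMultihomogeneous k f ∧ f (coords x) ≠ 0 ∧
      ∀ y, f (coords y) ≠ 0 → y ∈ N := by
  induction hN with
  | basic s hs =>
    obtain ⟨f, hf, rfl⟩ := hs
    exact ⟨f, hf, hx, fun y hy => hy⟩
  | univ =>
    exact ⟨fun _ => 1, isMultihomogeneous_scalar (a := 0) (b := 0) (c := 0) (.const 1)
      (by simp), one_ne_zero, fun y _ => trivial⟩
  | inter s t _ _ hs ht =>
    obtain ⟨f, hf, hfx, hfs⟩ := hs hx.1
    obtain ⟨g, hg, hgx, hgt⟩ := ht hx.2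
    exact ⟨_, hf.mul hg, mul_ne_zero hfx hgx, fun y hy =>
      ⟨hfs y (left_ne_zero_of_mul hy), hgt y (right_ne_zero_of_mul hy)⟩⟩
  | sUnion S _ ih =>
    obtain ⟨s, hs, hxs⟩ := hx
    obtain ⟨f, hf, hfx, hfs⟩ := ih s hs hxs
    exact ⟨f, hf, hfx, fun y hy => ⟨s, hs, hfs y hy⟩⟩

theorem isOpen_principal {f : U × V × W → k} (hf : IsMultihomogeneous k f) :
    IsOpen[zariski k U V W] {x | f (coords x) ≠ 0} :=
  TopologicalSpace.isOpen_generateFrom_of_mem ⟨f, hf, rfl⟩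

theorem IsMultihomogeneous.coords_ne_zero {f : U × V × W → k} (hf : IsMultihomogeneous k f)
    {p : ℙ k U} {q : ℙ k V} {w : W} (hw : w ≠ 0) (h : f (p.rep, q.rep, w) ≠ 0) :
    f (coords (p, q, Projectivization.mk k w hw)) ≠ 0 := by
  obtain ⟨a, b, c, hf⟩ := hf.2
  obtain ⟨r, hr⟩ := Projectivization.exists_smul_eq_mk_rep k w hw
  have h1 := hf 1 1 (r : k) p.rep q.rep w
  rw [one_smul, one_smul] at h1
  have h2 : (r : k) • w = (Projectivization.mk k w hw).rep := hr
  rw [h2] at h1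
  rw [coords]
  simp only
  rw [h1]
  exact smul_ne_zero (by simp) h

/-- A correspondence `R` with source in `S` is locally given by polynomials near each point of
its domain, and the domain meets all principal open sets that meet `S`. -/
structure IsLocallyPolynomial (R : ℙ k U × ℙ k V × ℙ k W → ℙ k U' × ℙ k V' × ℙ k W' → Prop)
    (S : Set (ℙ k U × ℙ k V × ℙ k W)) : Prop where
  mem : ∀ x x', R x x' → x ∈ S
  unique : ∀ x x' x'', R x x' → R x x'' → x' = x''
  regular : ∀ x x', R x x' → ∃ f : U × V × W → k, IsMultihomogeneous k f ∧ f (coords x) ≠ 0 ∧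
    ∃ (F₁ : U × V × W → U') (F₂ : U × V × W → V') (F₃ : U × V × W → W'),
      IsMultihomogeneous k F₁ ∧ IsMultihomogeneous k F₂ ∧ IsMultihomogeneous k F₃ ∧
      ∀ y ∈ S, f (coords y) ≠ 0 →
        ∃ (h₁ : F₁ (coords y) ≠ 0) (h₂ : F₂ (coords y) ≠ 0) (h₃ : F₃ (coords y) ≠ 0),
        R y (.mk k _ h₁, .mk k _ h₂, .mk k _ h₃)
  dense : ∀ x ∈ S, ∀ f : U × V × W → k, IsMultihomogeneous k f → f (coords x) ≠ 0 →
    ∃ y y', R y y' ∧ f (coords y) ≠ 0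

variable {R : ℙ k U × ℙ k V × ℙ k W → ℙ k U' × ℙ k V' × ℙ k W' → Prop}
  {S : Set (ℙ k U × ℙ k V × ℙ k W)} {S' : Set (ℙ k U' × ℙ k V' × ℙ k W')}

theorem IsLocallyPolynomial.isOpenDenseIn (h : IsLocallyPolynomial R S) :
    IsOpenDenseIn {x | ∃ x', R x x'} S := by
  refine ⟨⟨⋃₀ {N | IsOpen[zariski k U V W] N ∧ ∀ y ∈ S, y ∈ N → ∃ y', R y y'}, ?_, ?_⟩, ?_⟩
  · exact @isOpen_sUnion _ (zariski k U V W) _ fun N hN => hN.1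
  · ext x
    constructor
    · rintro ⟨x', hx⟩
      refine ⟨h.mem x x' hx, ?_⟩
      obtain ⟨f, hf, hfx, F₁, F₂, F₃, -, -, -, hF⟩ := h.regular x x' hx
      refine ⟨_, ⟨isOpen_principal hf, fun y hy hfy => ?_⟩, hfx⟩
      obtain ⟨h₁, h₂, h₃, hR⟩ := hF y hy hfy
      exact ⟨_, hR⟩
    · rintro ⟨hxS, N, ⟨-, hN⟩, hxN⟩
      exact hN x hxS hxN
  · intro x hx
    rw [@mem_closure_iff _ (zariski k U V W)]
    intro N hN hxN
    obtain ⟨f, hf, hfx, hfN⟩ := exists_principal_open hN hxN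
    obtain ⟨y, y', hR, hfy⟩ := h.dense x hx f hf hfx
    exact ⟨y, hfN y hfy, y', hR⟩

theorem IsLocallyPolynomial.isRegularOn (h : IsLocallyPolynomial R S)
    {φ : ℙ k U × ℙ k V × ℙ k W → ℙ k U' × ℙ k V' × ℙ k W'} (hφ : ∀ x x', R x x' → φ x = x') :
    IsRegularOn φ {x | ∃ x', R x x'} := by
  rintro x ⟨x', hx⟩
  obtain ⟨f, hf, hfx, F₁, F₂, F₃, hF₁, hF₂, hF₃, hF⟩ := h.regular x x' hx
  refine ⟨_, isOpen_principal hf, hfx, F₁, F₂, F₃, hF₁, hF₂, hF₃, ?_⟩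
  rintro y ⟨⟨y', hy⟩, hfy⟩
  obtain ⟨h₁, h₂, h₃, hR⟩ := hF y (h.mem y y' hy) hfy
  exact ⟨h₁, h₂, h₃, hφ _ _ hR⟩

/-- A correspondence that is locally polynomial in both directions defines a birational map. -/
theorem equivariantlyBirational_of_correspondence {G : Type*} [Group G]
    {α : G →* Equiv.Perm (ℙ k U × ℙ k V × ℙ k W)}
    {β : G →* Equiv.Perm (ℙ k U' × ℙ k V' × ℙ k W')}
    [Nonempty (ℙ k U × ℙ k V × ℙ k W)] [Nonempty (ℙ k U' × ℙ k V' × ℙ k W')]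
    (h : IsLocallyPolynomial R S) (h' : IsLocallyPolynomial (fun x' x => R x x') S')
    (hG : ∀ g x x', R x x' → R (α g x) (β g x')) : EquivariantlyBirational α S β S' := by
  classical
  -- Outside the domain of `R` the value is arbitrary and plays no role.
  let φ : ℙ k U × ℙ k V × ℙ k W → ℙ k U' × ℙ k V' × ℙ k W' := fun x => Classical.epsilon (R x)
  let ψ : ℙ k U' × ℙ k V' × ℙ k W' → ℙ k U × ℙ k V × ℙ k W :=
    fun x' => Classical.epsilon fun x => R x x'
  have hφ : ∀ x x', R x x' → φ x = x' := fun x x' hx =>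
    h.unique x _ _ (Classical.epsilon_spec ⟨x', hx⟩) hx
  have hψ : ∀ x' x, R x x' → ψ x' = x := fun x' x hx =>
    h'.unique x' _ _ (Classical.epsilon_spec (p := fun x => R x x') ⟨x, hx⟩) hx
  refine ⟨⟨φ, ψ, {x | ∃ x', R x x'}, {x' | ∃ x, R x x'}, ?_, ?_, ?_, ?_⟩, h.isOpenDenseIn,
    h'.isOpenDenseIn, h.isRegularOn hφ, h'.isRegularOn hψ, ?_⟩
  · rintro x ⟨x', hx⟩
    exact ⟨x, by rwa [hφ x x' hx]⟩
  · rintro x' ⟨x, hx⟩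
    exact ⟨x', by rwa [hψ x' x hx]⟩
  · rintro x ⟨x', hx⟩
    rw [hφ x x' hx, hψ x' x hx]
  · rintro x' ⟨x, hx⟩
    rw [hψ x' x hx, hφ x x' hx]
  · rintro g x ⟨x', hx⟩
    refine ⟨⟨_, hG g x x' hx⟩, ?_⟩
    show φ (α g x) = β g (φ x)
    rw [hφ _ _ (hG g x x' hx), hφ x x' hx]

end Correspondence

/-! ### The Pfaffian–Grassmannian correspondence -/

section Correspondence

variable {k : Type*} [Field k] {V : Type*} [AddCommGroup V] [Module k V]

/-- The exterior product of two linear forms. -/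
def wedge (f g : Module.Dual k V) : V [⋀^Fin 2]→ₗ[k] k where
  toFun v := f (v 0) * g (v 1) - f (v 1) * g (v 0)
  map_update_add' v i x y := by
    fin_cases i <;> simp <;> ring
  map_update_smul' v i c x := by
    fin_cases i <;> simp <;> ring
  map_eq_zero_of_eq' v i j h hij := by
    fin_cases i <;> fin_cases j <;> simp_all

/-- `ω` is in the space of forms `A`, `ξ = u ∧ w` is a plane isotropic for all forms in `A`, the
line `u` is the intersection of `ker l` both with `ker ω` and with the plane `⟨u, w⟩`, and
it determines both `ω` and `⟨u, w⟩`. -/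
def Corresponds (A : Submodule k (V [⋀^Fin 2]→ₗ[k] k)) (ω : V [⋀^Fin 2]→ₗ[k] k) (ξ : ⋀[k]^2 V)
    (l : Module.Dual k V) : Prop :=
  ω ∈ A ∧ ω ≠ 0 ∧ ∃ u w : V, ξ = exteriorPower.ιMulti k 2 ![u, w] ∧ u ≠ 0 ∧
    (∀ x, ω ![u, x] = 0) ∧ l u = 0 ∧ l w ≠ 0 ∧ (∀ η ∈ A, η ![u, w] = 0) ∧
    (∃ u', (∀ x, ω ![u', x] = 0) ∧ l u' ≠ 0) ∧
    (∀ η ∈ A, (∀ x, η ![u, x] = 0) → ∃ c : k, η = c • ω) ∧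
    (∀ w', (∀ η ∈ A, η ![u, w'] = 0) → ∃ c d : k, w' = c • u + d • w) ∧
    ∀ u', (∀ x, ω ![u', x] = 0) → l u' = 0 → ∃ c : k, u' = c • u

theorem ιMulti_smul_add (u w : V) (a c d : k) :
    exteriorPower.ιMulti k 2 ![a • u, c • u + d • w] =
      (a * d) • exteriorPower.ιMulti k 2 ![u, w] := by
  have h0 : ![a • u, c • u + d • w] = Function.update ![a • u, 0] 1 (c • u + d • w) := by
    ext i; fin_cases i <;> rfl
  have h1 : ![u, w] = Function.update ![u, w] 1 w := by
    ext i; fin_cases i <;> rfl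
  have h2 : Function.update ![a • u, 0] 1 u = Function.update ![u, u] 0 (a • u) := by
    ext i; fin_cases i <;> rfl
  have h3 : Function.update ![a • u, 0] 1 w = Function.update ![u, w] 0 (a • u) := by
    ext i; fin_cases i <;> rfl
  have h4 : Function.update ![u, u] 0 u = ![u, u] := by
    ext i; fin_cases i <;> rfl
  have h5 : Function.update ![u, w] 0 u = ![u, w] := by
    ext i; fin_cases i <;> rfl
  rw [h0, AlternatingMap.map_update_add, AlternatingMap.map_update_smul,
    AlternatingMap.map_update_smul, h2, h3, AlternatingMap.map_update_smul,
    AlternatingMap.map_update_smul, h4, h5,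
    AlternatingMap.map_eq_zero_of_eq _ ![u, u] (i := 0) (j := 1) rfl (by decide), smul_zero,
    smul_zero, zero_add, smul_smul, mul_comm]

/-- The contraction of a bivector with a linear form, paired with another linear form. -/
noncomputable def contract (l m : Module.Dual k V) : ⋀[k]^2 V →ₗ[k] k :=
  exteriorPower.alternatingMapLinearEquiv (wedge l m)

theorem contract_ιMulti (l m : Module.Dual k V) (u w : V) :
    contract l m (exteriorPower.ιMulti k 2 ![u, w]) = l u * m w - l w * m u :=
  exteriorPower.alternatingMapLinearEquiv_apply_ιMulti _ _

/-- Contracting `u ∧ w` with `l` gives `-l(w) u` when `l u = 0`. The bivector alone thus determines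
the line in which its plane meets `l = 0`. -/
theorem eq_smul_of_contract {l : Module.Dual k V} {u w u₂ w₂ : V} (hu : l u = 0) (hw : l w ≠ 0)
    (hu₂ : l u₂ = 0)
    (h : exteriorPower.ιMulti k 2 ![u, w] = exteriorPower.ιMulti k 2 ![u₂, w₂]) :
    u = (l w₂ / l w) • u₂ := by
  rw [← sub_eq_zero, ← Module.forall_dual_apply_eq_zero_iff k]
  intro m
  have := congrArg (contract l m) h
  rw [contract_ιMulti, contract_ιMulti, hu, hu₂] at this
  rw [map_sub, map_smul, smul_eq_mul]
  field_simp
  linear_combination -this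

variable {A : Submodule k (V [⋀^Fin 2]→ₗ[k] k)} {ω ω' : V [⋀^Fin 2]→ₗ[k] k} {ξ ξ' : ⋀[k]^2 V}
  {l : Module.Dual k V}

theorem Corresponds.bivector_ne_zero (h : Corresponds A ω ξ l) : ξ ≠ 0 := by
  obtain ⟨-, -, u, w, rfl, hu, -, hlu, hlw, -⟩ := h
  obtain ⟨m, hm⟩ := not_forall.mp ((Module.forall_dual_apply_eq_zero_iff k u).not.mpr hu)
  intro h0
  have := congrArg (contract l m) h0
  rw [contract_ιMulti, hlu, map_zero, zero_mul, zero_sub, neg_eq_zero] at this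
  exact mul_ne_zero hlw hm this

/-- The form and the hyperplane determine the line of `u`, and this line determines the isotropic
plane. -/
theorem Corresponds.unique_bivector (h : Corresponds A ω ξ l) (h' : Corresponds A ω ξ' l) :
    ∃ c : k, ξ' = c • ξ := by
  obtain ⟨-, -, u, w, rfl, hu, hωu, hlu, hlw, -, -, -, hpl, hker⟩ := h
  obtain ⟨-, -, u₂, w₂, rfl, hu₂, hωu₂, hlu₂, hlw₂, hiso, -⟩ := h'
  obtain ⟨a, rfl⟩ := hker u₂ hωu₂ hlu₂
  have ha : a ≠ 0 := fun h => hu₂ (by rw [h, zero_smul])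
  obtain ⟨c, d, rfl⟩ := hpl w₂ fun η hη => by
    have h1 := hiso η hη
    have h2 : ![a • u, w₂] = Function.update ![u, w₂] 0 (a • u) := by
      ext i; fin_cases i <;> rfl
    have h3 : Function.update ![u, w₂] 0 u = ![u, w₂] := by
      ext i; fin_cases i <;> rfl
    rw [h2, AlternatingMap.map_update_smul, h3] at h1
    exact (smul_eq_zero.mp h1).resolve_left ha
  exact ⟨_, ιMulti_smul_add u w a c d⟩

theorem Corresponds.unique_form (h : Corresponds A ω ξ l) (h' : Corresponds A ω' ξ l) :
    ∃ c : k, ω' = c • ω := by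
  obtain ⟨-, -, u, w, rfl, hu, hωu, hlu, hlw, -, -, hform, -, -⟩ := h
  obtain ⟨hA, -, u₂, w₂, h2, hu₂, hωu₂, hlu₂, hlw₂, -, -, -, -, -⟩ := h'
  refine hform ω' hA fun x => ?_
  have h3 := eq_smul_of_contract hlu hlw hlu₂ h2
  have h4 : ![u, x] = Function.update ![u₂, x] 0 ((l w₂ / l w) • u₂) := by
    rw [← h3]
    ext i; fin_cases i <;> rfl
  have h5 : Function.update ![u₂, x] 0 u₂ = ![u₂, x] := by
    ext i; fin_cases i <;> rfl
  rw [h4, AlternatingMap.map_update_smul, h5, hωu₂, smul_zero]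

/-- All the conditions concern lines and planes only, so the relation descends to projective points.
-/
theorem Corresponds.smul (h : Corresponds A ω ξ l) {a b c : k} (ha : a ≠ 0) (hb : b ≠ 0)
    (hc : c ≠ 0) : Corresponds A (a • ω) (b • ξ) (c • l) := by
  obtain ⟨hA, h0, u, w, rfl, hu, hωu, hlu, hlw, hiso, ⟨u', hu', hlu'⟩, hform, hpl, hker⟩ := h
  refine ⟨A.smul_mem a hA, smul_ne_zero ha h0, u, b • w, ?_, hu, fun x => by simp [hωu], ?_, ?_,
    fun η hη => ?_, ⟨u', fun x => by simp [hu'], ?_⟩, fun η hη hηu => ?_, fun w' hw' => ?_,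
    fun u'' h1 h2 => ?_⟩
  · have := ιMulti_smul_add u w 1 0 b
    simpa using this.symm
  · simp [hlu]
  · simp [hb, hc, hlw]
  · have h2 : ![u, b • w] = Function.update ![u, w] 1 (b • w) := by
      ext i; fin_cases i <;> rfl
    have h3 : Function.update ![u, w] 1 w = ![u, w] := by
      ext i; fin_cases i <;> rfl
    rw [h2, AlternatingMap.map_update_smul, h3, hiso η hη, smul_zero]
  · simp [hc, hlu']
  · obtain ⟨d, hd⟩ := hform η hη hηu
    exact ⟨d / a, by rw [smul_smul, div_mul_cancel₀ _ ha, hd]⟩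
  · obtain ⟨d, e, hde⟩ := hpl w' hw'
    exact ⟨d, e / b, by rw [smul_smul, div_mul_cancel₀ _ hb, hde]⟩
  · refine hker u'' (fun x => ?_) ?_
    · have := h1 x
      rw [AlternatingMap.smul_apply] at this
      exact (smul_eq_zero.mp this).resolve_left ha
    · rw [LinearMap.smul_apply] at h2
      exact (smul_eq_zero.mp h2).resolve_left hc

/-- The correspondence is equivariant under linear automorphisms preserving `A`. -/
theorem Corresponds.map (h : Corresponds A ω ξ l) {H : Type*} [Group H] (ρ : Representation k H V)
    (hA : ∀ g, ∀ η ∈ A, formRep ρ g η ∈ A) (g : H) :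
    Corresponds A (formRep ρ g ω) (bivectorRep ρ g ξ) (l ∘ₗ ρ g⁻¹) := by
  have hf : ∀ (g : H) (η : V [⋀^Fin 2]→ₗ[k] k) (x y : V),
      formRep ρ g η ![x, y] = η ![ρ g⁻¹ x, ρ g⁻¹ y] := by
    intro g η x y
    show η (fun i => ρ g⁻¹ (![x, y] i)) = _
    congr 1
    ext i
    fin_cases i <;> rfl
  have h1 : ∀ x, ρ g⁻¹ (ρ g x) = x := fun x => by simp
  have h2 : ∀ x, ρ g (ρ g⁻¹ x) = x := fun x => by simp
  have hinv : ∀ η : V [⋀^Fin 2]→ₗ[k] k, formRep ρ g (formRep ρ g⁻¹ η) = η := fun η => by simp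
  obtain ⟨hωA, h0, u, w, rfl, hu, hωu, hlu, hlw, hiso, ⟨u', hu', hlu'⟩, hform, hpl, hker⟩ := h
  refine ⟨hA g ω hωA, fun h => h0 (rep_injective (formRep ρ) g (h.trans (map_zero _).symm)),
    ρ g u, ρ g w, ?_, fun h => hu (rep_injective ρ g (h.trans (map_zero _).symm)),
    fun x => by rw [hf, h1, hωu], by simpa using hlu, by simpa using hlw, fun η hη => ?_,
    ⟨ρ g u', fun x => by rw [hf, h1, hu'], by simpa using hlu'⟩, fun η hη hηu => ?_,
    fun w' hw' => ?_, fun u'' h3 h4 => ?_⟩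
  · show exteriorPower.map 2 (ρ g) _ = _
    rw [exteriorPower.map_apply_ιMulti]
    congr 1
    ext i
    fin_cases i <;> rfl
  · have := hiso _ (hA g⁻¹ η hη)
    rwa [hf, inv_inv] at this
  · obtain ⟨c, hc⟩ := hform (formRep ρ g⁻¹ η) (hA g⁻¹ η hη) fun x => by
      rw [hf, inv_inv]
      exact hηu _
    exact ⟨c, by rw [← map_smul, ← hc, hinv]⟩
  · obtain ⟨c, d, hcd⟩ := hpl (ρ g⁻¹ w') fun η hη => by
      have := hw' _ (hA g η hη)
      rwa [hf, h1] at this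
    exact ⟨c, d, by rw [← map_smul, ← map_smul, ← map_add, ← hcd, h2]⟩
  · obtain ⟨c, hc⟩ := hker (ρ g⁻¹ u'') (fun x => by
      have := h3 (ρ g x)
      rwa [hf, h1] at this) (by simpa using h4)
    exact ⟨c, by rw [← map_smul, ← hc, h2]⟩

end Correspondence

/-! ### Polynomiality and degrees of the explicit formulas -/

section Polynomials

variable {k : Type*} [Field k] {D : Type*} [AddCommGroup D] [Module k D]

theorem isPolynomialFun_kAdj {y : D → Fin 5 → k} {l : D → Fin 6 → k}
    (hy : ∀ i, IsPolynomialFun k fun x => y x i) (hl : ∀ i, IsPolynomialFun k fun x => l x i) :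
    ∀ i, IsPolynomialFun k fun x => kAdj (y x) (l x) i := by
  have P : ∀ i j r, IsPolynomialFun k fun x => y x i * y x j * l x r := fun i j r =>
    ((hy i).mul (hy j)).mul (hl r)
  have Q : ∀ i j m r, IsPolynomialFun k fun x => (y x i ^ 2 + y x j * y x m) * l x r :=
    fun i j m r => (((hy i).pow 2).add ((hy j).mul (hy m))).mul (hl r)
  rw [forall_fin_six]
  exact ⟨(((((P 0 2 1).add (P 1 3 2)).add (P 2 4 3)).add (P 3 0 4)).add (P 4 1 5)),
    (((((P 0 2 0).neg.add (Q 2 1 4 2)).sub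
      (Q 1 0 3 5)).sub (P 1 2 3)).add (P 4 0 4)),
    (((((P 1 3 0).neg.add (Q 3 2 0 3)).sub
      (Q 2 1 4 1)).sub (P 2 3 4)).add (P 0 1 5)),
    (((((P 2 4 0).neg.add (Q 4 3 1 4)).sub
      (Q 3 2 0 2)).sub (P 3 4 5)).add (P 1 2 1)),
    (((((P 3 0 0).neg.add (Q 0 4 2 5)).sub
      (Q 4 3 1 3)).sub (P 4 0 1)).add (P 2 3 2)),
    (((((P 4 1 0).neg.add (Q 1 0 3 1)).sub
      (Q 0 4 2 4)).sub (P 0 1 2)).add (P 3 4 3))⟩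

theorem isPolynomialFun_kRow (y : Fin 5 → k) {u : D → Fin 6 → k}
    (hu : ∀ i, IsPolynomialFun k fun x => u x i) :
    ∀ i, IsPolynomialFun k fun x => kRow y (u x) i := by
  rw [forall_fin_six]
  simp only [kRow, Matrix.cons_val]
  refine ⟨?_, ?_, ?_, ?_, ?_, ?_⟩ <;>
  repeat' first
    | exact hu _
    | exact IsPolynomialFun.const _
    | apply IsPolynomialFun.add
    | apply IsPolynomialFun.sub
    | apply IsPolynomialFun.neg
    | apply IsPolynomialFun.mul

theorem isPolynomialFun_kMatrix (i : Fin 6) {u : D → Fin 6 → k}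
    (hu : ∀ i, IsPolynomialFun k fun x => u x i) (r j : Fin 6) :
    IsPolynomialFun k fun x => kMatrix i (u x) r j := by
  induction r using Fin.cases with
  | zero =>
    by_cases h : j = i
    · subst h
      simpa [kMatrix] using hu j
    · simpa [kMatrix, h] using IsPolynomialFun.const (E := D) (0 : k)
  | succ r => exact isPolynomialFun_kRow _ hu j

theorem isPolynomialFun_det {n : Type*} [Fintype n] [DecidableEq n] {M : D → Matrix n n k}
    (hM : ∀ i j, IsPolynomialFun k fun x => M x i j) : IsPolynomialFun k fun x => (M x).det := by
  simp only [Matrix.det_apply']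
  exact .sum _ fun σ _ => (IsPolynomialFun.const _).mul (.prod _ fun i _ => hM _ _)

theorem isPolynomialFun_adjugate {n : Type*} [Fintype n] [DecidableEq n] {M : D → Matrix n n k}
    (hM : ∀ i j, IsPolynomialFun k fun x => M x i j) (i j : n) :
    IsPolynomialFun k fun x => (M x).adjugate i j := by
  simp only [Matrix.adjugate_apply]
  refine isPolynomialFun_det fun r c => ?_
  by_cases h : r = j
  · subst h
    simpa [Matrix.updateRow_self] using IsPolynomialFun.const (E := D) ((Pi.single i 1 : n → k) c)
  · simpa [Matrix.updateRow_ne h] using hM r c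

theorem isPolynomialFun_dotProduct {n : Type*} [Fintype n] {u w : D → n → k}
    (hu : ∀ i, IsPolynomialFun k fun x => u x i) (hw : ∀ i, IsPolynomialFun k fun x => w x i) :
    IsPolynomialFun k fun x => u x ⬝ᵥ w x :=
  .sum _ fun i _ => (hu i).mul (hw i)

theorem kAdj_smul (c : k) (y : Fin 5 → k) (l : Fin 6 → k) : kAdj y (c • l) = c • kAdj y l := by
  funext i
  revert i
  rw [forall_fin_six]
  simp [kAdj]
  refine ⟨?_, ?_, ?_, ?_, ?_, ?_⟩ <;> ring

theorem kAdj_smul_left (c : k) (y : Fin 5 → k) (l : Fin 6 → k) :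
    kAdj (c • y) l = c ^ 2 • kAdj y l := by
  funext i
  revert i
  rw [forall_fin_six]
  simp [kAdj]
  refine ⟨?_, ?_, ?_, ?_, ?_, ?_⟩ <;> ring

theorem kMatrix_smul (i : Fin 6) (c : k) (u : Fin 6 → k) :
    kMatrix i (c • u) = c • kMatrix i u := by
  ext r j
  rw [Matrix.smul_apply]
  induction r using Fin.cases with
  | zero =>
    by_cases h : j = i
    · subst h
      simp [kMatrix]
    · simp [kMatrix, h]
  | succ r =>
    simp [kMatrix, kRow_smul]

theorem adjugate_kMatrix_smul (i : Fin 6) (c : k) (u : Fin 6 → k) :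
    (kMatrix i (c • u)).adjugate = c ^ 5 • (kMatrix i u).adjugate := by
  rw [kMatrix_smul, Matrix.adjugate_smul]
  simp

end Polynomials

/-! ### The correspondence and the Pfaffian cubic in adapted coordinates -/

section Coordinates

variable {k : Type*} [Field k] {V : Type*} [AddCommGroup V] [Module k V]

/-- `e` identifies `k⁵` with the space of skew forms `ω_y` in the coordinates on `V` given by the
basis `b`. -/
def IsKleinFrame (b : Module.Basis (Fin 6) k V)
    (e : (Fin 5 → k) →ₗ[k] (V [⋀^Fin 2]→ₗ[k] k)) : Prop :=
  ∀ y u w, e y ![u, w] = kForm y (b.equivFun u) (b.equivFun w)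

variable {b : Module.Basis (Fin 6) k V} {e : (Fin 5 → k) →ₗ[k] (V [⋀^Fin 2]→ₗ[k] k)}

theorem IsKleinFrame.ker_iff (he : IsKleinFrame b e) {y : Fin 5 → k} {u : V} :
    (∀ x, e y ![u, x] = 0) ↔ kRow y (b.equivFun u) = 0 := by
  constructor
  · intro h
    refine kRow_eq_zero_of_kForm fun w => ?_
    have := h (b.equivFun.symm w)
    rwa [he, b.equivFun.apply_symm_apply] at this
  · intro h x
    rw [he, kForm_of_kRow h]

variable (b) in
/-- The coefficients `y` of a form `ω_y`. -/
noncomputable def formCoords (ω : V [⋀^Fin 2]→ₗ[k] k) : Fin 5 → k := fun j => ω ![b 0, b j.succ]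

theorem IsKleinFrame.formCoords_apply (he : IsKleinFrame b e) (y : Fin 5 → k) :
    formCoords b (e y) = y := by
  funext j
  rw [formCoords, he]
  have h : ∀ i, b.equivFun (b i) = Pi.single i 1 := fun i => by
    ext r; simp [Pi.single_apply, eq_comm]
  rw [h, h, kForm_eq]
  fin_cases j <;> simp

theorem IsKleinFrame.injective (he : IsKleinFrame b e) : Function.Injective e :=
  Function.LeftInverse.injective he.formCoords_apply

theorem dual_eq_dotProduct (b : Module.Basis (Fin 6) k V) (l : Module.Dual k V) (u : V) :
    l u = (fun i => l (b i)) ⬝ᵥ b.equivFun u := by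
  conv_lhs => rw [← b.sum_equivFun u]
  rw [map_sum]
  exact Finset.sum_congr rfl fun i _ => by rw [map_smul, smul_eq_mul, mul_comm]

theorem IsKleinFrame.isIsotropic_iff (he : IsKleinFrame b e) {u w : V} :
    (∀ η ∈ LinearMap.range e, η ![u, w] = 0) ↔ IsIsotropic (b.equivFun u) (b.equivFun w) := by
  constructor
  · intro h y
    rw [← he]
    exact h _ ⟨y, rfl⟩
  · rintro h _ ⟨y, rfl⟩
    rw [he, h]

theorem IsKleinFrame.corresponds_iff (he : IsKleinFrame b e) {y : Fin 5 → k} (hy : y ≠ 0)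
    {ξ : ⋀[k]^2 V} {l : Module.Dual k V} :
    Corresponds (LinearMap.range e) (e y) ξ l ↔ ∃ u w : V, ξ = exteriorPower.ιMulti k 2 ![u, w] ∧
      IsFlag y (fun i => l (b i)) (b.equivFun u) (b.equivFun w) := by
  constructor
  · rintro ⟨-, -, u, w, rfl, hu, hωu, hlu, hlw, hiso, ⟨u', hu', hlu'⟩, hform, hpl, hker⟩
    refine ⟨u, w, rfl, ⟨fun h => hu (by simpa using h), he.ker_iff.mp hωu, ?_, ?_,
      he.isIsotropic_iff.mp hiso, ⟨b.equivFun u', he.ker_iff.mp hu', ?_⟩, fun y' hy' => ?_,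
      fun w' hw' => ?_, fun u'' h1 h2 => ?_⟩⟩
    · rwa [← dual_eq_dotProduct]
    · rwa [← dual_eq_dotProduct]
    · rwa [← dual_eq_dotProduct]
    · obtain ⟨c, hc⟩ := hform (e y') ⟨y', rfl⟩ (he.ker_iff.mpr hy')
      exact ⟨c, he.injective (by rw [hc, map_smul])⟩
    · obtain ⟨c, d, hcd⟩ := hpl (b.equivFun.symm w') (he.isIsotropic_iff.mpr (by
        rwa [b.equivFun.apply_symm_apply]))
      refine ⟨c, d, ?_⟩
      rw [← map_smul, ← map_smul, ← map_add, ← hcd, b.equivFun.apply_symm_apply]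
    · obtain ⟨c, hc⟩ := hker (b.equivFun.symm u'') (he.ker_iff.mpr (by
        rwa [b.equivFun.apply_symm_apply])) (by
          rwa [dual_eq_dotProduct b, b.equivFun.apply_symm_apply])
      refine ⟨c, ?_⟩
      rw [← map_smul, ← hc, b.equivFun.apply_symm_apply]
  · rintro ⟨u, w, rfl, h⟩
    obtain ⟨u', hu', hlu'⟩ := h.off_ker
    refine ⟨⟨y, rfl⟩, fun h => hy (he.injective (by rw [h, map_zero])), u, w, rfl,
      fun h0 => h.ne_zero (by rw [h0, map_zero]), he.ker_iff.mpr h.ker, ?_, ?_,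
      he.isIsotropic_iff.mpr h.isotropic, ⟨b.equivFun.symm u', he.ker_iff.mpr (by
        rwa [b.equivFun.apply_symm_apply]), ?_⟩, ?_, fun w' hw' => ?_, fun u'' h1 h2 => ?_⟩
    · rw [dual_eq_dotProduct b]; exact h.on
    · rw [dual_eq_dotProduct b]; exact h.off
    · rwa [dual_eq_dotProduct b, b.equivFun.apply_symm_apply]
    · rintro _ ⟨y', rfl⟩ hy'
      obtain ⟨c, hc⟩ := h.unique_form y' (he.ker_iff.mp hy')
      exact ⟨c, by rw [hc, map_smul]⟩
    · obtain ⟨c, d, hcd⟩ := h.unique_plane _ (he.isIsotropic_iff.mp hw')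
      exact ⟨c, d, b.equivFun.injective (by rw [hcd, map_add, map_smul, map_smul])⟩
    · obtain ⟨c, hc⟩ := h.unique_ker _ (he.ker_iff.mp h1) (by rwa [← dual_eq_dotProduct])
      exact ⟨c, b.equivFun.injective (by rw [hc, map_smul])⟩

theorem curryLeft_eq_zero_iff {ω : V [⋀^Fin 2]→ₗ[k] k} {u : V} :
    ω.curryLeft u = 0 ↔ ∀ x, ω ![u, x] = 0 := by
  constructor
  · intro h x
    have := congrArg (fun η : V [⋀^Fin 1]→ₗ[k] k => η ![x]) h
    exact this
  · intro h
    ext x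
    have := h (x 0)
    show ω (Matrix.vecCons u x) = 0
    convert this using 2
    ext i
    fin_cases i <;> rfl

/-- The Pfaffian detects forms of rank at most four. -/
theorem IsKleinFrame.formRank_le_iff (he : IsKleinFrame b e) {y : Fin 5 → k} (hy : y ≠ 0) :
    formRank (e y) ≤ 4 ↔ kPf y = 0 := by
  have := Module.Finite.of_basis b
  have hfin : Module.finrank k V = 6 := by rw [Module.finrank_eq_card_basis b]; rfl
  have hrn := LinearMap.finrank_range_add_finrank_ker (e y).curryLeft
  rw [hfin] at hrn
  rw [formRank]
  constructor
  · intro h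
    have hker : LinearMap.ker (e y).curryLeft ≠ ⊥ := by
      intro h0
      rw [h0, finrank_bot] at hrn
      omega
    obtain ⟨u, hu, hu0⟩ := Submodule.exists_mem_ne_zero_of_ne_bot hker
    exact kPf_eq_zero (he.ker_iff.mp (curryLeft_eq_zero_iff.mp (LinearMap.mem_ker.mp hu)))
      (fun h => hu0 (by simpa using h))
  · intro h
    -- One kernel vector would only bound the rank by five; the adjoint supplies two independent
    -- ones.
    obtain ⟨a, c, hac, hker⟩ := exists_ker_pair hy h
    have hmem : ∀ s t : k, b.equivFun.symm (s • a + t • c) ∈ LinearMap.ker (e y).curryLeft :=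
      fun s t => LinearMap.mem_ker.mpr (curryLeft_eq_zero_iff.mpr (he.ker_iff.mpr (by
        rw [b.equivFun.apply_symm_apply, hker])))
    have ha : b.equivFun.symm a ∈ LinearMap.ker (e y).curryLeft := by simpa using hmem 1 0
    have hc : b.equivFun.symm c ∈ LinearMap.ker (e y).curryLeft := by simpa using hmem 0 1
    have hli : LinearIndependent k ![(⟨_, ha⟩ : LinearMap.ker (e y).curryLeft), ⟨_, hc⟩] := by
      rw [LinearIndependent.pair_iff]
      intro s t hst
      refine hac s t ?_
      have := congrArg b.equivFun (congrArg Subtype.val hst)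
      simpa only [Submodule.coe_add, Submodule.coe_smul, map_add, map_smul,
        LinearEquiv.apply_symm_apply, Submodule.coe_zero, map_zero] using this
    have := hli.fintype_card_le_finrank
    rw [Fintype.card_fin] at this
    omega

theorem IsKleinFrame.exists_coords (he : IsKleinFrame b e) {ω : V [⋀^Fin 2]→ₗ[k] k}
    (h : ω ∈ LinearMap.range e) (h0 : ω ≠ 0) : e (formCoords b ω) = ω ∧ formCoords b ω ≠ 0 := by
  obtain ⟨y, rfl⟩ := h
  rw [he.formCoords_apply]
  exact ⟨rfl, fun h => h0 (by rw [h, map_zero])⟩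

/-- In suitable coordinates the Pfaffian hypersurface in `ℙ(A)` is the Klein cubic. -/
theorem IsKleinFrame.image_kleinCubic (he : IsKleinFrame b e) :
    ∃ (e' : (Fin 5 → k) →ₗ[k] (V [⋀^Fin 2]→ₗ[k] k)) (he' : Function.Injective e'),
      LinearMap.range e' = LinearMap.range e ∧
      Projectivization.map e' he' '' kleinCubic k = pfaffianCubic (LinearMap.range e) := by
  -- The Pfaffian is the sum of the `y i ^ 2 * y (i + 2)`. Since `3 * 2 = 1` modulo five, the
  -- substitution `i ↦ 3 * i`, with inverse `i ↦ 2 * i`, turns it into the Klein cubic.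
  let σ : (Fin 5 → k) ≃ₗ[k] (Fin 5 → k) := LinearEquiv.funCongrLeft k k
    ⟨fun i => 3 * i, fun i => 2 * i, by decide, by decide⟩
  have hσ : ∀ Y : Fin 5 → k, kPf (σ Y) = Y 0 ^ 2 * Y 1 + Y 1 ^ 2 * Y 2 + Y 2 ^ 2 * Y 3 +
      Y 3 ^ 2 * Y 4 + Y 4 ^ 2 * Y 0 := by
    intro Y
    have h : ∀ i, σ Y i = Y (3 * i) := fun i => rfl
    simp only [kPf, h]
    have h1 : (3 * 1 : Fin 5) = 3 := rfl
    have h2 : (3 * 2 : Fin 5) = 1 := rfl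
    have h3 : (3 * 3 : Fin 5) = 4 := rfl
    have h4 : (3 * 4 : Fin 5) = 2 := rfl
    rw [mul_zero, h1, h2, h3, h4]
    ring
  have hinj : Function.Injective (e ∘ₗ σ.toLinearMap) := he.injective.comp σ.injective
  refine ⟨e ∘ₗ σ.toLinearMap, hinj, ?_, ?_⟩
  · rw [LinearMap.range_comp, LinearEquiv.range, Submodule.map_top]
  · ext p
    constructor
    · rintro ⟨q, hq, rfl⟩
      obtain ⟨c, hc⟩ := Projectivization.exists_smul_eq_mk_rep k (e (σ q.rep))
        (fun h => q.rep_nonzero (hinj (h.trans (map_zero _).symm)))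
      have hq' : Projectivization.map (e ∘ₗ σ.toLinearMap) hinj q = Projectivization.mk k
          (e (σ q.rep)) (fun h => q.rep_nonzero (hinj (h.trans (map_zero _).symm))) := by
        conv_lhs => rw [← q.mk_rep]
        rfl
      have hc' : (c : k) • e (σ q.rep) = _ := hc
      rw [← hq'] at hc'
      have hy : (c : k) • σ q.rep ≠ 0 := smul_ne_zero c.ne_zero fun h =>
        q.rep_nonzero (σ.injective (h.trans (map_zero _).symm))
      rw [pfaffianCubic, Set.mem_ofPred_eq, ← hc', ← map_smul]
      refine ⟨⟨_, rfl⟩, (he.formRank_le_iff hy).mpr ?_⟩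
      have h1 : kPf ((c : k) • σ q.rep) = (c : k) ^ 3 * kPf (σ q.rep) := by
        simp [kPf]; ring
      rw [h1, hσ]
      have hq2 : _ = (0 : k) := hq
      rw [hq2, mul_zero]
    · rintro ⟨hA, hr⟩
      obtain ⟨h1, h2⟩ := he.exists_coords hA p.rep_nonzero
      rw [← h1, he.formRank_le_iff h2] at hr
      set Y := σ.symm (formCoords b p.rep) with hY
      have hY0 : Y ≠ 0 := fun h => h2 (by simpa [hY] using h)
      have hσY : σ Y = formCoords b p.rep := by rw [hY, σ.apply_symm_apply]
      refine ⟨Projectivization.mk k Y hY0, ?_, ?_⟩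
      · obtain ⟨c, hc⟩ := Projectivization.exists_smul_eq_mk_rep k Y hY0
        have hc' : (c : k) • Y = _ := hc
        rw [kleinCubic, Set.mem_ofPred_eq, ← hc']
        rw [← hσY, hσ] at hr
        simp only [Pi.smul_apply, smul_eq_mul]
        linear_combination (c : k) ^ 3 * hr
      · rw [Projectivization.map_mk]
        conv_rhs => rw [← p.mk_rep]
        congr 1
        rw [LinearMap.comp_apply]
        exact (congrArg e hσY).trans h1

end Coordinates

/-! ### From charts to locally polynomial correspondences -/

section Charts

variable {k : Type*} [Field k]
variable {U Z V U' : Type*} [AddCommGroup U] [Module k U] [AddCommGroup Z] [Module k Z]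
  [AddCommGroup V] [Module k V] [AddCommGroup U'] [Module k U']

/-- A relation between points of `ℙ(U)` and `ℙ(U')` parametrized by points of `ℙ(V)`, given by
charts, defines a locally polynomial correspondence. -/
theorem isLocallyPolynomial_of_charts [Infinite k] {ι : Type*} {C : U → U' → V → Prop}
    {S : Set (ℙ k U)} {c : ι → U → V → k} {F : ι → U → V → U'}
    (hc : ∀ i, IsMultihomogeneous k fun x : U × Z × V => c i x.1 x.2.2)
    (hF : ∀ i, IsMultihomogeneous k fun x : U × Z × V => F i x.1 x.2.2)
    (mem : ∀ (p : ℙ k U) ξ v, C p.rep ξ v → p ∈ S)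
    (unique : ∀ ω ξ ξ' v, C ω ξ v → C ω ξ' v → ∃ a : k, ξ' = a • ξ)
    (ne_zero : ∀ ω ξ v, C ω ξ v → ξ ≠ 0)
    (smul : ∀ ω ξ v (a : k), a ≠ 0 → C ω ξ v → C ω (a • ξ) v)
    (chart : ∀ p ∈ S, ∀ i v, c i p.rep v ≠ 0 → C p.rep (F i p.rep v) v)
    (cover : ∀ (p : ℙ k U) ξ v, C p.rep ξ v → ∃ i, c i p.rep v ≠ 0)
    (dense : ∀ p ∈ S, ∃ i v, c i p.rep v ≠ 0) (zero : ∀ i ω, c i ω 0 = 0) :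
    IsLocallyPolynomial (fun (x : ℙ k U × ℙ k Z × ℙ k V) (x' : ℙ k U' × ℙ k Z × ℙ k V) =>
      C x.1.rep x'.1.rep x.2.2.rep ∧ x'.2 = x.2) (S ×ˢ Set.univ) := by
  have hchart : ∀ i (y : ℙ k U × ℙ k Z × ℙ k V), y.1 ∈ S → c i y.1.rep y.2.2.rep ≠ 0 →
      ∃ h : F i y.1.rep y.2.2.rep ≠ 0,
        C y.1.rep (Projectivization.mk k _ h).rep y.2.2.rep := by
    intro i y hy hcy
    have h := chart _ hy i _ hcy
    obtain ⟨a, ha⟩ := Projectivization.exists_smul_eq_mk_rep k _ (ne_zero _ _ _ h)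
    refine ⟨ne_zero _ _ _ h, ?_⟩
    rw [← ha]
    exact smul _ _ _ _ a.ne_zero h
  refine ⟨fun x x' h => ⟨mem _ _ _ h.1, trivial⟩, ?_, ?_, ?_⟩
  · rintro x x' x'' ⟨h1, h2⟩ ⟨h3, h4⟩
    refine Prod.ext ?_ (h2.trans h4.symm)
    obtain ⟨a, ha⟩ := unique _ _ _ _ h1 h3
    rw [← x'.1.mk_rep, ← x''.1.mk_rep, Projectivization.mk_eq_mk_iff']
    obtain ⟨a, ha⟩ := unique _ _ _ _ h3 h1
    exact ⟨a, ha.symm⟩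
  · rintro x x' ⟨h1, h2⟩
    obtain ⟨i, hi⟩ := cover _ _ _ h1
    refine ⟨_, hc i, hi, _, fun x => x.2.1, fun x => x.2.2, hF i,
      ⟨fun l => .linear (l ∘ₗ LinearMap.fst k Z V ∘ₗ LinearMap.snd k U (Z × V)), 0, 1, 0,
        by intros; simp only [pow_zero, one_mul, mul_one, pow_one]⟩,
      ⟨fun l => .linear (l ∘ₗ LinearMap.snd k Z V ∘ₗ LinearMap.snd k U (Z × V)), 0, 0, 1,
        by intros; simp only [pow_zero, one_mul, pow_one]⟩, ?_⟩
    rintro y ⟨hy, -⟩ hcy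
    obtain ⟨h, hC⟩ := hchart i y hy hcy
    refine ⟨h, y.2.1.rep_nonzero, y.2.2.rep_nonzero, hC, ?_⟩
    exact Prod.ext (Projectivization.mk_rep _) (Projectivization.mk_rep _)
  · rintro ⟨p, q, s⟩ ⟨hp, -⟩ f hf hfx
    -- The points of the first two factors are kept and only `v` moves. Two polynomials in `v`,
    -- neither identically zero, have a common point of nonvanishing, so density is proved fibre by
    -- fibre.
    obtain ⟨i, v, hv⟩ := dense p hp
    have hP : ∀ {g : U × Z × V → k}, IsMultihomogeneous k g →
        IsPolynomialFun k fun v => g (p.rep, q.rep, v) := by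
      intro g hg
      refine hg.isPolynomialFun.comp (F := fun v => (p.rep, q.rep, v)) fun l => ?_
      have : ∀ v, l (p.rep, q.rep, v) = l (p.rep, q.rep, 0) +
          (l ∘ₗ LinearMap.inr k U (Z × V) ∘ₗ LinearMap.inr k Z V) v := by
        intro v
        simp only [LinearMap.comp_apply, LinearMap.inr_apply]
        rw [← map_add, Prod.mk_add_mk, Prod.mk_add_mk, add_zero, add_zero, zero_add]
      exact (congrArg (IsPolynomialFun k) (funext this)).mpr <| (IsPolynomialFun.const _).add (.linear _)
    obtain ⟨w, hw1, hw2⟩ := IsPolynomialFun.exists_mul_ne_zero (hP hf) (hP (hc i))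
      (a := s.rep) (b := v) hfx hv
    have hw : w ≠ 0 := by
      rintro rfl
      exact hw2 (zero i _)
    obtain ⟨h, hC⟩ := hchart i (p, q, .mk k w hw) hp ((hc i).coords_ne_zero hw hw2)
    exact ⟨(p, q, .mk k w hw), (.mk k _ h, q, .mk k w hw), ⟨hC, rfl⟩, hf.coords_ne_zero hw hw1⟩

end Charts

section Forms

variable {k : Type*} [Field k] {V : Type*} [AddCommGroup V] [Module k V]

theorem alternating_eq_sum (b : Module.Basis (Fin 6) k V) {E : Type*} [AddCommGroup E] [Module k E]
    (ψ : V [⋀^Fin 2]→ₗ[k] E) (u w : Fin 6 → k) :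
    ψ ![b.equivFun.symm u, b.equivFun.symm w] = ∑ i, ∑ j, (u i * w j) • ψ ![b i, b j] := by
  let B : V →ₗ[k] V →ₗ[k] E := LinearMap.mk₂ k (fun x y => ψ ![x, y])
    (fun x x' y => congrArg (fun η => η ![y]) (ψ.curryLeft.map_add x x'))
    (fun c x y => congrArg (fun η => η ![y]) (ψ.curryLeft.map_smul c x))
    (fun x y y' => by
      have h : ∀ z, ![x, z] = Function.update ![x, 0] 1 z := fun z => by
        ext i; fin_cases i <;> rfl
      rw [h, h y, h y', AlternatingMap.map_update_add])
    (fun c x y => by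
      have h : ∀ z, ![x, z] = Function.update ![x, 0] 1 z := fun z => by
        ext i; fin_cases i <;> rfl
      rw [h, h y, AlternatingMap.map_update_smul])
  change B _ _ = ∑ i, ∑ j, (u i * w j) • B (b i) (b j)
  rw [b.equivFun_symm_apply, b.equivFun_symm_apply, map_sum B, LinearMap.sum_apply]
  simp only [map_sum, map_smul, LinearMap.smul_apply, smul_smul, mul_comm]

end Forms

/-! ### The map from forms to bivectors -/

section Charts

variable {k : Type*} [Field k] {V Z : Type*} [AddCommGroup V] [Module k V] [AddCommGroup Z]
  [Module k Z] (b : Module.Basis (Fin 6) k V)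

/-- The kernel vector of a form on the hyperplane `l = 0`. -/
noncomputable def formKer (ω : V [⋀^Fin 2]→ₗ[k] k) (l : Module.Dual k V) : Fin 6 → k :=
  kAdj (formCoords b ω) fun i => l (b i)

/-- A vector isotropic to `u` for all forms `ω_y`. -/
noncomputable def isotropicPartner (i r : Fin 6) (u : Fin 6 → k) : Fin 6 → k :=
  fun j => (kMatrix i u).adjugate j r

/-- A form `ω_y` killing `u`. -/
noncomputable def formKilling (i j : Fin 6) (u : Fin 6 → k) : Fin 5 → k :=
  fun r => (kMatrix i u).adjugate j r.succ

/-- The vector of the plane `ξ` on the hyperplane `l = 0`. -/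
noncomputable def bivectorKer (ξ : ⋀[k]^2 V) (l : Module.Dual k V) : Fin 6 → k :=
  fun j => contract l (b.coord j) ξ

variable {b} {e : (Fin 5 → k) →ₗ[k] (V [⋀^Fin 2]→ₗ[k] k)}

/-- `ℓ` is an equivariant family of linear forms as in `exists_equivariant_covector`. -/
structure IsCovectorField (ℓ : V → Module.Dual k V) (d : ℕ) : Prop where
  polynomial : ∀ w, IsPolynomialFun k fun v => ℓ v w
  smul : ∀ (r : k) v, ℓ (r • v) = r ^ (d + 1) • ℓ v
  dominant : ∀ h : Module.Dual k V → k, IsPolynomialFun k h → ∀ q, h q ≠ 0 → ∃ v, h (ℓ v) ≠ 0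

theorem IsCovectorField.map_zero {ℓ : V → Module.Dual k V} {d : ℕ} (h : IsCovectorField ℓ d) :
    ℓ 0 = 0 := by
  have := h.smul 0 0
  rwa [zero_smul, zero_pow (Nat.succ_ne_zero d), zero_smul] at this

theorem isPolynomialFun_fst {f : V → k} (hf : IsPolynomialFun k f) {U W : Type*}
    [AddCommGroup U] [Module k U] [AddCommGroup W] [Module k W] :
    IsPolynomialFun k fun x : V × U × W => f x.1 :=
  hf.comp (F := fun x : V × U × W => x.1) fun l => .linear (l ∘ₗ LinearMap.fst k V (U × W))

theorem isPolynomialFun_thd {f : V → k} (hf : IsPolynomialFun k f) {U W : Type*}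
    [AddCommGroup U] [Module k U] [AddCommGroup W] [Module k W] :
    IsPolynomialFun k fun x : U × W × V => f x.2.2 :=
  hf.comp (F := fun x : U × W × V => x.2.2) fun l =>
    .linear (l ∘ₗ LinearMap.snd k W V ∘ₗ LinearMap.snd k U (W × V))

theorem isPolynomialFun_eval (x : V) : IsPolynomialFun k fun m : Module.Dual k V => m x :=
  .linear (Module.Dual.eval k V x)

theorem exists_dual (b : Module.Basis (Fin 6) k V) (l : Fin 6 → k) :
    ∃ m : Module.Dual k V, (fun i => m (b i)) = l :=
  ⟨b.constr k l, funext fun i => b.constr_basis k l i⟩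

theorem isPolynomialFun_formCoords (i : Fin 5) : IsPolynomialFun k fun ω => formCoords b ω i :=
  .linear
    { toFun := fun ω : V [⋀^Fin 2]→ₗ[k] k => formCoords b ω i
      map_add' := fun _ _ => rfl
      map_smul' := fun _ _ => rfl }

variable (b) in
/-- The chart of the correspondence around a form. -/
noncomputable def formChart (ℓ : V → Module.Dual k V) (i : Fin 6 × Fin 6)
    (ω : V [⋀^Fin 2]→ₗ[k] k) (v : V) : k :=
  formKer b ω (ℓ v) i.1 *
    ((fun j => ℓ v (b j)) ⬝ᵥ isotropicPartner i.1 i.2 (formKer b ω (ℓ v)))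

variable (b) in
/-- The bivector corresponding to a form. -/
noncomputable def formToBivector (ℓ : V → Module.Dual k V) (i : Fin 6 × Fin 6)
    (ω : V [⋀^Fin 2]→ₗ[k] k) (v : V) : ⋀[k]^2 V :=
  exteriorPower.ιMulti k 2 ![b.equivFun.symm (formKer b ω (ℓ v)),
    b.equivFun.symm (isotropicPartner i.1 i.2 (formKer b ω (ℓ v)))]

theorem formKer_smul (ω : V [⋀^Fin 2]→ₗ[k] k) (l : Module.Dual k V) (a c : k) :
    formKer b (a • ω) (c • l) = (a ^ 2 * c) • formKer b ω l := by
  have h1 : formCoords b (a • ω) = a • formCoords b ω := rfl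
  have h2 : (fun i => (c • l) (b i)) = c • fun i => l (b i) := rfl
  rw [formKer, h1, h2, kAdj_smul, kAdj_smul_left, smul_smul, mul_comm]
  rfl

theorem isotropicPartner_smul (i r : Fin 6) (c : k) (u : Fin 6 → k) :
    isotropicPartner i r (c • u) = c ^ 5 • isotropicPartner i r u := by
  funext j
  rw [isotropicPartner, adjugate_kMatrix_smul]
  rfl

theorem formKilling_smul (i r : Fin 6) (c : k) (u : Fin 6 → k) :
    formKilling i r (c • u) = c ^ 5 • formKilling i r u := by
  funext j
  rw [formKilling, adjugate_kMatrix_smul]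
  rfl

theorem isPolynomialFun_formKer {ℓ : V → Module.Dual k V} {d : ℕ} (hℓ : IsCovectorField ℓ d)
    (i : Fin 6) :
    IsPolynomialFun k fun x : (V [⋀^Fin 2]→ₗ[k] k) × Z × V => formKer b x.1 (ℓ x.2.2) i :=
  isPolynomialFun_kAdj (fun i => isPolynomialFun_fst (isPolynomialFun_formCoords i))
    (fun i => isPolynomialFun_thd (hℓ.polynomial (b i))) i

theorem isMultihomogeneous_formChart {ℓ : V → Module.Dual k V} {d : ℕ} (hℓ : IsCovectorField ℓ d)
    (i : Fin 6 × Fin 6) : IsMultihomogeneous k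
      fun x : (V [⋀^Fin 2]→ₗ[k] k) × Z × V => formChart b ℓ i x.1 x.2.2 := by
  -- The kernel vector has degree `2` in the form and `1` in the covector, and its partner five
  -- times as much; the pairing contributes one more covector.
  refine isMultihomogeneous_scalar (a := 12) (b := 0) (c := 7 * (d + 1)) ?_ ?_
  · refine (isPolynomialFun_formKer hℓ i.1).mul (isPolynomialFun_dotProduct
      (fun j => isPolynomialFun_thd (hℓ.polynomial (b j))) fun j => isPolynomialFun_adjugate
        (isPolynomialFun_kMatrix _ (isPolynomialFun_formKer hℓ)) _ _)
  · intro r s t u v w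
    have h : (fun j => (t ^ (d + 1) • ℓ w) (b j)) = t ^ (d + 1) • fun j => ℓ w (b j) := rfl
    simp only [formChart]
    rw [hℓ.smul, formKer_smul, isotropicPartner_smul, h, smul_dotProduct, dotProduct_smul]
    simp only [Pi.smul_apply, smul_eq_mul]
    ring

theorem isMultihomogeneous_formToBivector {ℓ : V → Module.Dual k V} {d : ℕ}
    (hℓ : IsCovectorField ℓ d) (i : Fin 6 × Fin 6) : IsMultihomogeneous k
      fun x : (V [⋀^Fin 2]→ₗ[k] k) × Z × V => formToBivector b ℓ i x.1 x.2.2 := by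
  refine ⟨fun l => ?_, 12, 0, 6 * (d + 1), fun r s t u v w => ?_⟩
  · simp only [formToBivector, alternating_eq_sum, map_sum, map_smul, smul_eq_mul]
    exact .sum _ fun p _ => .sum _ fun q _ => ((isPolynomialFun_formKer hℓ p).mul
      (isPolynomialFun_adjugate (isPolynomialFun_kMatrix _ (isPolynomialFun_formKer hℓ)) _ _)).mul
      (.const _)
  · simp only [formToBivector]
    rw [hℓ.smul, formKer_smul, isotropicPartner_smul, map_smul, map_smul]
    have := ιMulti_smul_add (b.equivFun.symm (formKer b u (ℓ w)))
      (b.equivFun.symm (isotropicPartner i.1 i.2 (formKer b u (ℓ w)))) (r ^ 2 * t ^ (d + 1)) 0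
      ((r ^ 2 * t ^ (d + 1)) ^ 5)
    rw [zero_smul, zero_add] at this
    rw [this]
    congr 1
    ring

/-- The charts are justified by `isFlag_of_col`, cover the domain by `IsFlag.exists_col`, and meet
the fibre over each point of `Y` by `exists_isFlag_of_kPf` and dominance of `ℓ`. -/
theorem isLocallyPolynomial_forms [Infinite k] (he : IsKleinFrame b e)
    {ℓ : V → Module.Dual k V} {d : ℕ} (hℓ : IsCovectorField ℓ d) :
    IsLocallyPolynomial (fun (x : ℙ k (V [⋀^Fin 2]→ₗ[k] k) × ℙ k Z × ℙ k V)
      (x' : ℙ k (⋀[k]^2 V) × ℙ k Z × ℙ k V) =>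
        Corresponds (LinearMap.range e) x.1.rep x'.1.rep (ℓ x.2.2.rep) ∧ x'.2 = x.2)
      (pfaffianCubic (LinearMap.range e) ×ˢ Set.univ) := by
  have key : ∀ p ∈ pfaffianCubic (LinearMap.range e), formCoords b p.rep ≠ 0 ∧
      e (formCoords b p.rep) = p.rep ∧ kPf (formCoords b p.rep) = 0 := by
    rintro p ⟨hA, hr⟩
    obtain ⟨h1, h2⟩ := he.exists_coords hA p.rep_nonzero
    rw [← h1, he.formRank_le_iff h2] at hr
    exact ⟨h2, h1, hr⟩
  have hS : ∀ (p : ℙ k (V [⋀^Fin 2]→ₗ[k] k)) ξ l, Corresponds (LinearMap.range e) p.rep ξ l →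
      p ∈ pfaffianCubic (LinearMap.range e) := by
    intro p ξ l h
    obtain ⟨h1, h2⟩ := he.exists_coords h.1 p.rep_nonzero
    refine ⟨h.1, ?_⟩
    rw [← h1] at h ⊢
    obtain ⟨u, w, -, hf⟩ := (he.corresponds_iff h2).mp h
    exact (he.formRank_le_iff h2).mpr (kPf_eq_zero hf.ker hf.ne_zero)
  refine isLocallyPolynomial_of_charts
    (C := fun ω ξ v => Corresponds (LinearMap.range e) ω ξ (ℓ v))
    (isMultihomogeneous_formChart (b := b) hℓ) (isMultihomogeneous_formToBivector (b := b) hℓ)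
    (fun p ξ v h => hS p ξ _ h) (fun ω ξ ξ' v => Corresponds.unique_bivector)
    (fun ω ξ v => Corresponds.bivector_ne_zero) (fun ω ξ v a ha h => ?_) (fun p hp i v hc => ?_)
    (fun p ξ v h => ?_) (fun p hp => ?_) (fun i ω => ?_)
  · simpa using h.smul one_ne_zero ha one_ne_zero
  · obtain ⟨h1, h2, h3⟩ := key p hp
    rw [← h2, he.corresponds_iff h1]
    refine ⟨_, _, rfl, ?_⟩
    rw [b.equivFun.apply_symm_apply, b.equivFun.apply_symm_apply, h2]
    exact isFlag_of_col h3 hc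
  · obtain ⟨h1, h2, h3⟩ := key p (hS p _ _ h)
    rw [← h2, he.corresponds_iff h1] at h
    obtain ⟨u, w, -, hf⟩ := h
    obtain ⟨i, r, hir⟩ := hf.exists_col h1
    exact ⟨(i, r), hir⟩
  · obtain ⟨h1, h2, h3⟩ := key p hp
    obtain ⟨l, u, w, hf⟩ := exists_isFlag_of_kPf h1 h3
    obtain ⟨i, r, hir⟩ := hf.exists_col h1
    obtain ⟨m, rfl⟩ := exists_dual b l
    have hm : ∀ j, IsPolynomialFun k fun m : Module.Dual k V => m (b j) := fun j =>
      isPolynomialFun_eval (b j)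
    have hK := isPolynomialFun_kAdj (fun i => .const (formCoords b p.rep i)) hm
    -- A suitable covector `m` exists, and suitability is a polynomial nonvanishing condition, so
    -- dominance supplies one of the form `ℓ v`.
    obtain ⟨v, hv⟩ := hℓ.dominant (fun m => formKer b p.rep m i *
      ((fun j => m (b j)) ⬝ᵥ isotropicPartner i r (formKer b p.rep m)))
      ((hK i).mul (isPolynomialFun_dotProduct hm fun j => isPolynomialFun_adjugate
        (isPolynomialFun_kMatrix _ hK) _ _)) m hir
    exact ⟨(i, r), v, hv⟩
  · have h : (fun j => (0 : Module.Dual k V) (b j)) = 0 := rfl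
    rw [formChart, hℓ.map_zero, h, zero_dotProduct, mul_zero]

end Charts

/-! ### The inverse map, from bivectors to forms -/

section Bivectors

variable {k : Type*} [Field k] {V Z : Type*} [AddCommGroup V] [Module k V] [AddCommGroup Z]
  [Module k Z] {b : Module.Basis (Fin 6) k V} {e : (Fin 5 → k) →ₗ[k] (V [⋀^Fin 2]→ₗ[k] k)}

theorem ιMulti_comb (a c : V) (s t s' t' : k) :
    exteriorPower.ιMulti k 2 ![s • a + t • c, s' • a + t' • c] =
      (s * t' - t * s') • exteriorPower.ιMulti k 2 ![a, c] := by
  have key : ∀ x y : V, exteriorPower.ιMulti k 2 ![y, x] = -exteriorPower.ιMulti k 2 ![x, y] := by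
    intro x y
    rw [← AlternatingMap.map_swap _ ![x, y] (i := 0) (j := 1) (by decide)]
    congr 1
    ext i
    fin_cases i <;> rfl
  have h0 : ∀ y x x' : V, ![y, x + x'] = Function.update ![y, 0] 1 (x + x') := fun y x x' => by
    ext i; fin_cases i <;> rfl
  have h1 : ∀ y x : V, Function.update ![y, 0] 1 x = ![y, x] := fun y x => by
    ext i; fin_cases i <;> rfl
  have h2 : ∀ (y x : V) (r : k), exteriorPower.ιMulti k 2 ![y, r • x] =
      r • exteriorPower.ιMulti k 2 ![y, x] := fun y x r => by
    rw [← h1, AlternatingMap.map_update_smul, h1]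
  have h3 : ∀ x : V, exteriorPower.ιMulti k 2 ![x, x] = 0 := fun x =>
    AlternatingMap.map_eq_zero_of_eq _ _ (i := 0) (j := 1) rfl (by decide)
  rw [h0, AlternatingMap.map_update_add, h1, h1, h2, h2, key a, key c, h0, h0,
    AlternatingMap.map_update_add, AlternatingMap.map_update_add, h1, h1, h1, h1, h2, h2, h2, h2,
    h3, h3, key a c]
  module

theorem contract_eq_sum (b : Module.Basis (Fin 6) k V) (l m : Module.Dual k V) (ξ : ⋀[k]^2 V) :
    contract l m ξ = ∑ i, l (b i) * contract (b.coord i) m ξ := by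
  let W : Module.Dual k V →ₗ[k] (V [⋀^Fin 2]→ₗ[k] k) :=
    { toFun := fun l => wedge l m
      map_add' := fun f g => by
        ext v
        show (f (v 0) + g (v 0)) * m (v 1) - (f (v 1) + g (v 1)) * m (v 0) =
          f (v 0) * m (v 1) - f (v 1) * m (v 0) + (g (v 0) * m (v 1) - g (v 1) * m (v 0))
        ring
      map_smul' := fun c f => by
        ext v
        show c * f (v 0) * m (v 1) - c * f (v 1) * m (v 0) =
          c * (f (v 0) * m (v 1) - f (v 1) * m (v 0))
        ring }
  have hl : l = ∑ i, l (b i) • b.coord i := by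
    refine b.ext fun j => ?_
    simp
  have h : contract l m ξ = (LinearMap.applyₗ ξ ∘ₗ
      exteriorPower.alternatingMapLinearEquiv.toLinearMap ∘ₗ W) l := rfl
  rw [h]
  conv_lhs => rw [hl]
  rw [map_sum]
  exact Finset.sum_congr rfl fun i _ => map_smul _ _ _

theorem mem_annihilator_iff {A : Submodule k (V [⋀^Fin 2]→ₗ[k] k)} {u w : V} :
    exteriorPower.ιMulti k 2 ![u, w] ∈ annihilator A ↔ ∀ η ∈ A, η ![u, w] = 0 := by
  simp only [annihilator, Submodule.mem_iInf, LinearMap.mem_ker,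
    exteriorPower.alternatingMapLinearEquiv_apply_ιMulti]

theorem bivectorKer_ιMulti (u w : V) (l : Module.Dual k V) :
    bivectorKer b (exteriorPower.ιMulti k 2 ![u, w]) l = b.equivFun (l u • w - l w • u) := by
  funext j
  rw [bivectorKer, contract_ιMulti]
  simp

theorem bivectorKer_smul (ξ : ⋀[k]^2 V) (l : Module.Dual k V) (a c : k) :
    bivectorKer b (a • ξ) (c • l) = (a * c) • bivectorKer b ξ l := by
  funext j
  simp only [bivectorKer, Pi.smul_apply]
  rw [contract_eq_sum b, contract_eq_sum b l]
  simp only [map_smul, LinearMap.smul_apply, smul_eq_mul, Finset.mul_sum]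
  exact Finset.sum_congr rfl fun i _ => by ring

variable (b) in
/-- The chart of the correspondence around a bivector. -/
noncomputable def bivectorChart (ℓ : V → Module.Dual k V) (i : Fin 6 × Fin 6 × Fin 6)
    (ξ : ⋀[k]^2 V) (v : V) : k :=
  bivectorKer b ξ (ℓ v) i.1 *
    kAdj (formKilling i.1 i.2.1 (bivectorKer b ξ (ℓ v))) (fun j => ℓ v (b j)) i.2.2

variable (b e) in
/-- The form corresponding to a bivector. -/
noncomputable def bivectorToForm (ℓ : V → Module.Dual k V) (i : Fin 6 × Fin 6 × Fin 6)
    (ξ : ⋀[k]^2 V) (v : V) : V [⋀^Fin 2]→ₗ[k] k :=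
  e (formKilling i.1 i.2.1 (bivectorKer b ξ (ℓ v)))

theorem isPolynomialFun_bivectorKer {ℓ : V → Module.Dual k V} {d : ℕ} (hℓ : IsCovectorField ℓ d)
    (i : Fin 6) : IsPolynomialFun k fun x : (⋀[k]^2 V) × Z × V => bivectorKer b x.1 (ℓ x.2.2) i := by
  simp only [bivectorKer, contract_eq_sum b (ℓ _)]
  exact .sum _ fun j _ => (isPolynomialFun_thd (hℓ.polynomial (b j))).mul
    (isPolynomialFun_fst (.linear _))

theorem isMultihomogeneous_bivectorChart {ℓ : V → Module.Dual k V} {d : ℕ}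
    (hℓ : IsCovectorField ℓ d) (i : Fin 6 × Fin 6 × Fin 6) : IsMultihomogeneous k
      fun x : (⋀[k]^2 V) × Z × V => bivectorChart b ℓ i x.1 x.2.2 := by
  -- The vector of the plane has degree `1` in both arguments, the form killing it is quintic in it,
  -- and the Pfaffian adjoint is quadratic in this form and linear in the covector.
  refine isMultihomogeneous_scalar (a := 11) (b := 0) (c := 12 * (d + 1)) ?_ ?_
  · exact (isPolynomialFun_bivectorKer hℓ i.1).mul (isPolynomialFun_kAdj
      (fun r => isPolynomialFun_adjugate
        (isPolynomialFun_kMatrix _ (isPolynomialFun_bivectorKer hℓ)) _ _)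
      (fun j => isPolynomialFun_thd (hℓ.polynomial (b j))) _)
  · intro r s t u v w
    have h : (fun j => (t ^ (d + 1) • ℓ w) (b j)) = t ^ (d + 1) • fun j => ℓ w (b j) := rfl
    simp only [bivectorChart]
    rw [hℓ.smul, bivectorKer_smul, formKilling_smul, h, kAdj_smul, kAdj_smul_left]
    simp only [Pi.smul_apply, smul_eq_mul]
    ring

theorem isMultihomogeneous_bivectorToForm {ℓ : V → Module.Dual k V} {d : ℕ}
    (hℓ : IsCovectorField ℓ d) (i : Fin 6 × Fin 6 × Fin 6) : IsMultihomogeneous k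
      fun x : (⋀[k]^2 V) × Z × V => bivectorToForm b e ℓ i x.1 x.2.2 := by
  refine ⟨fun l => ?_, 5, 0, 5 * (d + 1), fun r s t u v w => ?_⟩
  · have h : ∀ y, l (e y) = ∑ r, y r * l (e (Pi.single r 1)) := fun y => by
      conv_lhs => rw [pi_eq_sum_univ' y]
      simp [map_sum, map_smul]
    simp only [bivectorToForm]
    exact (congrArg (IsPolynomialFun k) (funext fun x => h _)).mpr <| .sum _ fun r _ => (isPolynomialFun_adjugate
      (isPolynomialFun_kMatrix _ (isPolynomialFun_bivectorKer hℓ)) _ _).mul (.const _)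
  · simp only [bivectorToForm]
    rw [hℓ.smul, bivectorKer_smul, formKilling_smul, map_smul]
    congr 1
    ring

theorem bivectorChart_formula (ℓ : V → Module.Dual k V) (i : Fin 6 × Fin 6 × Fin 6) (v u : V)
    (c : k) {ξ : ⋀[k]^2 V} (h : bivectorKer b ξ (ℓ v) = c • b.equivFun u) :
    bivectorChart b ℓ i ξ v = c ^ 11 * (b.equivFun u i.1 *
      kAdj (formKilling i.1 i.2.1 (b.equivFun u)) (fun j => ℓ v (b j)) i.2.2) := by
  rw [bivectorChart, h, formKilling_smul, kAdj_smul_left]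
  simp only [Pi.smul_apply, smul_eq_mul]
  ring

/-- The vector `l(a) c - l(c) a` is the intersection of the plane with `l = 0`; the bivector is
rewritten with it as first factor. -/
theorem exists_ιMulti_eq {l : Module.Dual k V} {a c : V} (h : l a • c - l c • a ≠ 0) :
    ∃ w, exteriorPower.ιMulti k 2 ![a, c] = exteriorPower.ιMulti k 2 ![l a • c - l c • a, w] ∧
      l w = -1 := by
  have h1 : l a • c - l c • a = (-l c) • a + l a • c := by module
  by_cases ha : l a = 0
  · have hc : l c ≠ 0 := fun hc => h (by rw [ha, hc, zero_smul, zero_smul, sub_zero])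
    refine ⟨(0 : k) • a + (-(l c)⁻¹) • c, ?_, by simp [hc]⟩
    rw [h1, ιMulti_comb]
    simp [ha, hc]
  · refine ⟨(-(l a)⁻¹) • a + (0 : k) • c, ?_, by simp [ha]⟩
    rw [h1, ιMulti_comb]
    simp [ha]

/-- The mirror image of `isLocallyPolynomial_forms`: `isFlag_of_row`, `IsFlag.exists_row` and
`exists_isFlag_of_isIsotropic` replace the corresponding statements about columns. -/
theorem isLocallyPolynomial_bivectors [Infinite k] (he : IsKleinFrame b e)
    {ℓ : V → Module.Dual k V} {d : ℕ} (hℓ : IsCovectorField ℓ d) :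
    IsLocallyPolynomial (fun (x : ℙ k (⋀[k]^2 V) × ℙ k Z × ℙ k V)
      (x' : ℙ k (V [⋀^Fin 2]→ₗ[k] k) × ℙ k Z × ℙ k V) =>
        Corresponds (LinearMap.range e) x'.1.rep x.1.rep (ℓ x.2.2.rep) ∧ x'.2 = x.2)
      (fanoThreefold (LinearMap.range e) ×ˢ Set.univ) := by
  refine isLocallyPolynomial_of_charts
    (C := fun ξ ω v => Corresponds (LinearMap.range e) ω ξ (ℓ v))
    (isMultihomogeneous_bivectorChart (b := b) hℓ)
    (isMultihomogeneous_bivectorToForm (b := b) (e := e) hℓ)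
    (fun p ω v h => ?_) (fun ω ξ ξ' v => Corresponds.unique_form)
    (fun ω ξ v h => h.2.1) (fun ω ξ v a ha h => ?_) (fun p hp i v hc => ?_)
    (fun p ω v h => ?_) (fun p hp => ?_) (fun i ω => ?_)
  · obtain ⟨-, -, u, w, h, -, -, -, -, hiso, -⟩ := h
    exact ⟨⟨u, w, h⟩, by rw [Set.mem_ofPred_eq, h]; exact mem_annihilator_iff.mpr hiso⟩
  · simpa using h.smul ha one_ne_zero one_ne_zero
  · obtain ⟨⟨a, c, hac⟩, hann⟩ := hp
    rw [Set.mem_ofPred_eq] at hann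
    have hu := bivectorKer_ιMulti (b := b) a c (ℓ v)
    rw [← hac] at hu
    have hu0 : ℓ v a • c - ℓ v c • a ≠ 0 := by
      intro h0
      rw [bivectorChart, hu, h0, map_zero, Pi.zero_apply, zero_mul] at hc
      exact hc rfl
    obtain ⟨w, hw, hlw⟩ := exists_ιMulti_eq hu0
    rw [← hac] at hw
    rw [hw, mem_annihilator_iff, he.isIsotropic_iff] at hann
    rw [bivectorChart, hu] at hc
    have hy : formKilling i.1 i.2.1 (b.equivFun (ℓ v a • c - ℓ v c • a)) ≠ 0 := by
      intro h0
      rw [h0, ← zero_smul k 0, kAdj_smul_left, zero_pow two_ne_zero, zero_smul, Pi.zero_apply,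
        mul_zero] at hc
      exact hc rfl
    rw [bivectorToForm, hu, he.corresponds_iff hy]
    refine ⟨_, w, hw, isFlag_of_row ?_ ?_ hann hc⟩
    · rw [← dual_eq_dotProduct, map_sub, map_smul, map_smul, smul_eq_mul, smul_eq_mul]
      ring
    · rw [← dual_eq_dotProduct, hlw]
      exact neg_ne_zero.mpr one_ne_zero
  · obtain ⟨h1, h2⟩ := he.exists_coords h.1 h.2.1
    rw [← h1, he.corresponds_iff h2] at h
    obtain ⟨u, w, hξ, hf⟩ := h
    obtain ⟨i, j, r, hijr⟩ := hf.exists_row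
    refine ⟨(i, j, r), ?_⟩
    have hlw : ℓ v w ≠ 0 := by
      rw [dual_eq_dotProduct b]
      exact hf.off
    have hlu : ℓ v u = 0 := by
      rw [dual_eq_dotProduct b]
      exact hf.on
    rw [bivectorChart_formula ℓ (i, j, r) v u (-ℓ v w) (by
      rw [hξ, bivectorKer_ιMulti, hlu, zero_smul, zero_sub, ← neg_smul, map_smul])]
    exact mul_ne_zero (pow_ne_zero _ (neg_ne_zero.mpr hlw)) hijr
  · obtain ⟨⟨a, c, hac⟩, hann⟩ := hp
    rw [Set.mem_ofPred_eq, hac, mem_annihilator_iff, he.isIsotropic_iff] at hann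
    -- A dependence between `a` and `c` would make the bivector zero, whereas it represents a
    -- projective point.
    have hli : ∀ s t : k, s • b.equivFun a + t • b.equivFun c = 0 → s = 0 ∧ t = 0 := by
      intro s t hst
      rw [← map_smul, ← map_smul, ← map_add, LinearEquiv.map_eq_zero_iff] at hst
      have h0 : ∀ s' t' : k, s * t' - t * s' = 0 := by
        intro s' t'
        have h1 := ιMulti_comb a c s t s' t'
        rw [hst, ← hac, AlternatingMap.map_coord_zero _ 0 rfl] at h1
        exact (smul_eq_zero.mp h1.symm).resolve_right p.rep_nonzero
      have h1 := h0 0 1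
      have h2 := h0 1 0
      rw [mul_one, mul_zero, sub_zero] at h1
      rw [mul_one, mul_zero, zero_sub, neg_eq_zero] at h2
      exact ⟨h1, h2⟩
    obtain ⟨y, l, s, t, s', t', hdet, hf⟩ := exists_isFlag_of_isIsotropic hann hli
    obtain ⟨i, j, r, hijr⟩ := hf.exists_row
    obtain ⟨m, rfl⟩ := exists_dual b l
    set u := s • a + t • c with hu
    set w := s' • a + t' • c with hw
    have hu' : s • b.equivFun a + t • b.equivFun c = b.equivFun u := by simp [hu]
    have hw' : s' • b.equivFun a + t' • b.equivFun c = b.equivFun w := by simp [hw]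
    rw [hu', hw'] at hf
    rw [hu'] at hijr
    have hlu : m u = 0 := by
      rw [dual_eq_dotProduct b]
      exact hf.on
    have hlw : m w ≠ 0 := by
      rw [dual_eq_dotProduct b]
      exact hf.off
    have hξ : p.rep = exteriorPower.ιMulti k 2 ![u, w] := by
      rw [hu, hw, ιMulti_comb, hdet, one_smul, hac]
    have hm : ∀ j, IsPolynomialFun k fun m : Module.Dual k V => m (b j) := fun j =>
      isPolynomialFun_eval (b j)
    have hB : ∀ j, IsPolynomialFun k fun m : Module.Dual k V => bivectorKer b p.rep m j := by
      intro j
      exact (congrArg (IsPolynomialFun k) (funext fun m =>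
        contract_eq_sum b m (b.coord j) p.rep)).mpr <| .sum _ fun i _ => (hm i).mul (.const _)
    obtain ⟨v, hv⟩ := hℓ.dominant (fun m => bivectorKer b p.rep m i *
        kAdj (formKilling i j (bivectorKer b p.rep m)) (fun j => m (b j)) r)
      ((hB i).mul (isPolynomialFun_kAdj (fun r => isPolynomialFun_adjugate
        (isPolynomialFun_kMatrix _ hB) _ _) hm _)) m (by
      have := bivectorChart_formula (b := b) (fun _ => m) (i, j, r) 0 u (-m w) (ξ := p.rep) (by
        rw [hξ, bivectorKer_ιMulti, hlu, zero_smul, zero_sub, ← neg_smul, map_smul])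
      exact (this.trans_ne
        (mul_ne_zero (pow_ne_zero _ (neg_ne_zero.mpr hlw)) hijr) :))
    exact ⟨(i, j, r), v, hv⟩
  · have h : (fun j => (0 : Module.Dual k V) (b j)) = (0 : k) • 0 := by
      rw [smul_zero]
      rfl
    rw [bivectorChart, hℓ.map_zero, h, kAdj_smul, zero_smul, Pi.zero_apply, mul_zero]

end Bivectors

/-! ### The equivariant birational map -/

section Equivariance

variable {k : Type*} [Field k] {V : Type*} [AddCommGroup V] [Module k V]

theorem projAction_rep {H : Type*} [Group H] {E : Type*} [AddCommGroup E] [Module k E]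
    (σ : Representation k H E) (g : H) (p : ℙ k E) :
    ∃ c : k, c ≠ 0 ∧ (projAction σ g p).rep = c • σ g p.rep := by
  have h0 : σ g p.rep ≠ 0 := fun h => p.rep_nonzero
    (rep_injective σ g (h.trans (map_zero _).symm))
  obtain ⟨c, hc⟩ := Projectivization.exists_smul_eq_mk_rep k _ h0
  refine ⟨c, c.ne_zero, ?_⟩
  have : projAction σ g p = Projectivization.mk k _ h0 := by
    conv_lhs => rw [← p.mk_rep, projAction_mk]
  rw [this, ← hc]
  rfl

/-- `Y × ℙ² × ℙ(V)` and `X × ℙ² × ℙ(V)` are equivariantly birational. -/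
theorem IsKleinFrame.equivariantlyBirational [IsAlgClosed k] [CharZero k] [FiniteDimensional k V]
    {b : Module.Basis (Fin 6) k V} {e : (Fin 5 → k) →ₗ[k] (V [⋀^Fin 2]→ₗ[k] k)}
    (he : IsKleinFrame b e) (ρ : Representation k SL211 V) [ρ.IsIrreducible]
    (hA : ∀ g, ∀ η ∈ LinearMap.range e, formRep ρ g η ∈ LinearMap.range e)
    {Z : Type*} [AddCommGroup Z] [Module k Z] [Nontrivial Z] :
    EquivariantlyBirational
      (prodAction (actionForms ρ) (1 : PSL211 →* Equiv.Perm (ℙ k Z)) (actionV ρ))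
      (pfaffianCubic (LinearMap.range e) ×ˢ Set.univ)
      (prodAction (actionBivectors ρ) (1 : PSL211 →* Equiv.Perm (ℙ k Z)) (actionV ρ))
      (fanoThreefold (LinearMap.range e) ×ˢ Set.univ) := by
  have : Nontrivial V := ⟨⟨b 0, 0, b.ne_zero 0⟩⟩
  have : Infinite k := CharZero.infinite k
  obtain ⟨d, ℓ, h1, h2, h3, h4⟩ := exists_equivariant_covector ρ
  have hℓ : IsCovectorField ℓ d := ⟨h1, h2, h4⟩
  have hPV : Nonempty (ℙ k V) := inferInstance
  have hPZ : Nonempty (ℙ k Z) := inferInstance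
  have hPF : Nonempty (ℙ k (V [⋀^Fin 2]→ₗ[k] k)) :=
    ⟨.mk k (e (Pi.single 0 1)) fun h => by
      simpa using congrFun (he.injective (h.trans (map_zero e).symm)) 0⟩
  have hPB : Nonempty (ℙ k (⋀[k]^2 V)) :=
    ⟨.mk k (exteriorPower.ιMulti k 2 ![b 0, b 1]) fun h => by
      have := congrArg (contract (b.coord 0) (b.coord 1)) h
      rw [contract_ιMulti] at this
      simp at this⟩
  refine equivariantlyBirational_of_correspondence (isLocallyPolynomial_forms he hℓ) ?_ ?_
  · refine (congrArg (fun R => IsLocallyPolynomial R _) (funext fun x' => funext fun x =>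
      propext ?_)).mpr (isLocallyPolynomial_bivectors (Z := Z) he hℓ)
    constructor
    · rintro ⟨h, h'⟩
      exact ⟨by rwa [h'], h'.symm⟩
    · rintro ⟨h, h'⟩
      exact ⟨by rwa [h'], h'.symm⟩
  · rintro g ⟨p, q, s⟩ ⟨p', q', s'⟩ ⟨hR, hqs⟩
    obtain ⟨g, rfl⟩ := QuotientGroup.mk_surjective g
    obtain ⟨rfl, rfl⟩ := Prod.mk.inj hqs
    refine ⟨?_, rfl⟩
    obtain ⟨c₁, hc₁, e₁⟩ := projAction_rep (formRep ρ) g p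
    obtain ⟨c₂, hc₂, e₂⟩ := projAction_rep (bivectorRep ρ) g p'
    obtain ⟨c₃, hc₃, e₃⟩ := projAction_rep ρ g s'
    show Corresponds (LinearMap.range e) (projAction (formRep ρ) g p).rep
      (projAction (bivectorRep ρ) g p').rep (ℓ (projAction ρ g s').rep)
    -- Equivariance of `ℓ`: the hyperplane moves together with the point of `ℙ(V)`, as
    -- `Corresponds.map` requires.
    have h5 : ℓ (ρ g s'.rep) = ℓ s'.rep ∘ₗ ρ g⁻¹ := by
      ext w
      have := h3 g s'.rep (ρ g⁻¹ w)
      rwa [Representation.self_inv_apply] at this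
    rw [e₁, e₂, e₃, hℓ.smul, h5]
    exact (hR.map ρ hA g).smul hc₁ hc₂ (pow_ne_zero _ hc₃)

end Equivariance

/-! ### Generators of `SL₂(𝔽₁₁)` -/

section Generators

instance : Fact (Nat.Prime 11) := ⟨by norm_num⟩

/-- The unipotent element with upper right entry `x`. -/
def upper (x : ZMod 11) : SL211 := ⟨!![1, x; 0, 1], by
  rw [Matrix.det_fin_two_of, mul_zero, sub_zero, mul_one]⟩

/-- The Weyl element. -/
def weyl : SL211 := ⟨!![0, 1; -1, 0], by simp⟩

/-- The diagonal element with entries `a`, `a⁻¹`. -/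
def torus (a : (ZMod 11)ˣ) : SL211 := ⟨!![(a : ZMod 11), 0; 0, (a : ZMod 11)⁻¹], by
  rw [Matrix.det_fin_two_of, mul_inv_cancel₀ a.ne_zero, mul_zero, sub_zero]⟩

theorem coe_upper (x : ZMod 11) : (upper x : Matrix (Fin 2) (Fin 2) (ZMod 11)) = !![1, x; 0, 1] :=
  rfl

theorem coe_weyl : (weyl : Matrix (Fin 2) (Fin 2) (ZMod 11)) = !![0, 1; -1, 0] := rfl

theorem coe_torus (a : (ZMod 11)ˣ) : (torus a : Matrix (Fin 2) (Fin 2) (ZMod 11)) =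
    !![(a : ZMod 11), 0; 0, (a : ZMod 11)⁻¹] := rfl

theorem of_fin_two_congr {R : Type*} {a b c d a' b' c' d' : R} (ha : a = a') (hb : b = b')
    (hc : c = c') (hd : d = d') : !![a, b; c, d] = !![a', b'; c', d'] := by
  rw [ha, hb, hc, hd]

theorem upper_mul (x y : ZMod 11) : upper x * upper y = upper (x + y) := by
  apply Subtype.ext
  rw [Matrix.SpecialLinearGroup.coe_mul]
  simp only [coe_upper, Matrix.mul_fin_two]
  refine of_fin_two_congr ?_ ?_ ?_ ?_ <;> ring

theorem upper_zero : upper 0 = 1 := by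
  apply Subtype.ext
  rw [coe_upper, Matrix.SpecialLinearGroup.coe_one, Matrix.one_fin_two]

theorem upper_pow (n : ℕ) : upper 1 ^ n = upper n := by
  induction n with
  | zero => simp [upper_zero]
  | succ n ih => rw [pow_succ, ih, upper_mul]; simp

theorem upper_eq_pow (x : ZMod 11) : upper x = upper 1 ^ x.val := by
  rw [upper_pow, ZMod.natCast_val, ZMod.cast_id]

theorem torus_mul (a b : (ZMod 11)ˣ) : torus a * torus b = torus (a * b) := by
  apply Subtype.ext
  rw [Matrix.SpecialLinearGroup.coe_mul]
  simp only [coe_torus, Matrix.mul_fin_two, Units.val_mul, mul_inv]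
  refine of_fin_two_congr ?_ ?_ ?_ ?_ <;> ring

theorem torus_one : torus 1 = 1 := by
  apply Subtype.ext
  rw [coe_torus, Matrix.SpecialLinearGroup.coe_one, Matrix.one_fin_two, Units.val_one, inv_one]

theorem torus_neg_one : torus (-1) = -1 := by
  apply Subtype.ext
  rw [coe_torus, Matrix.SpecialLinearGroup.coe_neg, Matrix.SpecialLinearGroup.coe_one,
    Matrix.one_fin_two, Units.val_neg, Units.val_one, inv_neg, inv_one]
  decide

theorem weyl_mul_weyl : weyl * weyl = -1 := by
  apply Subtype.ext
  rw [Matrix.SpecialLinearGroup.coe_mul, coe_weyl, Matrix.SpecialLinearGroup.coe_neg,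
    Matrix.SpecialLinearGroup.coe_one, Matrix.one_fin_two]
  decide

theorem torus_mul_upper (a : (ZMod 11)ˣ) (x : ZMod 11) :
    torus a * upper x = upper (a * a * x) * torus a := by
  apply Subtype.ext
  rw [Matrix.SpecialLinearGroup.coe_mul, Matrix.SpecialLinearGroup.coe_mul]
  simp only [coe_upper, coe_torus, Matrix.mul_fin_two]
  have := a.ne_zero
  refine of_fin_two_congr ?_ ?_ ?_ ?_ <;> first | ring1 | (field_simp; ring1)

theorem torus_mul_weyl (a : (ZMod 11)ˣ) : torus a * weyl = weyl * torus a⁻¹ := by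
  apply Subtype.ext
  rw [Matrix.SpecialLinearGroup.coe_mul, Matrix.SpecialLinearGroup.coe_mul]
  simp only [coe_weyl, coe_torus, Matrix.mul_fin_two, Units.val_inv_eq_inv_val, inv_inv]
  refine of_fin_two_congr ?_ ?_ ?_ ?_ <;> ring

/-- The Bruhat relation. It gives the action of the Weyl element on the translates under
transvections of the Weyl image of a fixed vector. -/
theorem weyl_upper_weyl (x : (ZMod 11)ˣ) :
    weyl * upper x * weyl = upper (↑(-x⁻¹)) * torus (-x⁻¹) * weyl * upper ↑(-x⁻¹) := by
  apply Subtype.ext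
  simp only [Matrix.SpecialLinearGroup.coe_mul, coe_weyl, coe_torus, coe_upper, Matrix.mul_fin_two,
    Units.val_neg, Units.val_inv_eq_inv_val]
  have := x.ne_zero
  refine of_fin_two_congr ?_ ?_ ?_ ?_ <;> first | ring1 | (field_simp; ring1)

/-- Once the transvections are set to one, this word reduces to `weyl * weyl = weyl`; it is used in
this way in `weyl_eq_one`. -/
theorem weyl_mul_upper : weyl * weyl = upper 1 * weyl * upper 1 * weyl⁻¹ * upper 1 * weyl := by
  apply Subtype.ext
  simp only [Matrix.SpecialLinearGroup.coe_mul, Matrix.SpecialLinearGroup.coe_inv, coe_weyl,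
    coe_upper, Matrix.adjugate_fin_two_of]
  decide

/-- `SL₂(𝔽₁₁)` is generated by a transvection and the Weyl element. -/
theorem mem_of_upper_weyl (K : Subgroup SL211) (hu : upper 1 ∈ K) (hw : weyl ∈ K) (g : SL211) :
    g ∈ K := by
  have hU : ∀ x, upper x ∈ K := fun x => by rw [upper_eq_pow]; exact K.pow_mem hu _
  have hT : ∀ a, torus a ∈ K := by
    intro a
    obtain ⟨x, rfl⟩ : ∃ x : (ZMod 11)ˣ, a = -x⁻¹ := ⟨-a⁻¹, by simp⟩
    have h : torus (-x⁻¹) = (upper ↑(-x⁻¹))⁻¹ * (weyl * upper x * weyl) *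
        (upper ↑(-x⁻¹))⁻¹ * weyl⁻¹ := by
      rw [weyl_upper_weyl]
      group
    rw [h]
    exact K.mul_mem (K.mul_mem (K.mul_mem (K.inv_mem (hU _)) (K.mul_mem (K.mul_mem hw (hU _)) hw))
      (K.inv_mem (hU _))) (K.inv_mem hw)
  have key : ∀ g : SL211, g 1 0 ≠ 0 → g ∈ K := by
    intro g hg
    -- The Bruhat decomposition on the big cell, where the lower left entry is nonzero.
    have h : g = upper (g 0 0 / g 1 0) * torus (-(Units.mk0 _ hg)⁻¹) * weyl *
        upper (g 1 1 / g 1 0) := by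
      have hdet := g.det_coe
      rw [Matrix.det_fin_two] at hdet
      apply Subtype.ext
      simp only [Matrix.SpecialLinearGroup.coe_mul, coe_weyl, coe_torus, coe_upper,
        Matrix.mul_fin_two, Units.val_neg, Units.val_inv_eq_inv_val, Units.val_mk0]
      refine (Matrix.eta_fin_two (g : Matrix (Fin 2) (Fin 2) (ZMod 11))).trans ?_
      refine of_fin_two_congr ?_ ?_ ?_ ?_ <;> field_simp <;>
        first | ring1 | linear_combination (-g 1 0) * hdet
    rw [h]
    exact K.mul_mem (K.mul_mem (K.mul_mem (hU _) (hT _)) hw) (hU _)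
  by_cases hg : g 1 0 = 0
  -- Multiplication by the Weyl element moves a triangular matrix into the big cell.
  · have h : g * weyl ∈ K := by
      refine key _ fun h => ?_
      have hdet := g.det_coe
      rw [Matrix.det_fin_two, hg, mul_zero, sub_zero] at hdet
      have h1 : (g * weyl) 1 0 = -g 1 1 := by
        rw [Matrix.SpecialLinearGroup.coe_mul, coe_weyl, Matrix.mul_apply, Fin.sum_univ_two]
        simp
      rw [h1, neg_eq_zero] at h
      rw [h, mul_zero] at hdet
      exact zero_ne_one hdet
    have := K.mul_mem h (K.inv_mem hw)
    rwa [mul_inv_cancel_right] at this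
  · exact key g hg

variable {k : Type*} [Field k] {E : Type*} [AddCommGroup E] [Module k E]

/-- A subspace stable under generators is stable under the group. -/
theorem map_mem_of_generators (σ : Representation k SL211 E) (A : Submodule k E)
    (hu : ∀ v ∈ A, σ (upper 1) v ∈ A) (hw : ∀ v ∈ A, σ weyl v ∈ A) (g : SL211) :
    ∀ v ∈ A, σ g v ∈ A := by
  let M : Submonoid SL211 :=
    { carrier := {g | ∀ v ∈ A, σ g v ∈ A}
      one_mem' := fun v hv => by simpa using hv
      mul_mem' := fun {g h} hg hh v hv => by
        rw [map_mul]
        exact hg _ (hh v hv) }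
  let K : Subgroup SL211 :=
    { M with
      inv_mem' := fun {g} hg => by
        have : g⁻¹ = g ^ (orderOf g - 1) := by
          rw [inv_eq_iff_mul_eq_one, ← pow_succ', Nat.sub_add_cancel (orderOf_pos g),
            pow_orderOf_eq_one]
        rw [this]
        exact M.pow_mem hg _ }
  exact mem_of_upper_weyl K hu hw g

end Generators

/-! ### Cyclotomic identities -/

section Cyclotomic

variable {k : Type*} [Field k]

theorem forall_fin_five {P : Fin 5 → Prop} : (∀ i, P i) ↔ P 0 ∧ P 1 ∧ P 2 ∧ P 3 ∧ P 4 := by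
  refine ⟨fun h => ⟨h 0, h 1, h 2, h 3, h 4⟩, fun ⟨h0, h1, h2, h3, h4⟩ i => ?_⟩
  fin_cases i
  exacts [h0, h1, h2, h3, h4]

/-- The powers of `z` with exponent the squares `3 ^ i` modulo `11`. -/
def sqPow (z : k) : Fin 5 → k := ![z, z ^ 3, z ^ 9, z ^ 5, z ^ 4]

/-- The powers of `z` with exponent the non-squares `-3 ^ i` modulo `11`. -/
def nsqPow (z : k) : Fin 5 → k := ![z ^ 10, z ^ 8, z ^ 2, z ^ 6, z ^ 7]

/-- The real periods `z ^ (2 r) + z ^ (-2 r)` with `r ^ 2 = 3 ^ i` modulo `11`. -/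
def cosPow (z : k) : Fin 5 → k :=
  ![z ^ 2 + z ^ 9, z ^ 10 + z, z ^ 6 + z ^ 5, z ^ 8 + z ^ 3, z ^ 4 + z ^ 7]

variable {z : k}

theorem cyclotomic_eq (hz : IsPrimitiveRoot z 11) :
    1 + z + z ^ 2 + z ^ 3 + z ^ 4 + z ^ 5 + z ^ 6 + z ^ 7 + z ^ 8 + z ^ 9 + z ^ 10 = 0 := by
  have := hz.geom_sum_eq_zero (by norm_num)
  simpa [Finset.sum_range_succ] using this

/-- Exactly what is needed for the Weyl element to preserve the equality of the coefficients of `x₀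
∧ xᵢ` and `xᵢ₊₁ ∧ xᵢ₊₂`. Each case is an explicit multiple of the cyclotomic polynomial. -/
theorem cosPow_adjacent (hz : IsPrimitiveRoot z 11) : ∀ n : Fin 5,
    cosPow z (n + 1) - cosPow z (n + 2) + cosPow z (n + 2) * cosPow z (n + 4) -
      cosPow z (n + 3) * cosPow z (n + 3) =
    cosPow z n - 2 + 2 * cosPow z (n + 1) - 2 * cosPow z (n + 2) := by
  have h := cyclotomic_eq hz
  rw [forall_fin_five]
  simp only [cosPow, Fin.reduceAdd, Matrix.cons_val]
  refine ⟨?_, ?_, ?_, ?_, ?_⟩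
  · linear_combination
      (2 - 3 * z + z ^ 3 + z ^ 5 - z ^ 6) * h
  · linear_combination
      (2 - 3 * z + z ^ 2 + z ^ 3 - z ^ 4 - z ^ 6 + z ^ 7) * h
  · linear_combination
      (2 - 2 * z - z ^ 3 + z ^ 4 - z ^ 6 + 2 * z ^ 7 - z ^ 8) * h
  · linear_combination
      (2 - 2 * z - z ^ 3 + z ^ 5 + z ^ 9 - z ^ 10) * h
  · linear_combination
      (2 - z - 2 * z ^ 2 + z ^ 3 - z ^ 7 + z ^ 8) * h

/-- It controls the coefficients of `xᵢ₊₁ ∧ xᵢ₊₃`, both for invariance of the space of forms and for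
its uniqueness. -/
theorem cosPow_opposite (hz : IsPrimitiveRoot z 11) : ∀ n : Fin 5,
    cosPow z (n + 2) * cosPow z n - cosPow z (n + 4) * cosPow z (n + 3) =
      -(cosPow z (n + 1) - cosPow z (n + 3)) := by
  have h := cyclotomic_eq hz
  rw [forall_fin_five]
  simp only [cosPow, Fin.reduceAdd, Matrix.cons_val]
  refine ⟨?_, ?_, ?_, ?_, ?_⟩
  · linear_combination
      (z - z ^ 2 - z ^ 3 + z ^ 4) * h
  · linear_combination
      (z ^ 5 - z ^ 6 - z ^ 7 + z ^ 8) * h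
  · linear_combination
      (-z ^ 2 + z ^ 3 + z ^ 8 - z ^ 9) * h
  · linear_combination
      (-z + z ^ 2 + z ^ 4 - 2 * z ^ 6 + z ^ 7) * h
  · linear_combination
      (z ^ 2 - z ^ 3 - z ^ 6 + z ^ 7) * h

/-- The quadratic Gauss sum. -/
def gaussPeriod (z : k) : k := ∑ i, (sqPow z i - nsqPow z i)

/-- The Salié sums. -/
theorem salie_sum (hz : IsPrimitiveRoot z 11) : ∀ n : Fin 5,
    ∑ i, (sqPow z i * sqPow z (n - i) - nsqPow z i * nsqPow z (n - i)) =
      gaussPeriod z * cosPow z n := by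
  have h := cyclotomic_eq hz
  rw [forall_fin_five]
  simp only [gaussPeriod, sqPow, nsqPow, cosPow, Fin.sum_univ_five, Fin.reduceSub, Matrix.cons_val]
  refine ⟨?_, ?_, ?_, ?_, ?_⟩
  · linear_combination
      (z ^ 2 - 2 * z ^ 3 + 2 * z ^ 4 - 2 * z ^ 5 + 2 * z ^ 7 - 2 * z ^ 8 + 2 * z ^ 9 - z ^
      10) * h
  · linear_combination
      (-z ^ 2 + 2 * z ^ 3 - 2 * z ^ 5 + 2 * z ^ 7 - 2 * z ^ 9 + z ^ 10) * h
  · linear_combination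
      (0) * h
  · linear_combination
      (-z ^ 4 + 2 * z ^ 5 - 2 * z ^ 7 + z ^ 8) * h
  · linear_combination
      (-z ^ 4 + 2 * z ^ 5 - 2 * z ^ 7 + z ^ 8) * h

theorem cosPow_sub_ne_zero [CharZero k] (hz : IsPrimitiveRoot z 11) : ∀ n : Fin 5,
    cosPow z (n + 1) - cosPow z (n + 3) ≠ 0 := by
  have h := cyclotomic_eq hz
  -- A cofactor `q` with `a * q = 11` modulo the cyclotomic polynomial certifies that `a` is nonzero
  -- in characteristic zero.
  have key : ∀ a q r : k,
      a * q - 11 = r * (1 + z + z ^ 2 + z ^ 3 + z ^ 4 + z ^ 5 + z ^ 6 + z ^ 7 + z ^ 8 + z ^ 9 +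
        z ^ 10) → a ≠ 0 := by
    rintro a q r h1 rfl
    rw [h, mul_zero, zero_mul, zero_sub, neg_eq_zero] at h1
    norm_num at h1
  rw [forall_fin_five]
  simp only [cosPow, Fin.reduceAdd, Matrix.cons_val]
  refine ⟨?_, ?_, ?_, ?_, ?_⟩
  · exact key _ (-9 - 6 * z ^ 2 - 5 * z ^ 3 - 8 * z ^ 4 - 4 * z ^ 5 - 4 * z ^ 6 - 8 * z ^ 7 - 5 * z ^
      8 - 6 * z ^ 9)
      (-11 + 2 * z + 9 * z ^ 2 + 3 * z ^ 3 - 8 * z ^ 4 + 3 * z ^ 5 + 3 * z ^ 6 + 3 * z ^ 7 +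
      z ^ 8 - 6 * z ^ 9) (by ring)
  · exact key _ (-3 - 2 * z ^ 2 + 2 * z ^ 3 + z ^ 4 + 6 * z ^ 5 + 6 * z ^ 6 + z ^ 7 + 2 * z ^ 8 - 2 *
      z ^ 9)
      (-11 + 11 * z + 3 * z ^ 4 - 6 * z ^ 5 + 2 * z ^ 6) (by ring)
  · exact key _ (-1 + 3 * z ^ 2 + 8 * z ^ 3 + 4 * z ^ 4 + 2 * z ^ 5 + 2 * z ^ 6 + 4 * z ^ 7 + 8 * z ^
      8 + 3 * z ^ 9)
      (-11 + 11 * z + z ^ 2 - 2 * z ^ 3 - 2 * z ^ 4 - 2 * z ^ 5 + 9 * z ^ 6 - 2 * z ^ 7 - 3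
      * z ^ 8) (by ring)
  · exact key _ (-4 + z ^ 2 - z ^ 3 + 5 * z ^ 4 - 3 * z ^ 5 - 3 * z ^ 6 + 5 * z ^ 7 - z ^ 8 + z ^ 9)
      (-11 + 15 * z - 4 * z ^ 2 - z ^ 3 - 2 * z ^ 4 - 2 * z ^ 5 + 9 * z ^ 6 - 6 * z ^ 7 + 2
      * z ^ 8 - z ^ 9) (by ring)
  · exact key _ (-5 + 4 * z ^ 2 - 4 * z ^ 3 - 2 * z ^ 4 - z ^ 5 - z ^ 6 - 2 * z ^ 7 - 4 * z ^ 8 + 4 *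
      z ^ 9)
      (-11 + 11 * z - 5 * z ^ 2 + 5 * z ^ 3 + 4 * z ^ 4 - 3 * z ^ 5 + 2 * z ^ 6 - 8 * z ^ 7
      + 4 * z ^ 8) (by ring)

end Cyclotomic

/-! ### The invariant space of forms -/

section Frame

variable {k : Type*} [Field k] {V : Type*} [AddCommGroup V] [Module k V]

/-- The components of a vector in an invariant subspace along distinct eigenvalues lie in this
subspace. -/
theorem mem_of_sum_eigenvectors {E : Type*} [AddCommGroup E] [Module k E] (T : Module.End k E)
    (S : Submodule k E) (hS : ∀ v ∈ S, T v ∈ S) {ι : Type*} [Fintype ι] {μ : ι → k}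
    (hμ : Function.Injective μ) {v : ι → E} (hv : ∀ i, T (v i) = μ i • v i)
    (h : ∑ i, v i ∈ S) (i : ι) : v i ∈ S := by
  classical
  have key : ∀ p : Polynomial k, ∀ w ∈ S, Polynomial.aeval T p w ∈ S := by
    intro p w hw
    induction p using Polynomial.induction_on' with
    | add p q hp hq =>
      rw [map_add, LinearMap.add_apply]
      exact S.add_mem hp hq
    | monomial n c =>
      rw [Polynomial.aeval_monomial, Module.End.mul_apply, Module.algebraMap_end_apply]
      refine S.smul_mem _ ?_
      induction n with
      | zero => simpa using hw
      | succ n ih =>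
        rw [pow_succ', Module.End.mul_apply]
        exact hS _ ih
  have h1 := key (Lagrange.basis Finset.univ μ i) _ h
  rw [map_sum] at h1
  have h2 : ∀ j, Polynomial.aeval T (Lagrange.basis Finset.univ μ i) (v j) =
      if j = i then v j else 0 := by
    intro j
    rw [Module.End.aeval_apply_of_mem_apply_eq_smul (hv j)]
    split_ifs with hj
    · rw [hj, Lagrange.eval_basis_self hμ.injOn (Finset.mem_univ i), one_smul]
    · rw [Lagrange.eval_basis_of_ne (Ne.symm hj) (Finset.mem_univ j), zero_smul]
  simp only [h2, Finset.sum_ite_eq', Finset.mem_univ, if_true] at h1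
  exact h1

theorem compLinearMap_apply_pair (η : V [⋀^Fin 2]→ₗ[k] k) (f : V →ₗ[k] V) (u w : V) :
    η.compLinearMap f ![u, w] = η ![f u, f w] := by
  rw [AlternatingMap.compLinearMap_apply]
  congr 1
  ext i
  fin_cases i <;> rfl

/-- A skew form is determined by its values on pairs of basis vectors. -/
theorem forms_ext (b : Module.Basis (Fin 6) k V) {η η' : V [⋀^Fin 2]→ₗ[k] k}
    (h0 : ∀ i : Fin 5, η ![b 0, b i.succ] = η' ![b 0, b i.succ])
    (h1 : ∀ i : Fin 5, η ![b (i + 1).succ, b (i + 2).succ] = η' ![b (i + 1).succ, b (i + 2).succ])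
    (h2 : ∀ i : Fin 5, η ![b (i + 1).succ, b (i + 3).succ] = η' ![b (i + 1).succ, b (i + 3).succ]) :
    η = η' := by
  have swap : ∀ (η : V [⋀^Fin 2]→ₗ[k] k) (u w : V), η ![w, u] = -η ![u, w] := by
    intro η u w
    rw [← AlternatingMap.map_swap _ ![u, w] (i := 0) (j := 1) (by decide)]
    congr 1
    ext i
    fin_cases i <;> rfl
  have key : ∀ i j : Fin 6, i ≠ j → η ![b i, b j] = η' ![b i, b j] := by
    have h12 : ∀ i j : Fin 5, i ≠ j → η ![b i.succ, b j.succ] = η' ![b i.succ, b j.succ] := by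
      intro i j hij
      obtain h | h | h | h : (∃ r, i = r + 1 ∧ j = r + 2) ∨ (∃ r, j = r + 1 ∧ i = r + 2) ∨
          (∃ r, i = r + 1 ∧ j = r + 3) ∨ (∃ r, j = r + 1 ∧ i = r + 3) := by
        revert i j
        decide
      · obtain ⟨r, rfl, rfl⟩ := h
        exact h1 r
      · obtain ⟨r, rfl, rfl⟩ := h
        rw [swap, swap η', h1 r]
      · obtain ⟨r, rfl, rfl⟩ := h
        exact h2 r
      · obtain ⟨r, rfl, rfl⟩ := h
        rw [swap, swap η', h2 r]
    intro i j hij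
    induction i using Fin.cases with
    | zero =>
      induction j using Fin.cases with
      | zero => exact absurd rfl hij
      | succ j => exact h0 j
    | succ i =>
      induction j using Fin.cases with
      | zero => rw [swap, swap η', h0 i]
      | succ j => exact h12 i j fun h => hij (by rw [h])
  refine b.ext_alternating fun v hv => ?_
  have : (fun i => b (v i)) = ![b (v 0), b (v 1)] := by
    ext i
    fin_cases i <;> rfl
  rw [this]
  exact key _ _ fun h => absurd (hv h) (by decide)

variable (b : Module.Basis (Fin 6) k V)

/-- The forms `x_∞ ∧ x_i + x_{i+1} ∧ x_{i+2}`. -/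
noncomputable def kleinForm (i : Fin 5) : V [⋀^Fin 2]→ₗ[k] k :=
  wedge (b.coord 0) (b.coord i.succ) + wedge (b.coord (i + 1).succ) (b.coord (i + 2).succ)

/-- The space of forms `ω_y`. -/
noncomputable def kleinMap : (Fin 5 → k) →ₗ[k] (V [⋀^Fin 2]→ₗ[k] k) :=
  Fintype.linearCombination k (kleinForm b)

theorem kleinMap_apply (y : Fin 5 → k) (u w : V) : kleinMap b y ![u, w] = ∑ r, y r *
    ((b.coord 0 u * b.coord r.succ w - b.coord 0 w * b.coord r.succ u) +
      (b.coord (r + 1).succ u * b.coord (r + 2).succ w -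
        b.coord (r + 1).succ w * b.coord (r + 2).succ u)) := by
  let L : (V [⋀^Fin 2]→ₗ[k] k) →ₗ[k] k :=
    { toFun := fun η => η ![u, w]
      map_add' := fun _ _ => rfl
      map_smul' := fun _ _ => rfl }
  show L (kleinMap b y) = _
  rw [kleinMap, Fintype.linearCombination_apply, map_sum]
  refine Finset.sum_congr rfl fun r _ => ?_
  rw [map_smul]
  rfl

theorem isKleinFrame_kleinMap : IsKleinFrame b (kleinMap b) := by
  intro y u w
  rw [kleinMap_apply, kForm_eq, Fin.sum_univ_five]
  simp only [Module.Basis.coord_apply, Module.Basis.equivFun_apply]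
  simp only [Fin.reduceAdd, Fin.reduceSucc]
  ring

/-- Ten linear equations on the fifteen coefficients cut out the space, so invariance can be tested
on coefficients. -/
theorem mem_range_kleinMap_iff {η : V [⋀^Fin 2]→ₗ[k] k} : η ∈ LinearMap.range (kleinMap b) ↔
    (∀ i : Fin 5, η ![b 0, b i.succ] = η ![b (i + 1).succ, b (i + 2).succ]) ∧
      ∀ i : Fin 5, η ![b (i + 1).succ, b (i + 3).succ] = 0 := by
  have h0 : ∀ y (i : Fin 5), kleinMap b y ![b 0, b i.succ] = y i := by
    intro y i
    rw [kleinMap_apply]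
    simp [Finsupp.single_apply, Fin.succ_ne_zero]
  have h1 : ∀ y (i : Fin 5), kleinMap b y ![b (i + 1).succ, b (i + 2).succ] = y i := by
    intro y i
    rw [kleinMap_apply]
    revert i
    rw [forall_fin_five]
    simp [Finsupp.single_apply, Fin.sum_univ_five]
  have h2 : ∀ y (i : Fin 5), kleinMap b y ![b (i + 1).succ, b (i + 3).succ] = 0 := by
    intro y i
    rw [kleinMap_apply]
    revert i
    rw [forall_fin_five]
    simp [Finsupp.single_apply, Fin.sum_univ_five]
  constructor
  · rintro ⟨y, rfl⟩
    exact ⟨fun i => by rw [h0, h1], h2 y⟩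
  · rintro ⟨ha, hn⟩
    refine ⟨fun i => η ![b 0, b i.succ], forms_ext b (fun i => h0 _ i) (fun i => ?_) fun i => ?_⟩
    · rw [h1, ha]
    · rw [h2, hn]

end Frame

/-! ### Invariance of the space of forms in the normal form -/

section WeylFrame

variable {k : Type*} [Field k] {V : Type*} [AddCommGroup V] [Module k V]

/-- The basis `b` puts the generators of `SL₂(𝔽₁₁)` into a normal form. -/
structure IsWeylFrame (ρ : Representation k SL211 V) (b : Module.Basis (Fin 6) k V) (z a : k) :
    Prop where
  primitive : IsPrimitiveRoot z 11
  ne_zero : a ≠ 0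
  upper_zero : ρ (upper 1) (b 0) = b 0
  upper_succ : ∀ i : Fin 5, ρ (upper 1) (b i.succ) = sqPow z i • b i.succ
  weyl_zero : ρ weyl (b 0) = a • (b 0 - (2 : k) • ∑ j : Fin 5, b j.succ)
  weyl_succ : ∀ i : Fin 5, ρ weyl (b i.succ) = a • (-b 0 + ∑ j : Fin 5, cosPow z (i + j) • b j.succ)

variable {ρ : Representation k SL211 V} {b : Module.Basis (Fin 6) k V} {z a : k}

namespace IsWeylFrame

theorem coord_weyl_zero (h : IsWeylFrame ρ b z a) : b.coord 0 (ρ weyl (b 0)) = a := by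
  rw [h.weyl_zero]
  simp [Fin.succ_ne_zero]

theorem coord_succ_weyl_zero (h : IsWeylFrame ρ b z a) (j : Fin 5) :
    b.coord j.succ (ρ weyl (b 0)) = -2 * a := by
  rw [h.weyl_zero]
  simp [Finsupp.single_apply, Fin.succ_ne_zero]
  ring

theorem coord_weyl_succ (h : IsWeylFrame ρ b z a) (i : Fin 5) :
    b.coord 0 (ρ weyl (b i.succ)) = -a := by
  rw [h.weyl_succ]
  simp [Fin.succ_ne_zero]

theorem coord_succ_weyl_succ (h : IsWeylFrame ρ b z a) (i j : Fin 5) :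
    b.coord j.succ (ρ weyl (b i.succ)) = a * cosPow z (i + j) := by
  rw [h.weyl_succ]
  simp [Finsupp.single_apply, Fin.succ_ne_zero]

/-- The exponents add as `3 ^ (i + 1) + 3 ^ (i + 2) = 12 * 3 ^ i`, which is `3 ^ i` modulo `11`.
Hence the two terms of each basic form have the same weight. -/
theorem sqPow_mul_sqPow_adjacent (h : IsPrimitiveRoot z 11) : ∀ i : Fin 5,
    sqPow z (i + 1) * sqPow z (i + 2) = sqPow z i := by
  have := h.pow_eq_one
  rw [forall_fin_five]
  simp only [sqPow, Fin.reduceAdd, Matrix.cons_val]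
  refine ⟨?_, ?_, ?_, ?_, ?_⟩ <;> grind

/-- Here `3 ^ (i + 1) + 3 ^ (i + 3) = 10 * 3 ^ (i + 1)`, which is `-3 ^ (i + 1)` modulo `11`; these
weights are nonsquares. -/
theorem sqPow_mul_sqPow_opposite (h : IsPrimitiveRoot z 11) : ∀ i : Fin 5,
    sqPow z (i + 1) * sqPow z (i + 3) = nsqPow z (i + 1) := by
  have := h.pow_eq_one
  rw [forall_fin_five]
  simp only [sqPow, nsqPow, Fin.reduceAdd, Matrix.cons_val]
  refine ⟨?_, ?_, ?_, ?_, ?_⟩ <;> grind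

theorem upper_mem (h : IsWeylFrame ρ b z a) :
    ∀ η ∈ LinearMap.range (kleinMap b), η.compLinearMap (ρ (upper 1)) ∈
      LinearMap.range (kleinMap b) := by
  intro η hη
  rw [mem_range_kleinMap_iff] at hη ⊢
  have hs : ∀ (η : V [⋀^Fin 2]→ₗ[k] k) (c d : k) (u w : V),
      η ![c • u, d • w] = c * d * η ![u, w] := by
    intro η c d u w
    have := η.toMultilinearMap.map_smul_univ ![c, d] ![u, w]
    rw [Fin.prod_univ_two] at this
    refine Eq.trans ?_ this
    show η _ = η _
    congr 1
    ext i
    fin_cases i <;> rfl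
  refine ⟨fun i => ?_, fun i => ?_⟩
  · rw [compLinearMap_apply_pair, compLinearMap_apply_pair, h.upper_zero, h.upper_succ,
      h.upper_succ, h.upper_succ, hs, sqPow_mul_sqPow_adjacent h.primitive, ← one_smul k (b 0), hs,
      one_mul, hη.1]
  · rw [compLinearMap_apply_pair, h.upper_succ, h.upper_succ, hs, hη.2, mul_zero]

/-- The entries of the Weyl element depend on `i + j` only, so every coefficient comparison depends
on `i + r` only and is an instance of one of the two cyclotomic identities. -/
theorem weyl_mem (h : IsWeylFrame ρ b z a) :
    ∀ η ∈ LinearMap.range (kleinMap b), η.compLinearMap (ρ weyl) ∈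
      LinearMap.range (kleinMap b) := by
  rintro _ ⟨y, rfl⟩
  rw [mem_range_kleinMap_iff]
  refine ⟨fun i => ?_, fun i => ?_⟩
  · rw [compLinearMap_apply_pair, compLinearMap_apply_pair, kleinMap_apply, kleinMap_apply]
    refine Finset.sum_congr rfl fun r _ => ?_
    simp only [h.coord_weyl_zero, h.coord_succ_weyl_zero, h.coord_weyl_succ,
      h.coord_succ_weyl_succ]
    have e0 : i + 1 + (r + 1) = i + r + 2 := by revert i r; decide
    have e1 : i + 1 + (r + 2) = i + r + 3 := by revert i r; decide
    have e2 : i + 2 + (r + 1) = i + r + 3 := by revert i r; decide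
    have e3 : i + 2 + (r + 2) = i + r + 4 := by revert i r; decide
    have e4 : i + 1 + r = i + r + 1 := by revert i r; decide
    have e5 : i + 2 + r = i + r + 2 := by revert i r; decide
    have e6 : i + (r + 1) = i + r + 1 := by revert i r; decide
    have e7 : i + (r + 2) = i + r + 2 := by revert i r; decide
    rw [e0, e1, e2, e3, e4, e5, e6, e7]
    linear_combination (-(y r) * a ^ 2) * cosPow_adjacent h.primitive (i + r)
  · rw [compLinearMap_apply_pair, kleinMap_apply]
    refine Finset.sum_eq_zero fun r _ => ?_
    simp only [h.coord_weyl_succ, h.coord_succ_weyl_succ]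
    have e0 : i + 1 + (r + 1) = i + r + 2 := by revert i r; decide
    have e1 : i + 1 + (r + 2) = i + r + 3 := by revert i r; decide
    have e2 : i + 3 + (r + 1) = i + r + 4 := by revert i r; decide
    have e3 : i + 3 + (r + 2) = i + r := by revert i r; decide
    have e4 : i + 1 + r = i + r + 1 := by revert i r; decide
    have e5 : i + 3 + r = i + r + 3 := by revert i r; decide
    rw [e0, e1, e2, e3, e4, e5]
    linear_combination (y r * a ^ 2) * cosPow_opposite h.primitive (i + r)

end IsWeylFrame

theorem formRep_inv_apply {H : Type*} [Group H] (ρ : Representation k H V) (g : H)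
    (η : V [⋀^Fin 2]→ₗ[k] k) : formRep ρ g⁻¹ η = η.compLinearMap (ρ g) := by
  show η.compLinearMap (ρ g⁻¹⁻¹) = _
  rw [inv_inv]

/-- Forms are acted on through inverses. As the generators have finite orders `11` and `4`, each is
a power of its inverse, so stability under pullback suffices. -/
theorem formRep_mem_of_generators {A : Submodule k (V [⋀^Fin 2]→ₗ[k] k)}
    (hu : ∀ η ∈ A, η.compLinearMap (ρ (upper 1)) ∈ A)
    (hw : ∀ η ∈ A, η.compLinearMap (ρ weyl) ∈ A) (g : SL211) : ∀ η ∈ A, formRep ρ g η ∈ A := by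
  have h4 : (upper 1)⁻¹ ^ 10 = upper 1 := by
    rw [inv_pow, inv_eq_iff_mul_eq_one, upper_pow, upper_mul]
    exact (congrArg upper (by decide)).trans upper_zero
  have h5 : weyl⁻¹ ^ 3 = weyl := by
    rw [inv_pow, inv_eq_iff_mul_eq_one, ← pow_succ, pow_succ, pow_succ, pow_two, weyl_mul_weyl,
      mul_assoc, weyl_mul_weyl, neg_one_mul, neg_neg]
  have key : ∀ x : SL211, (∀ η ∈ A, η.compLinearMap (ρ x) ∈ A) → ∀ n : ℕ, ∀ η ∈ A,
      formRep ρ (x⁻¹ ^ n) η ∈ A := by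
    intro x hx n
    induction n with
    | zero => intro η hη; simpa using hη
    | succ n ih =>
      intro η hη
      rw [pow_succ', map_mul, Module.End.mul_apply, formRep_inv_apply]
      exact hx _ (ih η hη)
  refine map_mem_of_generators (formRep ρ) A ?_ ?_ g
  · rw [← h4]
    exact key _ hu 10
  · rw [← h5]
    exact key _ hw 3

namespace IsWeylFrame

theorem formRep_mem (h : IsWeylFrame ρ b z a) (g : SL211) :
    ∀ η ∈ LinearMap.range (kleinMap b), formRep ρ g η ∈ LinearMap.range (kleinMap b) :=
  formRep_mem_of_generators h.upper_mem h.weyl_mem g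

end IsWeylFrame

end WeylFrame

/-! ### Uniqueness of the five-dimensional invariant space -/

section Uniqueness

variable {k : Type*} [Field k] {V : Type*} [AddCommGroup V] [Module k V]

theorem wedge_compLinearMap_eq_smul {f g : Module.Dual k V} {T : V →ₗ[k] V} {c d : k}
    (hf : f ∘ₗ T = c • f) (hg : g ∘ₗ T = d • g) :
    (wedge f g).compLinearMap T = (c * d) • wedge f g := by
  have hf' : ∀ x, f (T x) = c * f x := fun x => LinearMap.congr_fun hf x
  have hg' : ∀ x, g (T x) = d * g x := fun x => LinearMap.congr_fun hg x
  ext v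
  show f (T (v 0)) * g (T (v 1)) - f (T (v 1)) * g (T (v 0)) =
    c * d * (f (v 0) * g (v 1) - f (v 1) * g (v 0))
  rw [hf', hf', hg', hg']
  ring

/-- The component of a form along the weight of `x_∞ ∧ x_i`. -/
noncomputable def sqPart (b : Module.Basis (Fin 6) k V) (η : V [⋀^Fin 2]→ₗ[k] k) (i : Fin 5) :
    V [⋀^Fin 2]→ₗ[k] k :=
  η ![b 0, b i.succ] • wedge (b.coord 0) (b.coord i.succ) +
    η ![b (i + 1).succ, b (i + 2).succ] • wedge (b.coord (i + 1).succ) (b.coord (i + 2).succ)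

/-- The component of a form along the weight of `x_{i+1} ∧ x_{i+3}`. -/
noncomputable def nsqPart (b : Module.Basis (Fin 6) k V) (η : V [⋀^Fin 2]→ₗ[k] k) (i : Fin 5) :
    V [⋀^Fin 2]→ₗ[k] k :=
  η ![b (i + 1).succ, b (i + 3).succ] • wedge (b.coord (i + 1).succ) (b.coord (i + 3).succ)

theorem sqPart_apply (b : Module.Basis (Fin 6) k V) (η : V [⋀^Fin 2]→ₗ[k] k) (i : Fin 5)
    (u w : V) : sqPart b η i ![u, w] =
      η ![b 0, b i.succ] * (b.coord 0 u * b.coord i.succ w - b.coord 0 w * b.coord i.succ u) +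
      η ![b (i + 1).succ, b (i + 2).succ] *
        (b.coord (i + 1).succ u * b.coord (i + 2).succ w -
          b.coord (i + 1).succ w * b.coord (i + 2).succ u) := rfl

theorem nsqPart_apply (b : Module.Basis (Fin 6) k V) (η : V [⋀^Fin 2]→ₗ[k] k) (i : Fin 5)
    (u w : V) : nsqPart b η i ![u, w] = η ![b (i + 1).succ, b (i + 3).succ] *
        (b.coord (i + 1).succ u * b.coord (i + 3).succ w -
          b.coord (i + 1).succ w * b.coord (i + 3).succ u) := rfl

theorem sum_parts (b : Module.Basis (Fin 6) k V) (η : V [⋀^Fin 2]→ₗ[k] k) :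
    ∑ i : Fin 5 ⊕ Fin 5, Sum.elim (sqPart b η) (nsqPart b η) i = η := by
  have hap : ∀ u w : V, (∑ i : Fin 5 ⊕ Fin 5, Sum.elim (sqPart b η) (nsqPart b η) i) ![u, w] =
      ∑ i, sqPart b η i ![u, w] + ∑ i, nsqPart b η i ![u, w] := by
    intro u w
    let L : (V [⋀^Fin 2]→ₗ[k] k) →ₗ[k] k :=
      { toFun := fun η => η ![u, w]
        map_add' := fun _ _ => rfl
        map_smul' := fun _ _ => rfl }
    have hL : ∀ η, L η = η ![u, w] := fun _ => rfl
    rw [Fintype.sum_sum_type, ← hL, map_add, map_sum, map_sum]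
    rfl
  refine forms_ext b (fun i => ?_) (fun i => ?_) fun i => ?_ <;>
  · rw [hap]
    simp only [sqPart_apply, nsqPart_apply]
    revert i
    rw [forall_fin_five]
    simp [Finsupp.single_apply, Fin.sum_univ_five]

variable {ρ : Representation k SL211 V} {b : Module.Basis (Fin 6) k V} {z a : k}

/-- The pullback of skew forms along a linear map. -/
noncomputable def pullback (T : V →ₗ[k] V) : Module.End k (V [⋀^Fin 2]→ₗ[k] k) where
  toFun η := η.compLinearMap T
  map_add' _ _ := rfl
  map_smul' _ _ := rfl

namespace IsWeylFrame

theorem coord_upper_zero (h : IsWeylFrame ρ b z a) :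
    b.coord 0 ∘ₗ ρ (upper 1) = (1 : k) • b.coord 0 := by
  refine b.ext fun j => ?_
  rw [LinearMap.comp_apply]
  induction j using Fin.cases with
  | zero => rw [h.upper_zero]; simp
  | succ j => rw [h.upper_succ]; simp [Fin.succ_ne_zero]

theorem coord_upper_succ (h : IsWeylFrame ρ b z a) (i : Fin 5) :
    b.coord i.succ ∘ₗ ρ (upper 1) = sqPow z i • b.coord i.succ := by
  refine b.ext fun j => ?_
  rw [LinearMap.comp_apply]
  induction j using Fin.cases with
  | zero => rw [h.upper_zero]; simp
  | succ j =>
    rw [h.upper_succ]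
    by_cases hij : j = i
    · subst hij; simp
    · simp [hij]

/-- The weights run once through `1, …, 10`: square weights have multiplicity two on skew forms,
nonsquare weights multiplicity one. -/
theorem eigenvalues_injective (h : IsPrimitiveRoot z 11) :
    Function.Injective (Sum.elim (sqPow z) fun i => nsqPow z (i + 1)) := by
  let m : Fin 5 ⊕ Fin 5 → ℕ := Sum.elim ![1, 3, 9, 5, 4] ![8, 2, 6, 7, 10]
  have hm : ∀ i, Sum.elim (sqPow z) (fun i => nsqPow z (i + 1)) i = z ^ m i := by
    rintro (i | i)
    · revert i
      rw [forall_fin_five]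
      simp [m, sqPow]
    · revert i
      rw [forall_fin_five]
      simp [m, nsqPow]
  have hlt : ∀ i, m i < 11 := by decide
  have hinj : ∀ i j, m i = m j → i = j := by decide
  intro i j hij
  rw [hm, hm] at hij
  exact hinj i j (h.pow_inj (hlt i) (hlt j) hij)

theorem pullback_parts (h : IsWeylFrame ρ b z a) (η : V [⋀^Fin 2]→ₗ[k] k) (i : Fin 5 ⊕ Fin 5) :
    pullback (ρ (upper 1)) (Sum.elim (sqPart b η) (nsqPart b η) i) =
      Sum.elim (sqPow z) (fun i => nsqPow z (i + 1)) i •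
        Sum.elim (sqPart b η) (nsqPart b η) i := by
  have hw : ∀ (f g : Module.Dual k V) (c d : k), f ∘ₗ ρ (upper 1) = c • f →
      g ∘ₗ ρ (upper 1) = d • g → pullback (ρ (upper 1)) (wedge f g) = (c * d) • wedge f g :=
    fun f g c d => wedge_compLinearMap_eq_smul
  obtain i | i := i
  · simp only [Sum.elim_inl, sqPart]
    rw [map_add, map_smul, map_smul, hw _ _ _ _ h.coord_upper_zero (h.coord_upper_succ i),
      hw _ _ _ _ (h.coord_upper_succ _) (h.coord_upper_succ _),
      sqPow_mul_sqPow_adjacent h.primitive, one_mul]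
    module
  · simp only [Sum.elim_inr, nsqPart]
    rw [map_smul, hw _ _ _ _ (h.coord_upper_succ _) (h.coord_upper_succ _),
      sqPow_mul_sqPow_opposite h.primitive, smul_comm]

theorem parts_mem (h : IsWeylFrame ρ b z a) {A : Submodule k (V [⋀^Fin 2]→ₗ[k] k)}
    (hu : ∀ η ∈ A, η.compLinearMap (ρ (upper 1)) ∈ A) {η : V [⋀^Fin 2]→ₗ[k] k} (hη : η ∈ A)
    (i : Fin 5 ⊕ Fin 5) : Sum.elim (sqPart b η) (nsqPart b η) i ∈ A :=
  mem_of_sum_eigenvectors (pullback (ρ (upper 1))) A hu (eigenvalues_injective h.primitive)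
    (h.pullback_parts η) (by rwa [sum_parts]) i

/-- The space of forms `ω_y` is the only five-dimensional invariant space of forms. -/
theorem eq_range_of_finrank [CharZero k] (h : IsWeylFrame ρ b z a)
    {A : Submodule k (V [⋀^Fin 2]→ₗ[k] k)}
    (hu : ∀ η ∈ A, η.compLinearMap (ρ (upper 1)) ∈ A)
    (hw : ∀ η ∈ A, η.compLinearMap (ρ weyl) ∈ A) (hA : Module.finrank k A = 5) :
    A = LinearMap.range (kleinMap b) := by
  have ha := h.ne_zero
  have hAf : FiniteDimensional k A := FiniteDimensional.of_finrank_pos (by omega)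
  have hn : ∀ η ∈ A, ∀ i : Fin 5, η ![b (i + 1).succ, b (i + 3).succ] = 0 := by
    intro η hη i
    by_contra hne
    -- If a nonsquare component occurs in `A`, its Weyl transform has nonzero components in all five
    -- square weights. These and `N` are six independent vectors of `A`.
    set N := nsqPart b η i with hN
    have hNA : N ∈ A := h.parts_mem hu hη (.inr i)
    set ν := N.compLinearMap (ρ weyl) with hν
    have hνA : ν ∈ A := hw _ hNA
    have hval : ∀ j : Fin 5, ν ![b 0, b j.succ] ≠ 0 := by
      intro j
      rw [hν, compLinearMap_apply_pair, hN, nsqPart_apply]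
      refine mul_ne_zero hne ?_
      simp only [h.coord_succ_weyl_zero, h.coord_succ_weyl_succ]
      have e0 : ∀ i j : Fin 5, j + (i + 1) = i + j + 1 := by decide
      have e1 : ∀ i j : Fin 5, j + (i + 3) = i + j + 3 := by decide
      rw [e0, e1]
      have : -2 * a * (a * cosPow z (i + j + 3)) - a * cosPow z (i + j + 1) * (-2 * a) =
          2 * a ^ 2 * (cosPow z (i + j + 1) - cosPow z (i + j + 3)) := by ring
      rw [this]
      exact mul_ne_zero (mul_ne_zero two_ne_zero (pow_ne_zero 2 ha))
        (cosPow_sub_ne_zero h.primitive _)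
    let v : Option (Fin 5) → A := fun o =>
      o.elim ⟨N, hNA⟩ fun j => ⟨sqPart b ν j, h.parts_mem hu hνA (.inl j)⟩
    have hli : LinearIndependent k fun o => (v o : V [⋀^Fin 2]→ₗ[k] k) := by
      refine Module.End.eigenvectors_linearIndependent' (pullback (ρ (upper 1)))
        (fun o : Option (Fin 5) => Sum.elim (sqPow z) (fun i => nsqPow z (i + 1))
          (o.elim (.inr i) .inl)) ((eigenvalues_injective h.primitive).comp ?_) _ fun o => ?_
      · rintro (_ | j) (_ | j') hjj'
        · rfl
        · cases hjj'
        · cases hjj'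
        · exact congrArg some (Sum.inl_injective hjj')
      · obtain _ | j := o
        · refine ⟨Module.End.mem_eigenspace_iff.mpr (h.pullback_parts η (.inr i)), fun h0 => hne ?_⟩
          change N = 0 at h0
          simpa [hN, nsqPart_apply] using congrArg
            (fun η : V [⋀^Fin 2]→ₗ[k] k => η ![b (i + 1).succ, b (i + 3).succ]) h0
        · refine ⟨Module.End.mem_eigenspace_iff.mpr (h.pullback_parts ν (.inl j)),
            fun h0 => hval j ?_⟩
          have := congrArg (fun η : V [⋀^Fin 2]→ₗ[k] k => η ![b 0, b j.succ]) h0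
          simpa [v, sqPart_apply, Fin.succ_ne_zero] using this
    have hli' : LinearIndependent k v := LinearIndependent.of_comp A.subtype hli
    have := hli'.fintype_card_le_finrank
    rw [hA, Fintype.card_option, Fintype.card_fin] at this
    omega
  have hle : A ≤ LinearMap.range (kleinMap b) := by
    intro η hη
    rw [mem_range_kleinMap_iff]
    refine ⟨fun i => ?_, hn η hη⟩
    -- The Weyl transform of a square component lies in `A`, so its nonsquare coefficients vanish
    -- too; one of them is a nonzero multiple of the difference of the two coefficients to be
    -- compared.
    have hQ := h.parts_mem hu hη (.inl i)
    have h0 := hn _ (hw _ hQ) 0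
    rw [compLinearMap_apply_pair, Sum.elim_inl, sqPart_apply] at h0
    simp only [h.coord_weyl_succ, h.coord_succ_weyl_succ] at h0
    have e0 : ∀ i : Fin 5, 0 + 1 + (i + 1) = i + 2 := by decide
    have e1 : ∀ i : Fin 5, 0 + 1 + (i + 2) = i + 3 := by decide
    have e2 : ∀ i : Fin 5, 0 + 3 + (i + 1) = i + 4 := by decide
    have e3 : ∀ i : Fin 5, 0 + 3 + (i + 2) = i := by decide
    have e4 : ∀ i : Fin 5, 0 + 1 + i = i + 1 := by decide
    have e5 : ∀ i : Fin 5, 0 + 3 + i = i + 3 := by decide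
    rw [e0, e1, e2, e3, e4, e5] at h0
    have h1 : a ^ 2 * ((η ![b 0, b i.succ] - η ![b (i + 1).succ, b (i + 2).succ]) *
        (cosPow z (i + 1) - cosPow z (i + 3))) = 0 := by
      linear_combination h0 -
        (η ![b (i + 1).succ, b (i + 2).succ] * a ^ 2) * cosPow_opposite h.primitive i
    have h2 := (mul_eq_zero.mp h1).resolve_left (pow_ne_zero 2 ha)
    exact sub_eq_zero.mp ((mul_eq_zero.mp h2).resolve_right (cosPow_sub_ne_zero h.primitive i))
  refine Submodule.eq_of_le_of_finrank_eq hle ?_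
  rw [hA, LinearMap.finrank_range_of_inj (isKleinFrame_kleinMap b).injective]
  simp

end IsWeylFrame

end Uniqueness

/-! ### Weights of a transvection -/

section Weights

variable {k : Type*} [Field k] {V : Type*} [AddCommGroup V] [Module k V]
  {ρ : Representation k SL211 V} {ψ : AddChar (ZMod 11) k}

variable (ρ ψ) in
/-- `v` is an eigenvector of the transvections, with weight `m`. -/
def HasWeight (m : ZMod 11) (v : V) : Prop := ∀ x, ρ (upper x) v = ψ (m * x) • v

variable (ρ ψ) in
/-- The projection to the vectors of weight `m`. -/
noncomputable def weightProj (m : ZMod 11) : V →ₗ[k] V :=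
  (11 : k)⁻¹ • ∑ x, ψ (-(m * x)) • ρ (upper x)

theorem weightProj_apply (m : ZMod 11) (v : V) :
    weightProj ρ ψ m v = (11 : k)⁻¹ • ∑ x, ψ (-(m * x)) • ρ (upper x) v := by
  simp [weightProj, LinearMap.sum_apply]

theorem upper_apply_upper (x y : ZMod 11) (v : V) :
    ρ (upper x) (ρ (upper y) v) = ρ (upper (x + y)) v := by
  rw [← upper_mul, map_mul, Module.End.mul_apply]

theorem hasWeight_weightProj (m : ZMod 11) (v : V) : HasWeight ρ ψ m (weightProj ρ ψ m v) := by
  intro y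
  rw [weightProj_apply, map_smul, map_sum, smul_comm]
  congr 1
  rw [Finset.smul_sum]
  refine Fintype.sum_equiv (Equiv.addLeft y) _ _ fun x => ?_
  rw [map_smul, upper_apply_upper, smul_smul, Equiv.coe_addLeft, ← AddChar.map_add_eq_mul]
  congr 2
  ring

theorem weightProj_upper (m x : ZMod 11) (v : V) :
    weightProj ρ ψ m (ρ (upper x) v) = ψ (m * x) • weightProj ρ ψ m v := by
  rw [← hasWeight_weightProj m v x, weightProj_apply, weightProj_apply, map_smul, map_sum]
  congr 1
  refine Finset.sum_congr rfl fun y _ => ?_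
  rw [map_smul, upper_apply_upper, upper_apply_upper, add_comm]

/-- Fourier inversion on `ZMod 11`: orthogonality of characters leaves only the translate by `0`. -/
theorem sum_weightProj [CharZero k] (hψ : ψ.IsPrimitive) (v : V) :
    ∑ m, weightProj ρ ψ m v = v := by
  simp only [weightProj_apply]
  rw [← Finset.smul_sum, Finset.sum_comm]
  simp only [← Finset.sum_smul]
  have h : ∀ x : ZMod 11, ∑ m, ψ (-(m * x)) = if x = 0 then 11 else 0 := by
    intro x
    have := AddChar.sum_mulShift (-x) hψ
    simp only [mul_neg] at this
    rw [this]
    simp [ZMod.card]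
  simp only [h, ite_smul, zero_smul, Finset.sum_ite_eq', Finset.mem_univ,
    if_true]
  rw [upper_zero, map_one, Module.End.one_apply, smul_smul, inv_mul_cancel₀ (by norm_num), one_smul]

theorem HasWeight.weightProj_self [CharZero k] {m : ZMod 11} {v : V} (h : HasWeight ρ ψ m v) :
    weightProj ρ ψ m v = v := by
  rw [weightProj_apply]
  have : ∀ x, ψ (-(m * x)) • ρ (upper x) v = v := fun x => by
    rw [h x, smul_smul, ← AddChar.map_add_eq_mul, neg_add_cancel, AddChar.map_zero_eq_one, one_smul]
  simp only [this, Finset.sum_const, Finset.card_univ, ZMod.card]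
  rw [← Nat.cast_smul_eq_nsmul k, smul_smul]
  norm_num

theorem HasWeight.weightProj_of_ne (hψ : ψ.IsPrimitive) {m n : ZMod 11} {v : V}
    (h : HasWeight ρ ψ n v) (hmn : n ≠ m) : weightProj ρ ψ m v = 0 := by
  rw [weightProj_apply]
  have : ∀ x, ψ (-(m * x)) • ρ (upper x) v = ψ (x * (n - m)) • v := fun x => by
    rw [h x, smul_smul, ← AddChar.map_add_eq_mul]
    congr 2
    ring
  simp only [this]
  rw [← Finset.sum_smul, AddChar.sum_mulShift _ hψ, if_neg (sub_ne_zero.mpr hmn), Nat.cast_zero,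
    zero_smul, smul_zero]

theorem HasWeight.smul {m : ZMod 11} {v : V} (h : HasWeight ρ ψ m v) (c : k) :
    HasWeight ρ ψ m (c • v) := fun x => by rw [map_smul, h x, smul_comm]

/-- The torus conjugates transvections by squares, so weights are moved within their square class.
-/
theorem HasWeight.torus {m n : ZMod 11} {v : V} (h : HasWeight ρ ψ m v) (a : (ZMod 11)ˣ)
    (hn : n * (a * a) = m) : HasWeight ρ ψ n (ρ (torus a) v) := by
  intro x
  have h1 : upper x * KleinFano.torus a = KleinFano.torus a * upper (↑a⁻¹ * ↑a⁻¹ * x) := by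
    rw [torus_mul_upper]
    congr 2
    have := a.mul_inv
    linear_combination (-(x * (a * ↑a⁻¹ + 1))) * this
  have h2 : m * (↑a⁻¹ * ↑a⁻¹ * x) = n * x := by
    rw [← hn]
    have := a.mul_inv
    linear_combination (n * x * (a * ↑a⁻¹ + 1)) * this
  rw [← Module.End.mul_apply, ← map_mul, h1, map_mul, Module.End.mul_apply, h, h2, map_smul]

theorem primitive_injective (hψ : ψ.IsPrimitive) : Function.Injective ψ := by
  intro x y hxy
  have h1 : ψ (x - y) = 1 := by
    have := AddChar.map_add_eq_mul ψ (x - y) y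
    rw [sub_add_cancel, hxy] at this
    have h0 : ψ y ≠ 0 := (ψ.val_isUnit y).ne_zero
    exact (mul_right_cancel₀ h0 ((one_mul _).trans this)).symm
  exact sub_eq_zero.mp ((AddChar.IsPrimitive.zmod_char_eq_one_iff 11 hψ _).mp h1)

theorem linearIndependent_of_weights (hψ : ψ.IsPrimitive) {ι : Type*} {m : ι → ZMod 11}
    (hm : Function.Injective m) {v : ι → V} (hv : ∀ i, HasWeight ρ ψ (m i) (v i))
    (h0 : ∀ i, v i ≠ 0) : LinearIndependent k v :=
  Module.End.eigenvectors_linearIndependent' (ρ (upper 1)) (fun i => ψ (m i))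
    ((primitive_injective hψ).comp hm) v fun i =>
      ⟨Module.End.mem_eigenspace_iff.mpr (by rw [hv i, mul_one]), h0 i⟩

/-- The square `3` as a unit. -/
def unitThree : (ZMod 11)ˣ := ⟨3, 4, by decide, by decide⟩

/-- The squares `3 ^ i` modulo `11`. -/
def sqUnit (i : Fin 5) : (ZMod 11)ˣ := unitThree ^ (i : ℕ)

theorem sqUnit_add : ∀ i j, sqUnit (i + j) = sqUnit i * sqUnit j := by decide

theorem sqUnit_neg : ∀ i, sqUnit (-i) = (sqUnit i)⁻¹ := by decide

theorem sqUnit_injective : Function.Injective fun i => (sqUnit i : ZMod 11) := by decide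

theorem exists_mul_self : ∀ i, ∃ a : (ZMod 11)ˣ, sqUnit i * (a * a) = 1 := by
  decide

theorem sum_zmod {M : Type*} [AddCommMonoid M] (F : ZMod 11 → M) :
    ∑ x, F x = F 0 + ∑ i, (F (sqUnit i) + F (-sqUnit i)) := by
  have h : (Finset.univ : Finset (ZMod 11)) = insert 0
      (Finset.univ.image (fun i => (sqUnit i : ZMod 11)) ∪
        Finset.univ.image (fun i => (-sqUnit i : ZMod 11))) := by decide
  rw [h, Finset.sum_insert (by decide), Finset.sum_union (by decide),
    Finset.sum_image (fun x _ y _ h => sqUnit_injective h),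
    Finset.sum_image (fun x _ y _ h => sqUnit_injective (neg_injective h)), Finset.sum_add_distrib]

/-- A vector of non-zero weight has translates of five different weights. -/
theorem HasWeight.exists_translate {m : ZMod 11} {v : V} (h : HasWeight ρ ψ m v) (h0 : v ≠ 0)
    (i : Fin 5) : ∃ w, HasWeight ρ ψ (m * sqUnit i) w ∧ w ≠ 0 := by
  obtain ⟨a, ha⟩ := exists_mul_self i
  refine ⟨_, h.torus a ?_, fun h1 => h0 (rep_injective ρ (KleinFano.torus a)
    (h1.trans (map_zero _).symm))⟩
  rw [mul_assoc, ← Units.val_mul, ← Units.val_mul, ha, Units.val_one, mul_one]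

theorem isPrimitiveRoot_of_isPrimitive (hψ : ψ.IsPrimitive) : IsPrimitiveRoot (ψ 1) 11 := by
  rw [IsPrimitiveRoot.iff_orderOf]
  refine orderOf_eq_prime ?_ fun h => ?_
  · rw [← AddChar.map_nsmul_eq_pow]
    exact (congrArg ψ (by decide)).trans (AddChar.map_zero_eq_one ψ)
  · exact absurd ((AddChar.IsPrimitive.zmod_char_eq_one_iff 11 hψ 1).mp h) (by decide)

theorem apply_sqUnit (ψ : AddChar (ZMod 11) k) : ∀ i, ψ (sqUnit i) = sqPow (ψ 1) i := by
  have h : ∀ n : ℕ, ψ n = ψ 1 ^ n := fun n => by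
    rw [← AddChar.map_nsmul_eq_pow, nsmul_one]
  rw [forall_fin_five]
  simp only [sqPow, Matrix.cons_val, ← h]
  refine ⟨?_, ?_, ?_, ?_, ?_⟩ <;> exact congrArg ψ (by decide)

theorem apply_neg_sqUnit (ψ : AddChar (ZMod 11) k) : ∀ i, ψ (-sqUnit i) = nsqPow (ψ 1) i := by
  have h : ∀ n : ℕ, ψ n = ψ 1 ^ n := fun n => by
    rw [← AddChar.map_nsmul_eq_pow, nsmul_one]
  rw [forall_fin_five]
  simp only [nsqPow, Matrix.cons_val, ← h]
  refine ⟨?_, ?_, ?_, ?_, ?_⟩ <;> exact congrArg ψ (by decide)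

/-- If the transvections act trivially, then so does the Weyl element. -/
theorem weyl_eq_one {M : Type*} [Monoid M] {f : SL211 →* M} (h : f (upper 1) = 1) :
    f weyl = 1 := by
  have h1 := congrArg f weyl_mul_upper
  simp only [map_mul, h, one_mul, mul_one] at h1
  rw [← map_mul f weyl weyl⁻¹, mul_inv_cancel, map_one, one_mul] at h1
  have h2 : f weyl * f weyl⁻¹ = 1 := by rw [← map_mul, mul_inv_cancel, map_one]
  calc f weyl = f weyl * f weyl * f weyl⁻¹ := by rw [mul_assoc, h2, mul_one]
    _ = 1 := by rw [h1, h2]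

theorem exists_weight [CharZero k] (hψ : ψ.IsPrimitive) (h : ρ (upper 1) ≠ 1) :
    ∃ m v, m ≠ 0 ∧ v ≠ 0 ∧ HasWeight ρ ψ m v := by
  by_contra hne
  push Not at hne
  refine h (LinearMap.ext fun v => ?_)
  have h0 : ∀ m, m ≠ 0 → weightProj ρ ψ m v = 0 := fun m hm => by
    by_contra hv
    exact hne m _ hm hv (hasWeight_weightProj m v)
  have h1 := sum_weightProj (ρ := ρ) hψ v
  rw [Finset.sum_eq_single 0 (fun m _ hm => h0 m hm) (by simp)] at h1
  have h2 := hasWeight_weightProj (ρ := ρ) (ψ := ψ) 0 v 1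
  rw [h1, zero_mul, AddChar.map_zero_eq_one, one_smul] at h2
  exact h2

end Weights

/-! ### The matrix of the Weyl element from Fourier relations -/

section Weyl

variable {k : Type*} [Field k] {V : Type*} [AddCommGroup V] [Module k V]

/-- The vector with given coordinates. -/
noncomputable def comb (B : Module.Basis (Fin 6) k V) (c₀ : k) (c : Fin 5 → k) : V :=
  c₀ • B 0 + ∑ i : Fin 5, c i • B i.succ

theorem coord_zero_comb (B : Module.Basis (Fin 6) k V) (c₀ : k) (c : Fin 5 → k) :
    B.coord 0 (comb B c₀ c) = c₀ := by
  simp [comb, Fin.succ_ne_zero]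

theorem coord_succ_comb (B : Module.Basis (Fin 6) k V) (c₀ : k) (c : Fin 5 → k) (j : Fin 5) :
    B.coord j.succ (comb B c₀ c) = c j := by
  simp [comb, Finsupp.single_apply, Fin.succ_ne_zero]

theorem sum_sqPow_add_nsqPow {z : k} (hz : IsPrimitiveRoot z 11) :
    ∑ i, (sqPow z i + nsqPow z i) = -1 := by
  have h := cyclotomic_eq hz
  simp only [sqPow, nsqPow, Fin.sum_univ_five, Matrix.cons_val]
  linear_combination h

/-- The action of the Weyl element is determined by its action on the translates of the image of
a fixed vector of the transvections. -/
theorem weyl_apply_of_relations [CharZero k] {B : Module.Basis (Fin 6) k V} {W : V →ₗ[k] V}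
    {z : k} (hz : IsPrimitiveRoot z 11) {a ε : k} {θ : Fin 5 → k} (hθ0 : θ 0 = 1)
    (hθ : ∀ i j, θ (i + j) = θ i * θ j) (hε : ε * ε = 1) {f : V} {p q : Fin 5 → V}
    (hf : f = comb B a 1) (hp : ∀ k, p k = comb B a fun i => sqPow z (i + k))
    (hq : ∀ k, q k = comb B a fun i => nsqPow z (i + k)) (hWf : W f = ε • B 0)
    (hWp : ∀ k, W (p k) = (ε * θ k) • q (-k)) (hWq : ∀ k, W (q k) = θ k • p (-k))
    (s0 : f + ∑ k, (p k + q k) = (11 * a) • B 0)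
    (s1 : f + ∑ k, (sqPow z k • p k + nsqPow z k • q k) = 0)
    (s2 : ∀ i : Fin 5, f + ∑ k, (nsqPow z (i + k) • p k + sqPow z (i + k) • q k) =
      (11 : k) • B i.succ) (hW0 : W (B 0) = f) :
    11 * a ^ 2 = -1 ∧ ∀ i : Fin 5, (11 : k) • W (B i.succ) =
      comb B (-2) fun j => 11 * a * cosPow z (i + j) := by
  -- The vectors `p k`, `q k` are translates of `f` by the transvections with entries `3 ^ k` and
  -- `-3 ^ k`. The relations `s0`, `s1`, `s2` are Fourier inversion in the weights `0`, `-1` and `3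
  -- ^ i`; applying `W` to them gives all the equations used below.
  have cp0 : ∀ k, B.coord 0 (p k) = a := fun k => by rw [hp, coord_zero_comb]
  have cq0 : ∀ k, B.coord 0 (q k) = a := fun k => by rw [hq, coord_zero_comb]
  have cp : ∀ k j, B.coord (Fin.succ j) (p k) = sqPow z (j + k) := fun k j => by
    rw [hp, coord_succ_comb]
  have cq : ∀ k j, B.coord (Fin.succ j) (q k) = nsqPow z (j + k) := fun k j => by
    rw [hq, coord_succ_comb]
  have cf0 : B.coord 0 f = a := by rw [hf, coord_zero_comb]
  have cf : ∀ j : Fin 5, B.coord j.succ f = 1 := fun j => by rw [hf, coord_succ_comb]; rfl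
  have c00 : B.coord 0 (B 0) = 1 := by simp
  have c0 : ∀ j : Fin 5, B.coord j.succ (B 0) = 0 := fun j => by simp
  have t0 := congrArg W s0
  have t1 := congrArg W s1
  simp only [map_add, map_sum, map_smul, hWf, hWp, hWq, hW0, map_zero] at t0 t1
  have t00 := congrArg (B.coord 0) t0
  have t10 := congrArg (B.coord 0) t1
  have t0j := fun j : Fin 5 => congrArg (B.coord j.succ) t0
  simp only [map_add, map_sum, map_smul, smul_eq_mul, cp0, cq0, cp, cq, cf0, cf, c00, c0, mul_one,
    mul_zero, zero_add, map_zero] at t00 t10 t0j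
  have ha : a ≠ 0 := by
    rintro rfl
    simp only [mul_zero, Finset.sum_const_zero, add_zero] at t10
    rw [t10, mul_zero] at hε
    exact zero_ne_one hε
  -- The left side is nonzero and independent of `j`, which forces the character `θ` to be trivial.
  have hsum : ∀ j, 11 * a = θ j * ∑ k, θ (-k) * (ε * nsqPow z k + sqPow z k) := by
    intro j
    rw [← t0j j, Finset.mul_sum]
    refine Fintype.sum_equiv (Equiv.subLeft j) _ _ fun i => ?_
    rw [Equiv.subLeft_apply, ← mul_assoc, ← hθ]
    have e1 : j + -(j - i) = i := by abel
    rw [e1, sub_eq_add_neg]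
    ring
  have hθ1 : ∀ j, θ j = 1 := by
    intro j
    have h0 := hsum 0
    have hj := hsum j
    rw [hθ0, one_mul] at h0
    rw [← h0] at hj
    exact (mul_eq_right₀ (mul_ne_zero (by norm_num) ha)).mp hj.symm
  have hS := sum_sqPow_add_nsqPow hz
  have hG := hsum 0
  simp only [hθ1, one_mul, mul_one] at hG t00 t10
  -- For `ε = 1` the weight `-1` relation gives `a = 1` and the weight `0` relation gives `11 * a =
  -- -1`, which are incompatible.
  have hε1 : ε = -1 := by
    rcases mul_self_eq_one_iff.mp hε with rfl | h
    · exfalso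
      simp only [one_mul, ← add_mul, ← Finset.sum_mul] at hG t10
      rw [hS] at t10
      simp only [add_comm (nsqPow z _)] at hG
      rw [hS] at hG
      have h1 : a = 1 := by linear_combination -t10
      rw [h1] at hG
      norm_num at hG
    · exact h
  subst hε1
  have hg : gaussPeriod z = 11 * a := by
    rw [hG, gaussPeriod]
    exact Finset.sum_congr rfl fun i _ => by ring
  have ha2 : 11 * a ^ 2 = -1 := by
    have h1 : ∑ k : Fin 5, (-1 * a + a) = 0 := Finset.sum_eq_zero fun i _ => by ring
    rw [h1, add_zero] at t00
    linear_combination -t00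
  refine ⟨ha2, fun i => ?_⟩
  -- Its coordinates are a Gauss sum and Salié sums, and `salie_sum` together with `hg` evaluates
  -- the latter as `11 * a` times a real period.
  have t2 := congrArg W (s2 i)
  simp only [map_add, map_sum, map_smul, hWf, hWp, hWq] at t2
  rw [← t2]
  refine B.ext_elem fun r => ?_
  rw [← B.coord_apply, ← B.coord_apply]
  induction r using Fin.cases with
  | zero =>
    rw [coord_zero_comb]
    simp only [map_add, map_sum, map_smul, smul_eq_mul, cp0, cq0, c00, hθ1]
    have h1 : ∑ k, (nsqPow z (i + k) * (-1 * 1 * a) + sqPow z (i + k) * (1 * a)) =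
        a * gaussPeriod z := by
      rw [gaussPeriod, Finset.mul_sum]
      refine Fintype.sum_equiv (Equiv.addLeft i) _ _ fun k => ?_
      rw [Equiv.coe_addLeft]
      ring
    rw [h1, hg]
    linear_combination ha2
  | succ j =>
    rw [coord_succ_comb]
    simp only [map_add, map_sum, map_smul, smul_eq_mul, cp, cq, c0, hθ1]
    rw [← hg, ← salie_sum hz, mul_zero, zero_add]
    refine Fintype.sum_equiv (Equiv.addLeft i) _ _ fun k => ?_
    rw [Equiv.coe_addLeft]
    have e1 : i + j - (i + k) = j + -k := by abel
    rw [e1]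
    ring

end Weyl

/-! ### Weights of a six-dimensional irreducible representation -/

section Existence

variable {k : Type*} [Field k] {V : Type*} [AddCommGroup V] [Module k V]
  {ρ : Representation k SL211 V} {ψ : AddChar (ZMod 11) k}

theorem eq_top_of_generators [ρ.IsIrreducible] {S : Submodule k V}
    (hu : ∀ v ∈ S, ρ (upper 1) v ∈ S) (hw : ∀ v ∈ S, ρ weyl v ∈ S) (h : S ≠ ⊥) : S = ⊤ := by
  let S' : Subrepresentation ρ := ⟨S, fun g v hv => map_mem_of_generators ρ S hu hw g v hv⟩
  have hs : IsSimpleOrder (Subrepresentation ρ) := inferInstanceAs ρ.IsIrreducible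
  rcases hs.eq_bot_or_eq_top S' with h1 | h1
  · exact absurd (congrArg Subrepresentation.toSubmodule h1) h
  · exact congrArg Subrepresentation.toSubmodule h1

/-- Otherwise the Weyl element acts trivially as well, and every line is invariant. -/
theorem upper_ne_one [ρ.IsIrreducible] (h6 : Module.finrank k V = 6) : ρ (upper 1) ≠ 1 := by
  intro h
  have hw := weyl_eq_one h
  have : Nontrivial V := Module.nontrivial_of_finrank_pos (R := k) (by omega)
  obtain ⟨v, hv⟩ := exists_ne (0 : V)
  have h1 : (k ∙ v) = ⊤ := eq_top_of_generators (ρ := ρ) (fun x hx => by rw [h]; exact hx)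
    (fun x hx => by rw [hw]; exact hx) (by simpa using hv)
  have h2 := finrank_span_singleton (K := k) hv
  rw [h1, finrank_top, h6] at h2
  omega

/-- The weights of a six-dimensional representation. -/
theorem exists_weights [IsAlgClosed k] [CharZero k] [FiniteDimensional k V] [ρ.IsIrreducible]
    (h6 : Module.finrank k V = 6) : ∃ ψ : AddChar (ZMod 11) k, ψ.IsPrimitive ∧
      ∀ i, ∃ v, v ≠ 0 ∧ HasWeight ρ ψ (sqUnit i) v := by
  obtain ⟨z, hz⟩ := HasEnoughRootsOfUnity.exists_primitiveRoot k 11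
  have hψ := AddChar.zmodChar_primitive_of_primitive_root 11 hz
  obtain ⟨m, v, hm, hv0, hv⟩ := exists_weight hψ (upper_ne_one (ρ := ρ) h6)
  set φ := AddChar.zmodChar 11 ((IsPrimitiveRoot.iff_def z 11).mp hz).1
  -- Some nonzero weight `m` occurs; replacing the character by its shift by `m` normalises this
  -- weight to `1`, and the torus then produces all square weights.
  refine ⟨φ.mulShift m, ?_, fun i => ?_⟩
  · refine AddChar.IsPrimitive.of_ne_one fun h => hψ hm h
  · obtain ⟨w, hw, hw0⟩ := hv.exists_translate hv0 i
    refine ⟨w, hw0, fun x => ?_⟩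
    rw [hw x, AddChar.mulShift_apply, mul_assoc]

/-- One nonsquare weight would bring all five, hence ten independent vectors in dimension six. -/
theorem eq_zero_of_weight_neg [FiniteDimensional k V] (h6 : Module.finrank k V = 6)
    (hψ : ψ.IsPrimitive) {e : Fin 5 → V} (he0 : ∀ i, e i ≠ 0)
    (he : ∀ i, HasWeight ρ ψ (sqUnit i) (e i)) {i : Fin 5} {v : V}
    (hv : HasWeight ρ ψ (-sqUnit i) v) : v = 0 := by
  by_contra hv0
  choose w hw hw0 using hv.exists_translate hv0
  have hli : LinearIndependent k (Sum.elim e w) := by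
    refine linearIndependent_of_weights (ρ := ρ) (m := Sum.elim (fun j => (sqUnit j : ZMod 11))
      fun j => -sqUnit i * sqUnit j) hψ ?_ ?_ ?_
    · have h : ∀ i, Function.Injective (Sum.elim (fun j => (sqUnit j : ZMod 11))
          fun j => -sqUnit i * sqUnit j) := by decide
      exact h i
    · rintro (j | j)
      · exact he j
      · exact hw j
    · rintro (j | j)
      · exact he0 j
      · exact hw0 j
  have := hli.fintype_card_le_finrank
  rw [h6] at this
  simp at this

/-- Without weight zero, `V` would be the sum of five weight spaces permuted by the torus, so of
equal dimension; but `5` does not divide `6`. -/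
theorem exists_fixed_vector [CharZero k] [FiniteDimensional k V] (h6 : Module.finrank k V = 6)
    (hψ : ψ.IsPrimitive) (hs : ∀ i, ∃ v, v ≠ 0 ∧ HasWeight ρ ψ (sqUnit i) v) :
    ∃ v, v ≠ 0 ∧ HasWeight ρ ψ 0 v := by
  choose e he0 he using hs
  by_contra hne
  push Not at hne
  have hzero : ∀ v, HasWeight ρ ψ 0 v → v = 0 := fun v hv => by
    by_contra h
    exact hne v h hv
  have hneg := fun i v => eq_zero_of_weight_neg (ρ := ρ) h6 hψ he0 he (i := i) (v := v)
  let E : Fin 5 → Submodule k V := fun i => Module.End.eigenspace (ρ (upper 1)) (ψ (sqUnit i))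
  have hE : ∀ i v, v ∈ E i ↔ HasWeight ρ ψ (sqUnit i) v := by
    intro i v
    rw [Module.End.mem_eigenspace_iff]
    refine ⟨fun h x => ?_, fun h => by rw [h, mul_one]⟩
    have : ∀ n : ℕ, ρ (upper n) v = ψ (sqUnit i * n) • v := by
      intro n
      induction n with
      | zero => simp [upper_zero]
      | succ n ih =>
        rw [Nat.cast_succ, ← upper_mul, map_mul, Module.End.mul_apply, h, map_smul, ih, smul_smul,
          ← AddChar.map_add_eq_mul]
        congr 2
        ring
    have h1 := this x.val
    rwa [ZMod.natCast_val, ZMod.cast_id] at h1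
  have hind : iSupIndep E := (Module.End.eigenspaces_iSupIndep (ρ (upper 1))).comp
    ((primitive_injective hψ).comp sqUnit_injective)
  have htop : ⨆ i, E i = ⊤ := by
    rw [eq_top_iff]
    intro v _
    rw [← sum_weightProj (ρ := ρ) hψ v, sum_zmod, hzero _ (hasWeight_weightProj 0 v), zero_add]
    refine Submodule.sum_mem _ fun i _ => ?_
    rw [hneg i _ (hasWeight_weightProj _ v), add_zero]
    exact Submodule.mem_iSup_of_mem i ((hE i _).mpr (hasWeight_weightProj _ v))
  have hint := DirectSum.isInternal_submodule_of_iSupIndep_of_iSup_eq_top hind htop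
  have hdim := (LinearEquiv.ofBijective (DirectSum.coeLinearMap E) hint).finrank_eq
  rw [Module.finrank_directSum, h6] at hdim
  have hle : ∀ i j, Module.finrank k (E i) ≤ Module.finrank k (E j) := by
    intro i j
    obtain ⟨a, ha⟩ := exists_mul_self (j - i)
    have hij : (sqUnit j : ZMod 11) * (a * a) = sqUnit i := by
      have e1 : j = i + (j - i) := by abel
      rw [e1, sqUnit_add, Units.val_mul, mul_assoc, ← Units.val_mul a, ← Units.val_mul _ (a * a),
        ha, Units.val_one, mul_one]
    refine LinearMap.finrank_le_finrank_of_injective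
      (f := (ρ (torus a)).restrict fun v hv => (hE j _).mpr (((hE i v).mp hv).torus a hij)) ?_
    intro x y hxy
    exact Subtype.ext (rep_injective ρ (torus a) (congrArg Subtype.val hxy))
  have heq : ∀ i, Module.finrank k (E i) = Module.finrank k (E 0) := fun i =>
    le_antisymm (hle _ _) (hle _ _)
  simp only [heq, Finset.sum_const, Finset.card_univ, Fintype.card_fin, smul_eq_mul] at hdim
  omega

end Existence

/-! ### The normal form of a six-dimensional irreducible representation -/

section Frame

variable {k : Type*} [Field k] {V : Type*} [AddCommGroup V] [Module k V]
  {ρ : Representation k SL211 V} {ψ : AddChar (ZMod 11) k}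

theorem exists_weight_basis [FiniteDimensional k V] (h6 : Module.finrank k V = 6)
    (hψ : ψ.IsPrimitive) {e₀ : V} {e : Fin 5 → V} (h0 : e₀ ≠ 0) (hw0 : HasWeight ρ ψ 0 e₀)
    (he0 : ∀ i, e i ≠ 0) (he : ∀ i, HasWeight ρ ψ (sqUnit i) (e i)) :
    ∃ B : Module.Basis (Fin 6) k V, B 0 = e₀ ∧ ∀ i : Fin 5, B i.succ = e i := by
  have hli : LinearIndependent k (Fin.cons e₀ e : Fin 6 → V) := by
    refine linearIndependent_of_weights (ρ := ρ)
      (m := Fin.cons 0 fun i => (sqUnit i : ZMod 11)) hψ (by decide) (fun i => ?_) fun i => ?_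
    · induction i using Fin.cases with
      | zero => exact hw0
      | succ i => exact he i
    · induction i using Fin.cases with
      | zero => exact h0
      | succ i => exact he0 i
  refine ⟨basisOfLinearIndependentOfCardEqFinrank hli (by rw [h6]; rfl), ?_, fun i => ?_⟩ <;>
  · rw [coe_basisOfLinearIndependentOfCardEqFinrank]
    rfl

/-- The five square weights and weight zero exhaust the six dimensions, so the fixed vectors form a
line. -/
theorem eq_smul_of_weight_zero [CharZero k] [FiniteDimensional k V]
    (h6 : Module.finrank k V = 6) (hψ : ψ.IsPrimitive) {e₀ : V} {e : Fin 5 → V} (h0 : e₀ ≠ 0)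
    (hw0 : HasWeight ρ ψ 0 e₀) (he0 : ∀ i, e i ≠ 0) (he : ∀ i, HasWeight ρ ψ (sqUnit i) (e i))
    {v : V} (hv : HasWeight ρ ψ 0 v) : ∃ c : k, v = c • e₀ := by
  obtain ⟨B, hB0, hB⟩ := exists_weight_basis h6 hψ h0 hw0 he0 he
  refine ⟨B.coord 0 v, ?_⟩
  conv_lhs => rw [← hv.weightProj_self, ← B.sum_repr v]
  rw [map_sum, Fin.sum_univ_succ, hB0, map_smul, hw0.weightProj_self,
    Finset.sum_eq_zero fun i _ => ?_, add_zero]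
  · rfl
  · rw [map_smul, hB, (he i).weightProj_of_ne hψ (Units.ne_zero _), smul_zero]

/-- Every six-dimensional irreducible representation has a basis in normal form. -/
theorem exists_isWeylFrame [IsAlgClosed k] [CharZero k] [FiniteDimensional k V]
    (ρ : Representation k SL211 V) [ρ.IsIrreducible] (h6 : Module.finrank k V = 6) :
    ∃ (b : Module.Basis (Fin 6) k V) (z a : k), IsWeylFrame ρ b z a := by
  obtain ⟨ψ, hψ, hs⟩ := exists_weights (ρ := ρ) h6
  obtain ⟨e₀, h0, hw0⟩ := exists_fixed_vector h6 hψ hs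
  choose e he0 he using hs
  have hz := isPrimitiveRoot_of_isPrimitive hψ
  have hχ : ∀ t : (ZMod 11)ˣ, ∃ c : k, ρ (torus t) e₀ = c • e₀ := fun t =>
    eq_smul_of_weight_zero h6 hψ h0 hw0 he0 he (hw0.torus t (zero_mul _))
  choose χ hχ using hχ
  have hχmul : ∀ s t, χ (s * t) = χ s * χ t := by
    intro s t
    have h1 : ρ (torus (s * t)) e₀ = (χ s * χ t) • e₀ := by
      rw [← torus_mul, map_mul, Module.End.mul_apply, hχ, map_smul, hχ, smul_smul, mul_comm]
    rw [hχ] at h1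
    exact smul_left_injective k h0 h1
  have hχ1 : χ 1 = 1 := by
    have h1 := hχ 1
    rw [torus_one, map_one, Module.End.one_apply] at h1
    exact smul_left_injective k h0 (by simpa using h1.symm)
  let f : ZMod 11 → V := fun x => ρ (upper x) (ρ weyl e₀)
  have hupper : ∀ x, ρ (upper x) e₀ = e₀ := fun x => by
    rw [hw0 x, zero_mul, AddChar.map_zero_eq_one, one_smul]
  have hf0 : f 0 = ρ weyl e₀ := by
    show ρ (upper 0) _ = _
    rw [upper_zero, map_one, Module.End.one_apply]
  have hwf0 : ρ weyl (f 0) = χ (-1) • e₀ := by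
    rw [hf0, ← Module.End.mul_apply, ← map_mul, weyl_mul_weyl, ← torus_neg_one, hχ]
  have hwf : ∀ x : (ZMod 11)ˣ, ρ weyl (f x) = χ (-x) • f ↑(-x⁻¹) := by
    intro x
    show ρ weyl (ρ (upper x) (ρ weyl e₀)) = _
    rw [← Module.End.mul_apply, ← map_mul, ← Module.End.mul_apply, ← map_mul, weyl_upper_weyl,
      map_mul, Module.End.mul_apply, hupper, mul_assoc, torus_mul_weyl, map_mul,
      Module.End.mul_apply, map_mul, Module.End.mul_apply, hχ, map_smul, map_smul]
    have h1 : (-x⁻¹)⁻¹ = -x := by rw [inv_neg, inv_inv]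
    rw [h1]
  -- By the Bruhat relation the span of `e₀` and of the translates of `weyl e₀` is stable under both
  -- generators, hence everything by irreducibility.
  have hS : Submodule.span k (insert e₀ (Set.range f)) = ⊤ := by
    refine eq_top_of_generators (ρ := ρ) ?_ ?_ ?_
    · intro v hv
      refine (Submodule.map_span_le (ρ (upper 1)) _ _).mpr ?_ (Submodule.mem_map_of_mem hv)
      rintro _ (rfl | ⟨x, rfl⟩)
      · rw [hupper]
        exact Submodule.subset_span (Or.inl rfl)
      · refine Submodule.subset_span (Or.inr ⟨1 + x, ?_⟩)
        exact (upper_apply_upper 1 x _).symm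
    · intro v hv
      refine (Submodule.map_span_le (ρ weyl) _ _).mpr ?_ (Submodule.mem_map_of_mem hv)
      rintro _ (rfl | ⟨x, rfl⟩)
      · rw [← hf0]
        exact Submodule.subset_span (Or.inr ⟨0, rfl⟩)
      · by_cases hx : x = 0
        · rw [hx, hwf0]
          exact Submodule.smul_mem _ _ (Submodule.subset_span (Or.inl rfl))
        · have := hwf (Units.mk0 x hx)
          rw [Units.val_mk0] at this
          rw [this]
          exact Submodule.smul_mem _ _ (Submodule.subset_span (Or.inr ⟨_, rfl⟩))
    · exact fun h => h0 ((Submodule.mem_bot k).mp (h ▸ Submodule.subset_span (Or.inl rfl)))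
  -- The basis vectors of square weight are the components of `weyl e₀` itself, which makes the
  -- corresponding coordinates of that vector equal to `1`. They are nonzero because otherwise this
  -- weight would be missing from the spanning set.
  let g : Fin 5 → V := fun i => weightProj ρ ψ (sqUnit i) (f 0)
  have hg : ∀ i, HasWeight ρ ψ (sqUnit i) (g i) := fun i => hasWeight_weightProj _ _
  have hg0 : ∀ i, g i ≠ 0 := by
    intro i hi
    have hker : Submodule.span k (insert e₀ (Set.range f)) ≤
        LinearMap.ker (weightProj ρ ψ (sqUnit i)) := by
      rw [Submodule.span_le]
      rintro _ (rfl | ⟨x, rfl⟩)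
      · exact hw0.weightProj_of_ne hψ (Units.ne_zero _).symm
      · show weightProj ρ ψ (sqUnit i) (ρ (upper x) (ρ weyl e₀)) = 0
        rw [weightProj_upper, ← hf0]
        exact (congrArg _ hi).trans (smul_zero _)
    rw [hS] at hker
    have h1 := hker (Submodule.mem_top (x := e i))
    rw [LinearMap.mem_ker, (he i).weightProj_self] at h1
    exact he0 i h1
  obtain ⟨B, hB0, hB⟩ := exists_weight_basis h6 hψ h0 hw0 hg0 hg
  obtain ⟨a, ha⟩ := eq_smul_of_weight_zero h6 hψ h0 hw0 hg0 hg
    (hasWeight_weightProj (ρ := ρ) (ψ := ψ) 0 (f 0))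
  have hneg : ∀ i, weightProj ρ ψ (-sqUnit i) (f 0) = 0 := fun i =>
    eq_zero_of_weight_neg h6 hψ he0 he (hasWeight_weightProj _ _)
  have hf : f 0 = comb B a 1 := by
    rw [← sum_weightProj (ρ := ρ) hψ (f 0), sum_zmod, ha, comb, hB0]
    congr 1
    refine Finset.sum_congr rfl fun i _ => ?_
    rw [hneg, add_zero, hB, Pi.one_apply, one_smul]
  have hfx : ∀ x, f x = comb B a fun i => ψ (sqUnit i * x) := by
    intro x
    have h1 : f x = ρ (upper x) (f 0) := by rw [hf0]
    rw [h1, hf, comb, comb, map_add, map_smul, hB0, hupper, map_sum]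
    congr 1
    refine Finset.sum_congr rfl fun i _ => ?_
    rw [hB, map_smul, hg i x, Pi.one_apply, one_smul]
  -- The weights `0`, `-1` and `3 ^ i` give the three relations needed below; in weight `-1`, a
  -- nonsquare, the projection vanishes.
  have hfourier : ∀ m, (11 : k) • weightProj ρ ψ m (f 0) = f 0 +
      ∑ i, (ψ (-(m * sqUnit i)) • f (sqUnit i) + ψ (m * sqUnit i) • f (-sqUnit i)) := by
    intro m
    have h1 : ∀ x, ρ (upper x) (f 0) = f x := fun x => by rw [hf0]
    rw [weightProj_apply, smul_smul, mul_inv_cancel₀ (by norm_num), one_smul, sum_zmod]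
    simp only [h1, mul_zero, neg_zero, AddChar.map_zero_eq_one, one_smul, mul_neg, neg_neg]
  have hneg' : ∀ i, ((-sqUnit i : (ZMod 11)ˣ) : ZMod 11) = -sqUnit i := fun i => Units.val_neg _
  have hmul : ∀ i j, (sqUnit i * sqUnit j : ZMod 11) = sqUnit (i + j) := fun i j => by
    rw [sqUnit_add, Units.val_mul]
  obtain ⟨ha2, hW⟩ := weyl_apply_of_relations (B := B) (W := ρ weyl) hz (a := a) (ε := χ (-1))
    (θ := fun i => χ (sqUnit i)) (f := f 0) (p := fun i => f (sqUnit i))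
    (q := fun i => f (-sqUnit i)) hχ1 (fun i j => by rw [sqUnit_add, hχmul])
    (by rw [← hχmul, neg_mul_neg, mul_one, hχ1]) hf
    (fun j => by simp only [hfx, hmul, apply_sqUnit])
    (fun j => by simp only [hfx, mul_neg, hmul, apply_neg_sqUnit]) (by rw [hwf0, hB0])
    (fun j => by rw [hwf, ← hχmul, neg_one_mul, sqUnit_neg, Units.val_neg])
    (fun j => by rw [← hneg', hwf, neg_neg, sqUnit_neg, inv_neg, neg_neg])
    (by
      have h1 := hfourier 0
      rw [ha, smul_smul] at h1
      rw [hB0, h1]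
      simp)
    (by
      have h1 := hfourier (-1)
      have h2 := hneg 0
      have h3 : (-sqUnit 0 : ZMod 11) = -1 := by decide
      rw [h3] at h2
      rw [h2, smul_zero] at h1
      simpa only [neg_mul, one_mul, neg_neg, apply_sqUnit, apply_neg_sqUnit] using h1.symm)
    (fun i => by
      have h1 := hfourier (sqUnit i)
      rw [hB]
      simpa only [hmul, apply_sqUnit, apply_neg_sqUnit] using h1.symm)
    (by rw [hB0, hf0])
  have ha0 : a ≠ 0 := by
    rintro rfl
    norm_num at ha2
  -- Since `11 * a ^ 2 = -1`, replacing `e₀` by `-2 * a` times itself turns the coefficient `-2 /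
  -- 11` of `e₀` into `-a`, as the normal form requires.
  have hc0 : (-2 * a) • e₀ ≠ 0 := smul_ne_zero (mul_ne_zero (by norm_num) ha0) h0
  obtain ⟨b, hb0, hb⟩ := exists_weight_basis h6 hψ hc0 (hw0.smul _) hg0 hg
  refine ⟨b, ψ 1, a, hz, ha0, ?_, fun i => ?_, ?_, fun i => ?_⟩
  · rw [hb0, map_smul, hupper]
  · rw [hb, hg i, mul_one, apply_sqUnit]
  · rw [hb0, map_smul, ← hf0, hf, comb, hB0]
    simp only [hB, hb, Pi.one_apply, one_smul]
    module
  · have h11 : (11 : k) ≠ 0 := by norm_num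
    refine smul_right_injective V h11 ?_
    show (11 : k) • _ = (11 : k) • _
    have h1 := hW i
    rw [hB] at h1
    rw [hb, h1, hb0, comb, hB0]
    simp only [hB, hb]
    rw [smul_add, smul_add, ← neg_smul, smul_smul, smul_smul]
    congr 1
    · congr 1
      linear_combination (-2 : k) * ha2
    · simp only [Finset.smul_sum, smul_smul, mul_assoc]

end Frame

/-! ### Representations in which the central element acts as `-1` -/

/-- Conjugation by a torus element raises a transvection to its fourth power. In a commutative
target its image therefore has order dividing both `3` and `11`. -/
theorem monoidHom_eq_one {M : Type*} [CommMonoid M] (f : SL211 →* M) : f (upper 1) = 1 := by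
  have hu : IsUnit (f (upper 1)) := (Group.isUnit _).map f
  have ht : IsUnit (f (torus (Units.mk0 2 (by decide)))) := (Group.isUnit _).map f
  have h4 : f (upper 1) ^ 4 = f (upper 1) := by
    have h := congrArg f (torus_mul_upper (Units.mk0 2 (by decide)) 1)
    rw [map_mul, map_mul, mul_comm] at h
    have h1 := ht.mul_right_cancel h
    refine Eq.trans ?_ h1.symm
    rw [← map_pow, upper_pow]
    exact congrArg (fun x => f (upper x)) (by decide)
  have h11 : f (upper 1) ^ 11 = 1 := by
    rw [← map_pow, upper_pow]
    have : ((11 : ℕ) : ZMod 11) = 0 := by decide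
    rw [this, upper_zero, map_one]
  have h12 : f (upper 1) ^ 3 = 1 := hu.mul_right_cancel (by rw [← pow_succ, one_mul, h4])
  calc f (upper 1) = f (upper 1) ^ 11 * f (upper 1) := by rw [h11, one_mul]
    _ = (f (upper 1) ^ 3) ^ 4 := by rw [← pow_succ, ← pow_mul]
    _ = 1 := by rw [h12, one_pow]

theorem monoidHom_neg_one {M : Type*} [Monoid M] {f : SL211 →* M} (h : f (upper 1) = 1) :
    f (-1) = 1 := by
  rw [← weyl_mul_weyl, map_mul, weyl_eq_one h, one_mul]

section Odd

variable {k : Type*} [Field k] [CharZero k] {V : Type*} [AddCommGroup V]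
  [Module k V] [FiniteDimensional k V]

/-- The determinant is a homomorphism to a commutative monoid, hence trivial on the central element,
where it equals `(-1) ^ n`. -/
theorem even_finrank_of_neg_one {ρ : Representation k SL211 V} (h : ∀ v, ρ (-1) v = -v) :
    Even (Module.finrank k V) := by
  have h1 := monoidHom_neg_one (monoidHom_eq_one (LinearMap.det.comp ρ))
  have h2 : ρ (-1) = (-1 : k) • LinearMap.id := LinearMap.ext fun v => by simp [h]
  rw [MonoidHom.comp_apply, h2, LinearMap.det_smul, LinearMap.det_id, mul_one] at h1
  rcases Nat.even_or_odd (Module.finrank k V) with h3 | h3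
  · exact h3
  · rw [h3.neg_one_pow] at h1
    norm_num at h1

variable [IsAlgClosed k]

/-- The torus translates of a vector of nonzero weight give dimension at least five, and the
dimension is even. -/
theorem six_le_finrank_of_neg_one [Nontrivial V] {ρ : Representation k SL211 V}
    (h : ∀ v, ρ (-1) v = -v) : 6 ≤ Module.finrank k V := by
  have hu : ρ (upper 1) ≠ 1 := fun h1 => by
    obtain ⟨v, hv⟩ := exists_ne (0 : V)
    have h2 := h v
    rw [monoidHom_neg_one h1, Module.End.one_apply] at h2
    have h3 : (2 : k) • v = 0 := by rw [two_smul, ← eq_neg_iff_add_eq_zero]; exact h2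
    exact hv ((smul_eq_zero.mp h3).resolve_left two_ne_zero)
  obtain ⟨z, hz⟩ := HasEnoughRootsOfUnity.exists_primitiveRoot k 11
  have hψ := AddChar.zmodChar_primitive_of_primitive_root 11 hz
  obtain ⟨m, v, hm, hv0, hv⟩ := exists_weight hψ hu
  choose w hw hw0 using hv.exists_translate hv0
  have hli := linearIndependent_of_weights (ρ := ρ) (m := fun i => m * sqUnit i) hψ
    ((mul_right_injective₀ hm).comp sqUnit_injective) hw hw0
  have h5 := hli.fintype_card_le_finrank
  rw [Fintype.card_fin] at h5
  obtain ⟨r, hr⟩ := even_finrank_of_neg_one h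
  omega

theorem six_le_finrank_subrepresentation {ρ : Representation k SL211 V}
    (h : ∀ v, ρ (-1) v = -v) {S : Submodule k V} (hS : ∀ g, ∀ v ∈ S, ρ g v ∈ S) (h0 : S ≠ ⊥) :
    6 ≤ Module.finrank k S := by
  have : Nontrivial S := Submodule.nontrivial_iff_ne_bot.mpr h0
  exact six_le_finrank_of_neg_one
    (ρ := Subrepresentation.toRepresentation (ρ := ρ) ⟨S, fun g v hv => hS g v hv⟩)
    fun v => Subtype.ext (h v)

theorem isIrreducible_of_neg_one {ρ : Representation k SL211 V} (h : ∀ v, ρ (-1) v = -v)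
    (h6 : Module.finrank k V = 6) : ρ.IsIrreducible := by
  have : Nontrivial V := Module.nontrivial_of_finrank_pos (R := k) (by omega)
  have hs : IsSimpleOrder (Subrepresentation ρ) :=
    { exists_pair_ne := ⟨⊥, ⊤, fun h1 =>
        bot_ne_top (α := Submodule k V) (congrArg Subrepresentation.toSubmodule h1)⟩
      eq_bot_or_eq_top := fun S => by
        rw [or_iff_not_imp_left]
        intro hS
        have h1 := six_le_finrank_subrepresentation h (S := S.toSubmodule)
          (fun g v hv => S.apply_mem_toSubmodule g hv)
          fun h1 => hS (Subrepresentation.toSubmodule_injective h1)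
        refine Subrepresentation.toSubmodule_injective (Submodule.eq_top_of_finrank_eq ?_)
        have := S.toSubmodule.finrank_le
        omega }
  exact hs

/-- For an eigenvalue `c` of `T`, the kernel and the range of `T - c` are nonzero invariant
subspaces. Each has dimension at least six and the dimensions add up to at most twelve, so the
kernel has dimension six. -/
theorem exists_isIrreducible_of_commute {ρ : Representation k SL211 V}
    (h : ∀ v, ρ (-1) v = -v) (h12 : Module.finrank k V ≤ 12) {T : Module.End k V}
    (hT : ∀ g, Commute (ρ g) T) (hs : ∀ c : k, T ≠ c • LinearMap.id) :
    ∃ ρ' : Representation k SL211 (Fin 6 → k), ρ'.IsIrreducible := by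
  have hV : Nontrivial V := by
    by_contra hV
    rw [not_nontrivial_iff_subsingleton] at hV
    exact hs 0 (LinearMap.ext fun v => Subsingleton.elim _ _)
  obtain ⟨c, hc⟩ := Module.End.exists_eigenvalue T
  let R : Module.End k V := T - c • LinearMap.id
  have hR : ∀ g v, ρ g (R v) = R (ρ g v) := fun g v => by
    have := congrArg (fun f : Module.End k V => f v) (hT g).eq
    simp only [Module.End.mul_apply] at this
    simp [R, this]
  have hker : LinearMap.ker R ≠ ⊥ := by
    obtain ⟨v, hv⟩ := hc.exists_hasEigenvector
    intro h0
    have : v ∈ LinearMap.ker R := by simp [R, hv.apply_eq_smul]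
    rw [h0, Submodule.mem_bot] at this
    exact hv.2 this
  have hrange : LinearMap.range R ≠ ⊥ := fun h0 =>
    hs c (sub_eq_zero.mp (LinearMap.range_eq_bot.mp h0))
  have hstab : ∀ g, ∀ v ∈ LinearMap.ker R, ρ g v ∈ LinearMap.ker R := fun g v hv => by
    rw [LinearMap.mem_ker] at hv ⊢
    rw [← hR, hv, map_zero]
  have h1 := six_le_finrank_subrepresentation h hstab hker
  have h2 := six_le_finrank_subrepresentation h (S := LinearMap.range R)
    (by rintro g _ ⟨v, rfl⟩; exact ⟨ρ g v, (hR g v).symm⟩) hrange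
  have h3 := R.finrank_range_add_finrank_ker
  have h6 : Module.finrank k (LinearMap.ker R) = 6 := by omega
  let e : LinearMap.ker R ≃ₗ[k] (Fin 6 → k) := LinearEquiv.ofFinrankEq _ _ (by simp [h6])
  let τ : Representation k SL211 (LinearMap.ker R) :=
    Subrepresentation.toRepresentation (ρ := ρ) ⟨LinearMap.ker R, fun g v hv => hstab g v hv⟩
  refine ⟨e.conjRingEquiv.toMonoidHom.comp τ, isIrreducible_of_neg_one (fun v => ?_) (by simp)⟩
  have : τ (-1) (e.symm v) = -e.symm v := Subtype.ext (h _)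
  change e (τ (-1) (e.symm v)) = -v
  rw [this, map_neg, e.apply_symm_apply]

end Odd

/-! ### Functions on the plane -/

section Plane

variable (k : Type*) [Field k]

/-- The representation on the functions on the plane. -/
def planeRep : Representation k SL211 ((Fin 2 → ZMod 11) → k) where
  toFun g := LinearMap.funLeft k k fun v => (g⁻¹ : SL211).1.mulVec v
  map_one' := by ext; simp
  map_mul' g h := by
    refine LinearMap.ext fun f => funext fun v => ?_
    change f (((g * h)⁻¹ : SL211).1.mulVec v) = f ((h⁻¹ : SL211).1.mulVec ((g⁻¹ : SL211).1.mulVec v))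
    rw [Matrix.mulVec_mulVec, ← Matrix.SpecialLinearGroup.coe_mul, mul_inv_rev]

/-- The quadratic character. -/
def quadChar (x : ZMod 11) : k := ((quadraticChar (ZMod 11) x : ℤ) : k)

theorem quadChar_mul (x y : ZMod 11) : quadChar k (x * y) = quadChar k x * quadChar k y := by
  rw [quadChar, map_mul, Int.cast_mul, quadChar, quadChar]

theorem quadChar_neg_one : quadChar k (-1) = -1 := by
  have : quadraticChar (ZMod 11) (-1) = -1 := by decide
  simp [quadChar, this]

/-- The functions which are homogeneous for the quadratic character. -/
def homogeneousFunctions : Submodule k ((Fin 2 → ZMod 11) → k) where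
  carrier := {f | ∀ a v, f (a • v) = quadChar k a * f v}
  zero_mem' := by simp
  add_mem' {f g} hf hg a v := by simp [hf a v, hg a v, mul_add]
  smul_mem' c f hf a v := by simp [hf a v, mul_left_comm]

/-- The integral operator with kernel the quadratic character of the symplectic form. -/
def symplecticTransform : Module.End k ((Fin 2 → ZMod 11) → k) where
  toFun f v := ∑ w, quadChar k (v 0 * w 1 - v 1 * w 0) * f w
  map_add' f g := by ext; simp [mul_add, Finset.sum_add_distrib]
  map_smul' c f := by ext; simp [Finset.mul_sum, mul_left_comm]

variable {k}

theorem symplecticTransform_apply (f : (Fin 2 → ZMod 11) → k) (v : Fin 2 → ZMod 11) :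
    symplecticTransform k f v = ∑ w, quadChar k (v 0 * w 1 - v 1 * w 0) * f w := by
  rw [symplecticTransform, LinearMap.coe_mk, AddHom.coe_mk]

theorem mulVec_symplectic (g : SL211) (v w : Fin 2 → ZMod 11) :
    g.1.mulVec v 0 * g.1.mulVec w 1 - g.1.mulVec v 1 * g.1.mulVec w 0 = v 0 * w 1 - v 1 * w 0 := by
  have h := g.2
  rw [Matrix.det_fin_two] at h
  simp only [Matrix.mulVec, dotProduct, Fin.sum_univ_two]
  linear_combination (v 0 * w 1 - v 1 * w 0) * h

theorem planeRep_apply (g : SL211) (f : (Fin 2 → ZMod 11) → k) (v : Fin 2 → ZMod 11) :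
    planeRep k g f v = f ((g⁻¹ : SL211).1.mulVec v) := rfl

theorem mulVec_mulVec_inv (g : SL211) (v : Fin 2 → ZMod 11) :
    g.1.mulVec ((g⁻¹ : SL211).1.mulVec v) = v := by
  rw [Matrix.mulVec_mulVec, ← Matrix.SpecialLinearGroup.coe_mul, mul_inv_cancel,
    Matrix.SpecialLinearGroup.coe_one, Matrix.one_mulVec]

theorem mulVec_inv_mulVec (g : SL211) (v : Fin 2 → ZMod 11) :
    (g⁻¹ : SL211).1.mulVec (g.1.mulVec v) = v := by
  rw [Matrix.mulVec_mulVec, ← Matrix.SpecialLinearGroup.coe_mul, inv_mul_cancel,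
    Matrix.SpecialLinearGroup.coe_one, Matrix.one_mulVec]

theorem symplecticTransform_planeRep (g : SL211) (f : (Fin 2 → ZMod 11) → k) :
    symplecticTransform k (planeRep k g f) = planeRep k g (symplecticTransform k f) := by
  let E : (Fin 2 → ZMod 11) ≃ (Fin 2 → ZMod 11) :=
    ⟨g.1.mulVec, (g⁻¹ : SL211).1.mulVec, mulVec_inv_mulVec g, mulVec_mulVec_inv g⟩
  funext v
  rw [planeRep_apply, symplecticTransform_apply, symplecticTransform_apply, ← E.sum_comp]
  refine Finset.sum_congr rfl fun w _ => ?_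
  change _ * planeRep k g f (g.1.mulVec w) = _
  rw [planeRep_apply, mulVec_inv_mulVec]
  congr 2
  change v 0 * g.1.mulVec w 1 - v 1 * g.1.mulVec w 0 = _
  have h := mulVec_symplectic g ((g⁻¹ : SL211).1.mulVec v) w
  rwa [mulVec_mulVec_inv] at h

theorem planeRep_mem (g : SL211) {f : (Fin 2 → ZMod 11) → k} (hf : f ∈ homogeneousFunctions k) :
    planeRep k g f ∈ homogeneousFunctions k := fun a v => by
  rw [planeRep_apply, planeRep_apply, Matrix.mulVec_smul, hf]

theorem symplecticTransform_mem (f : (Fin 2 → ZMod 11) → k) :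
    symplecticTransform k f ∈ homogeneousFunctions k := fun a v => by
  rw [symplecticTransform_apply, symplecticTransform_apply, Finset.mul_sum]
  refine Finset.sum_congr rfl fun w _ => ?_
  rw [← mul_assoc, ← quadChar_mul, Pi.smul_apply, Pi.smul_apply, smul_eq_mul, smul_eq_mul]
  congr 2
  ring

/-- A homogeneous function is determined by its values at representatives of the twelve points of
the projective line over `𝔽₁₁`. -/
theorem finrank_homogeneousFunctions :
    Module.finrank k (homogeneousFunctions k) ≤ 12 := by
  let r : homogeneousFunctions k →ₗ[k] (Option (ZMod 11) → k) :=
    (LinearMap.funLeft k k fun x : Option (ZMod 11) => x.elim ![0, 1] fun y => ![1, y]).comp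
      (homogeneousFunctions k).subtype
  have hr : Function.Injective r := by
    rw [injective_iff_map_eq_zero]
    intro f hf
    ext v
    have h0 : f.1 ![0, 1] = 0 := congrFun hf none
    have h1 : ∀ y, f.1 ![1, y] = 0 := fun y => congrFun hf (some y)
    by_cases hv : v 0 = 0
    · have : v = v 1 • ![0, 1] := by
        ext i
        fin_cases i <;> simp [hv]
      rw [this, f.2, h0, mul_zero]
      rfl
    · have : v = v 0 • ![1, (v 0)⁻¹ * v 1] := by
        ext i
        fin_cases i <;> simp [hv]
      rw [this, f.2, h1, mul_zero]
      rfl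
  have := LinearMap.finrank_le_finrank_of_injective hr
  simpa using this

variable (k) in
/-- The quadratic character on the first axis, extended by zero. -/
def axisFunction (v : Fin 2 → ZMod 11) : k := if v 1 = 0 then quadChar k (v 0) else 0

theorem axisFunction_mem : axisFunction k ∈ homogeneousFunctions k := fun a v => by
  have h0 : quadChar k 0 = 0 := by simp [quadChar]
  by_cases ha : a = 0
  · simp [axisFunction, ha, h0]
  · simp [axisFunction, ha, quadChar_mul]

theorem axisFunction_apply : axisFunction k ![0, 1] = 0 := by simp [axisFunction]

/-- Only the ten nonzero points of the axis contribute, each with value `-1`. As `axisFunction`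
vanishes at this point, the transform is not a scalar. -/
theorem symplecticTransform_axisFunction :
    symplecticTransform k (axisFunction k) ![0, 1] = -10 := by
  rw [symplecticTransform_apply]
  have h : ∀ w : Fin 2 → ZMod 11, quadChar k ((![0, 1] : Fin 2 → ZMod 11) 0 * w 1 -
      (![0, 1] : Fin 2 → ZMod 11) 1 * w 0) * axisFunction k w =
      if w 1 = 0 then (if w 0 = 0 then 0 else -1) else 0 := by
    intro w
    have h1 : ∀ x : ZMod 11, quadraticChar (ZMod 11) (-x) * quadraticChar (ZMod 11) x =
      if x = 0 then 0 else -1 := by decide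
    have h2 : ∀ x : ZMod 11, quadChar k (-x) * quadChar k x = if x = 0 then 0 else -1 := by
      intro x
      rw [quadChar, quadChar, ← Int.cast_mul, h1]
      split_ifs <;> simp
    simp only [Matrix.cons_val_zero, Matrix.cons_val_one, zero_mul, one_mul, zero_sub,
      axisFunction, mul_ite, mul_zero, h2]
  rw [Finset.sum_congr rfl fun w _ => h w]
  rw [← (finTwoArrowEquiv (ZMod 11)).symm.sum_comp, Fintype.sum_prod_type]
  simp only [finTwoArrowEquiv_symm_apply]
  have hsum : ∀ x : ZMod 11, (∑ y : ZMod 11, if (![x, y] : Fin 2 → ZMod 11) 1 = 0 then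
      (if (![x, y] : Fin 2 → ZMod 11) 0 = 0 then (0 : k) else -1) else 0) =
      if x = 0 then 0 else -1 := fun x => by by_cases hx : x = 0 <;> simp [hx]
  refine (Finset.sum_congr rfl fun x _ => hsum x).trans ?_
  have h3 : (Finset.univ.filter fun x : ZMod 11 => ¬x = 0).card = 10 := by decide
  rw [Finset.sum_ite, Finset.sum_const_zero, Finset.sum_const, h3, zero_add, nsmul_eq_mul]
  norm_num

/-- The quadratic character is odd because `11` is congruent to `3` modulo `4`. -/
theorem planeRep_neg_one {f : (Fin 2 → ZMod 11) → k} (hf : f ∈ homogeneousFunctions k) :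
    planeRep k (-1) f = -f := by
  ext v
  have : ((-1 : SL211)⁻¹ : SL211).1.mulVec v = (-1 : ZMod 11) • v := by
    have h1 : (-1 : SL211)⁻¹ = -1 := by decide
    rw [h1]
    change (-(1 : Matrix (Fin 2) (Fin 2) (ZMod 11))).mulVec v = _
    rw [Matrix.neg_mulVec, Matrix.one_mulVec, neg_one_smul]
  rw [planeRep_apply, this, hf, quadChar_neg_one, neg_one_mul, Pi.neg_apply]

variable (k) in
-- The homogeneous functions form a principal series representation of dimension at most twelve; the
-- symplectic transform commutes with the group and is not scalar, so it splits off a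
-- six-dimensional piece.
theorem exists_isIrreducible [IsAlgClosed k] [CharZero k] :
    ∃ ρ : Representation k SL211 (Fin 6 → k), ρ.IsIrreducible := by
  let ρ : Representation k SL211 (homogeneousFunctions k) :=
    Subrepresentation.toRepresentation (ρ := planeRep k)
      ⟨homogeneousFunctions k, fun g _ hf => planeRep_mem g hf⟩
  let T : Module.End k (homogeneousFunctions k) :=
    (symplecticTransform k).restrict fun f _ => symplecticTransform_mem f
  refine exists_isIrreducible_of_commute (ρ := ρ) (fun f => Subtype.ext (planeRep_neg_one f.2))
    finrank_homogeneousFunctions (T := T) (fun g => LinearMap.ext fun f =>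
      Subtype.ext (symplecticTransform_planeRep g f.1).symm) fun c hc => ?_
  have h := congrArg Subtype.val
    (congrArg (fun f : Module.End k (homogeneousFunctions k) => f ⟨_, axisFunction_mem⟩) hc)
  have h1 := congrFun h ![0, 1]
  have h2 : symplecticTransform k (axisFunction k) ![0, 1] = c * axisFunction k ![0, 1] := h1
  rw [symplecticTransform_axisFunction, axisFunction_apply, mul_zero] at h2
  norm_num at h2

end Plane

/-! ### The invariant subspace as a subrepresentation -/

section Invariant

variable {k : Type*} [Field k] {V : Type*} [AddCommGroup V]
  [Module k V] {ρ : Representation k SL211 V} {b : Module.Basis (Fin 6) k V} {z a : k}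

/-- The space of skew forms of a Weyl frame. -/
noncomputable def IsWeylFrame.subrepresentation (h : IsWeylFrame ρ b z a) : Subrepresentation (formRep ρ) :=
  ⟨LinearMap.range (kleinMap b), fun g v hv => h.formRep_mem g v hv⟩

theorem IsWeylFrame.finrank_subrepresentation (h : IsWeylFrame ρ b z a) :
    Module.finrank k h.subrepresentation.toSubmodule = 5 := by
  refine (LinearMap.finrank_range_of_inj (isKleinFrame_kleinMap b).injective).trans ?_
  simp

theorem IsWeylFrame.toSubmodule_eq [CharZero k] (h : IsWeylFrame ρ b z a) (A : Subrepresentation (formRep ρ))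
    (hA : Module.finrank k A.toSubmodule = 5) :
    A.toSubmodule = LinearMap.range (kleinMap b) := by
  have hstab : ∀ g, ∀ η ∈ A.toSubmodule, η.compLinearMap (ρ g) ∈ A.toSubmodule := fun g η hη => by
    rw [← formRep_inv_apply]
    exact A.apply_mem_toSubmodule g⁻¹ hη
  exact h.eq_range_of_finrank (hstab _) (hstab _) hA

end Invariant

end KleinFano

open KleinFano in
theorem proposition4p1 {k : Type*} [Field k] [IsAlgClosed k] [CharZero k] :
    -- irreducible six-dimensional representations exist
    (∃ ρ : Representation k SL211 (Fin 6 → k), ρ.IsIrreducible) ∧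
    ∀ {V : Type*} [AddCommGroup V] [Module k V] [FiniteDimensional k V]
      (ρ : Representation k SL211 V) [ρ.IsIrreducible], Module.finrank k V = 6 →
      (∃! A : Subrepresentation (formRep ρ), Module.finrank k A.toSubmodule = 5) ∧
      ∀ A : Subrepresentation (formRep ρ), Module.finrank k A.toSubmodule = 5 →
        -- `Y` is the Klein cubic, up to a linear change of coordinates `k⁵ ≅ A`
        (∃ (e : (Fin 5 → k) →ₗ[k] (V [⋀^Fin 2]→ₗ[k] k)) (he : Function.Injective e),
          LinearMap.range e = A.toSubmodule ∧
          Projectivization.map e he '' kleinCubic k = pfaffianCubic A.toSubmodule) ∧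
        -- `Y × ℙ² × ℙ(V) ∼_G X × ℙ² × ℙ(V)`
        EquivariantlyBirational
          (prodAction (actionForms ρ) (1 : PSL211 →* Equiv.Perm (ℙ k (Fin 3 → k))) (actionV ρ))
          (pfaffianCubic A.toSubmodule ×ˢ Set.univ)
          (prodAction (actionBivectors ρ) (1 : PSL211 →* Equiv.Perm (ℙ k (Fin 3 → k)))
            (actionV ρ))
          (fanoThreefold A.toSubmodule ×ˢ Set.univ) := by
  refine ⟨exists_isIrreducible k, fun {V} _ _ _ ρ _ h6 => ?_⟩
  obtain ⟨b, z, a, h⟩ := exists_isWeylFrame ρ h6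
  refine ⟨⟨h.subrepresentation, h.finrank_subrepresentation, fun A hA =>
    Subrepresentation.toSubmodule_injective (h.toSubmodule_eq A hA)⟩, fun A hA => ?_⟩
  rw [h.toSubmodule_eq A hA]
  have hb := isKleinFrame_kleinMap b
  exact ⟨hb.image_kleinCubic, hb.equivariantlyBirational ρ h.formRep_mem⟩
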